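/- Let $\mu>0$, put $\beta=2\mu+\frac{\pi}{2}$, and for $\alpha>0$ write $I_\alpha=(-\alpha,\alpha)$ and $S_\alpha=\{\zeta\in\mathbb C:\operatorname{Im}\zeta\in I_\alpha\}$. Let $$D'_\mu=\{w\in\mathbb C^3:\ w_2\ne0,\ w_3\neq 0,\ \operatorname{Im}w_1-\log|w_2w_3|^2\in I_{\pi/2},\ \log|w_2|^2\in I_\mu,\ \log|w_3|^2\in I_\mu\}.$$ For $j,k\in\mathbb Z$ let $\mathcal H^{j,k}(D'_\mu)$ be the space of those $F$ in the Bergman space $A^2(D'_\mu)$ (holomorphic functions, square-integrable for Lebesgue measure) with $F(w_1,e^{i\theta}w_2,w_3)=e^{ij\theta}F(w)$ and $F(w_1,w_2,e^{i\theta}w_3)=e^{ik\theta}F(w)$ for all $\theta\in\mathbb R$. Define $\omega_{j,k}:S_\beta\to\mathbb R$ by $$\omega_{j,k}(x+iy)=\pi^2\,\bigl((e^{(j+1)(\cdot)}\chi_{I_\mu})*(e^{(k+1)(\cdot)}\chi_{I_\mu})*\chi_{I_{\pi/2}}\bigr)(y),$$ and let $A^2(S_\beta,\omega_{j,k})$ be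 the space of holomorphic $f$ on $S_\beta$ with $\int_{S_\beta}|f|^2\omega_{j,k}\,dV<\infty$, with inner product $\langle f,g\rangle=\int_{S_\beta} f\,\bar g\,\omega_{j,k}\,dV$. (1) For all $j,k\in\mathbb Z$ the rule $(L_{j,k}G)(w_1)=G(w_1,w_2,w_3)\,w_2^{-j}w_3^{-k}$ for $w\in D'_\mu$ (the right-hand side depends on $w_1$ only) defines an isometric isomorphism $L_{j,k}:\mathcal H^{j,k}(D'_\mu)\to A^2(S_\beta,\omega_{j,k})$ (a linear bijection preserving inner products). (2) For all $j,k\in\mathbb Z$ the space $A^2(S_\beta,\omega_{j,k})$ has a unique reproducing kernel $K_{\omega_{j,k}}$, and the reproducing kernel of $\mathcal H^{j,k}(D'_\mu)$ is $(w,w')\mapsto K_{\omega_{j,k}}(w_1,w_1')\,(w_2\overline{w_2'})^j\,(w_3\overline{w_3'})^k$. (3) For all $\zeta,\zeta'\in S_\beta$, $$K_{\omega_{-1,-1}}(\zeta,\zeta')=\int_{\mathbb R}\frac{\xi^3\,e^{i(\zeta-\bar\zeta')\xi}}{2\pi^3\sinh^2(2\mu\xi)\sinh(\pi\xi)}\,d\xi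 ,$$ the integral being absolutely convergent. (4) Let $\mu>\frac{\pi}{2}$ and put $\nu=\frac{\pi}{2\mu}$, $\nu'=\min\{2\nu,1\}$, $$C_\nu=-\frac{i\nu^5}{2\pi^5\sin(\nu\pi)},\qquad C_\nu'=\frac{i\nu^4}{2\pi^5}\,\frac{3-\nu\pi\cot(\nu\pi)}{\sin(\nu\pi)},$$ and let $m=0$ if $\mu<\pi$, $m=2$ if $\mu=\pi$, $m=1$ if $\mu>\pi$. Then $\nu<1$, $\nu<\nu'$ and, for $\tau=\zeta-\bar\zeta'$ with $\zeta,\zeta'\in S_\beta$, $$K_{\omega_{-1,-1}}(\zeta,\zeta')=2\pi i\,e^{-\tau\nu}\,(C_\nu\tau+C'_\nu)+O\bigl((1+|\operatorname{Re}\tau|)^m e^{-\nu'\operatorname{Re}\tau}\bigr)\quad\text{if }\operatorname{Re}\tau>0,$$ $$K_{\omega_{-1,-1}}(\zeta,\zeta')=-2\pi i\,e^{\tau\nu}\,(C_\nu\tau-C'_\nu)+O\bigl((1+|\operatorname{Re}\tau|)^m e^{\nu'\operatorname{Re}\tau}\bigr)\quad\text{if }\operatorname{Re}\tau<0.$$ Here,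 for every $\delta>0$, the implied constant can be chosen to depend only on $\mu$ and $\delta$, uniformly over all $\zeta,\zeta'\in S_\beta$ such that $|\operatorname{Re}\tau|\ge\delta$ or $|\operatorname{Im}\tau|\le2\beta-\delta$. -/

import Mathlib

open scoped ComplexConjugate

noncomputable section

namespace UnwoundWorm

/-- The Bergman space of the functions `F : Ω → ℂ` that are holomorphic on the (open) set `Ω` and
square-integrable on `Ω` with respect to the measure `m`. -/
def bergman {E : Type*} [NormedAddCommGroup E] [NormedSpace ℂ E] [MeasurableSpace E]
    (Ω : Set E) (m : MeasureTheory.Measure E) : Submodule ℂ (Ω → ℂ) where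
  carrier := {F | (∃ g : E → ℂ, DifferentiableOn ℂ g Ω ∧ ∀ z : Ω, F z = g z) ∧
    MeasureTheory.MemLp F 2 (m.comap (Subtype.val : Ω → E))}
  zero_mem' := ⟨⟨fun _ => 0, differentiableOn_const _, fun _ => rfl⟩,
    MeasureTheory.MemLp.zero⟩
  add_mem' := by
    rintro F G ⟨⟨f, hf, hF⟩, hF2⟩ ⟨⟨g, hg, hG⟩, hG2⟩
    exact ⟨⟨fun z => f z + g z, hf.add hg, fun z => by simp [hF z, hG z]⟩, hF2.add hG2⟩
  smul_mem' := by
    rintro c F ⟨⟨f, hf, hF⟩, hF2⟩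
    exact ⟨⟨fun z => c * f z, hf.const_mul c, fun z => by simp [hF z]⟩, hF2.const_smul c⟩

/-- The inner product `⟨F, G⟩ = ∫_Ω F conj(G) dm`. -/
def bergmanInner {E : Type*} [MeasurableSpace E] (Ω : Set E) (m : MeasureTheory.Measure E)
    (F G : Ω → ℂ) : ℂ :=
  ∫ z : Ω, F z * conj (G z) ∂(m.comap (Subtype.val : Ω → E))

/-- `K` is the reproducing kernel of the space `V` of functions on `Ω`, with the inner product of
`L²(Ω, m)`. -/
def IsReproducingKernel {E : Type*} [MeasurableSpace E] (Ω : Set E)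
    (m : MeasureTheory.Measure E) (V : Submodule ℂ (Ω → ℂ)) (K : Ω → Ω → ℂ) : Prop :=
  ∀ z' : Ω, (fun z => K z z') ∈ V ∧ ∀ F ∈ V, F z' = bergmanInner Ω m F (fun z => K z z')

/-- The strip `S_β = {ζ : Im ζ ∈ (-β, β)}`. -/
def strip (β : ℝ) : Set ℂ := {ζ | ζ.im ∈ Set.Ioo (-β) β}

/-- The unwound model domain `D'_μ ⊆ ℂ³`. The conditions `w₂ ≠ 0`, `w₃ ≠ 0` are implicit in
`log |w₂|², log |w₃|² ∈ (-μ, μ)`; they are explicit because of the convention `log 0 = 0`. -/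
def unwoundDomain (μ : ℝ) : Set (ℂ × ℂ × ℂ) :=
  {w | w.2.1 ≠ 0 ∧ w.2.2 ≠ 0 ∧
    w.1.im - Real.log (‖w.2.1 * w.2.2‖ ^ 2) ∈ Set.Ioo (-(Real.pi / 2)) (Real.pi / 2) ∧
    Real.log (‖w.2.1‖ ^ 2) ∈ Set.Ioo (-μ) μ ∧ Real.log (‖w.2.2‖ ^ 2) ∈ Set.Ioo (-μ) μ}

/-- The isotypic component `H^{j,k}(Ω)` of the (unweighted) Bergman space of `Ω ⊆ ℂ³`: the
functions with `F(w₁, e^{iθ}w₂, w₃) = e^{ijθ}F(w)` and `F(w₁, w₂, e^{iθ}w₃) = e^{ikθ}F(w)` for all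
real `θ`. -/
def isotypic (Ω : Set (ℂ × ℂ × ℂ)) (j k : ℤ) : Submodule ℂ (Ω → ℂ) where
  carrier := {F | F ∈ bergman Ω MeasureTheory.volume ∧
    (∀ (θ : ℝ) (w w' : Ω),
      w'.1 = (w.1.1, Complex.exp (Complex.I * θ) * w.1.2.1, w.1.2.2) →
        F w' = Complex.exp (Complex.I * j * θ) * F w) ∧
    (∀ (θ : ℝ) (w w' : Ω),
      w'.1 = (w.1.1, w.1.2.1, Complex.exp (Complex.I * θ) * w.1.2.2) →
        F w' = Complex.exp (Complex.I * k * θ) * F w)}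
  zero_mem' := ⟨Submodule.zero_mem _, by simp, by simp⟩
  add_mem' := by
    rintro F G ⟨hF, hF2, hF3⟩ ⟨hG, hG2, hG3⟩
    refine ⟨Submodule.add_mem _ hF hG, fun θ w w' h => ?_, fun θ w w' h => ?_⟩
    · simp only [Pi.add_apply, hF2 θ w w' h, hG2 θ w w' h, mul_add]
    · simp only [Pi.add_apply, hF3 θ w w' h, hG3 θ w w' h, mul_add]
  smul_mem' := by
    rintro c F ⟨hF, hF2, hF3⟩
    refine ⟨Submodule.smul_mem _ c hF, fun θ w w' h => ?_, fun θ w w' h => ?_⟩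
    · simp only [Pi.smul_apply, hF2 θ w w' h, smul_eq_mul, mul_left_comm]
    · simp only [Pi.smul_apply, hF3 θ w w' h, smul_eq_mul, mul_left_comm]

/-- The half-width `β = 2μ + π/2` of the strip attached to `D'_μ`. -/
def halfWidth (μ : ℝ) : ℝ := 2 * μ + Real.pi / 2

/-- Convolution of real functions on the line. -/
def conv (f g : ℝ → ℝ) : ℝ → ℝ :=
  MeasureTheory.convolution f g (ContinuousLinearMap.mul ℝ ℝ) MeasureTheory.volume

/-- The function `e^{a(·)} χ_{(-r, r)}` on the line. -/
def expCutoff (a r : ℝ) : ℝ → ℝ :=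
  Set.indicator (Set.Ioo (-r) r) (fun s => Real.exp (a * s))

/-- The weight
`ω_{j,k}(x + iy) = π² ((e^{(j+1)(·)} χ_{(-μ, μ)}) * (e^{(k+1)(·)} χ_{(-μ, μ)}) * χ_{(-π/2, π/2)})(y)`.
-/
def weight (μ : ℝ) (j k : ℤ) (ζ : ℂ) : ℝ :=
  Real.pi ^ 2 * conv (expCutoff ((j : ℝ) + 1) μ) (conv (expCutoff ((k : ℝ) + 1) μ)
    (Set.indicator (Set.Ioo (-(Real.pi / 2)) (Real.pi / 2)) (fun _ => 1))) ζ.im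

/-- The measure `ω_{j,k} dV` on `ℂ`. -/
def weightedVolume (μ : ℝ) (j k : ℤ) : MeasureTheory.Measure ℂ :=
  MeasureTheory.volume.withDensity fun ζ => ENNReal.ofReal (weight μ j k ζ)

/-- The weighted Bergman space `A²(S_β, ω_{j,k})`. -/
def weightedBergman (μ : ℝ) (j k : ℤ) : Submodule ℂ (strip (halfWidth μ) → ℂ) :=
  bergman (strip (halfWidth μ)) (weightedVolume μ j k)

/-- The first coordinate maps `D'_μ` into the strip `S_β`. -/
theorem fst_mem_strip {μ : ℝ} {w : ℂ × ℂ × ℂ} (hw : w ∈ unwoundDomain μ) :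
    w.1 ∈ strip (halfWidth μ) := by
  obtain ⟨h2, h3, h1, hl2, hl3⟩ := hw
  have hlog : Real.log (‖w.2.1 * w.2.2‖ ^ 2)
      = Real.log (‖w.2.1‖ ^ 2) + Real.log (‖w.2.2‖ ^ 2) := by
    rw [norm_mul, mul_pow, Real.log_mul (by simpa using h2) (by simpa using h3)]
  rw [hlog] at h1
  simp only [Set.mem_Ioo] at h1 hl2 hl3
  constructor <;> unfold halfWidth <;> linarith [h1.1, h1.2, hl2.1, hl2.2, hl3.1, hl3.2]

/-- The projection of `D'_μ` to the strip `S_β` on the first coordinate. -/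
def proj (μ : ℝ) (w : unwoundDomain μ) : strip (halfWidth μ) :=
  ⟨w.1.1, fst_mem_strip w.2⟩

/-- The integrand `ξ³ e^{iτξ} / (2π³ sinh²(2μξ) sinh(πξ))`, where `τ` stands for `ζ - conj ζ'`. -/
def kernelIntegrand (μ : ℝ) (τ : ℂ) (ξ : ℝ) : ℂ :=
  (ξ : ℂ) ^ 3 * Complex.exp (Complex.I * τ * ξ) /
    (2 * (Real.pi : ℂ) ^ 3 * (Real.sinh (2 * μ * ξ) : ℂ) ^ 2 * (Real.sinh (Real.pi * ξ) : ℂ))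

/-- `ν = π / (2μ)`. -/
def nu (μ : ℝ) : ℝ := Real.pi / (2 * μ)

/-- `ν' = min {2ν, 1}`. -/
def nu' (μ : ℝ) : ℝ := min (2 * nu μ) 1

/-- `C_ν = - i ν⁵ / (2π⁵ sin(νπ))`. -/
def coeffC (ν : ℝ) : ℂ :=
  -(Complex.I * (ν : ℂ) ^ 5 / (2 * (Real.pi : ℂ) ^ 5 * (Real.sin (ν * Real.pi) : ℂ)))

/-- `C'_ν = (i ν⁴ / (2π⁵)) (3 - νπ cot(νπ)) / sin(νπ)`. -/
def coeffC' (ν : ℝ) : ℂ :=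
  Complex.I * (ν : ℂ) ^ 4 / (2 * (Real.pi : ℂ) ^ 5) *
    (3 - (ν : ℂ) * (Real.pi : ℂ) * (Real.cot (ν * Real.pi) : ℂ)) / (Real.sin (ν * Real.pi) : ℂ)

open Classical in
/-- The degree of the polynomial factor of the remainder: `0` for `μ < π`, `2` for `μ = π` and `1`
for `μ > π`. -/
def remainderDegree (μ : ℝ) : ℕ :=
  if μ < Real.pi then 0 else if μ = Real.pi then 2 else 1

end UnwoundWorm

end

open UnwoundWorm

/-! Reduction to the strip. In logarithmic coordinates w₂ = e^a, w₃ = e^b the fibre of D'_μ over w₁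
= ζ is given by linear inequalities in Re a and Re b, so it is convex. If F has type (j, k), the
quotient F / (w₂^j w₃^k) is holomorphic and invariant under imaginary translations of a and b; its
derivative along the fibre therefore vanishes, and it depends on ζ only (`isotypic_fiber_eq`). In
polar coordinates with s = log |w₂|² and t = log |w₃|², the integral of |w₂^j w₃^k|² over the fibre
is the double convolution ω_{j,k}(Im ζ) (`lintegral_fiber`). Hence |w₂^j w₃^k|² dV pushes forward to
ω_{j,k} dV (`map_monomialMeasure`), which yields the isometry and transports reproducing kernels.

Kernel of the strip. This is a Paley–Wiener computation for an arbitrary weight ω(Im ζ). Put W(ξ) =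
∫ ω(y) e^{-2yξ} dy and k(τ) = ∫ e^{iτξ} / (2πW(ξ)) dξ. By Cauchy's theorem the Fourier transform of
u on the line Im z = y is e^{-yξ} times the one on ℝ. Pairing u with k(z - conj ζ') on each line and
then integrating in y produces the factor W(ξ), which cancels 1/W(ξ), and Fourier inversion leaves
u(ζ'). The computation is made for u with Gaussian decay; a general function is first multiplied by
exp(-δ(z² - ζ'²)), and δ tends to 0 (`IsStripWeight.reproducing`). For j = k = -1 the transform W is
π² times a product of three factors of the form sinh(cξ)/ξ, which is the formula of (3).

Asymptotics. For Re τ > 0 the line of integration is moved up to a height h > ν'. The double pole iν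
gives the principal term. The pole iν' has order m + 1 and gives a remainder with a polynomial
factor of degree m, and the integral on the new line is O(e^{-h Re τ}) (`exists_contour`). The
delicate point is uniformity as |Im τ| → 2β with |Re τ| ≥ δ, where the exponential decay of the
integrand is lost: there the leading part z³e^{-2βz} of the symbol is integrated exactly on each
half-line, and the remainder decays faster (`exists_norm_halfLine_le`). The case Re τ < 0 follows
because k is even. -/

namespace UnwoundWorm
open MeasureTheory Filter Topology Set
open scoped Interval

/-! ### Residues on rectangles and shifts of horizontal contours -/

/-- The integral of `F` along the boundary of the rectangle `[x₀, x₁] × [y₀, y₁]`. -/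
noncomputable def rectIntegral (F : ℂ → ℂ) (x₀ x₁ y₀ y₁ : ℝ) : ℂ :=
  (∫ x : ℝ in x₀..x₁, F (x + y₀ * Complex.I)) - (∫ x : ℝ in x₀..x₁, F (x + y₁ * Complex.I)) +
    Complex.I • (∫ y : ℝ in y₀..y₁, F (x₁ + y * Complex.I)) -
    Complex.I • (∫ y : ℝ in y₀..y₁, F (x₀ + y * Complex.I))

theorem rectIntegral_eq_zero {F : ℂ → ℂ} {x₀ x₁ y₀ y₁ : ℝ}
    (hF : DifferentiableOn ℂ F ([[x₀, x₁]] ×ℂ [[y₀, y₁]])) : rectIntegral F x₀ x₁ y₀ y₁ = 0 := by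
  simpa [rectIntegral] using Complex.integral_boundary_rect_eq_zero_of_differentiableOn F
    ⟨x₀, y₀⟩ ⟨x₁, y₁⟩ hF

/-- The boundary of the rectangle `[x₀, x₁] × [y₀, y₁]`. -/
def rectBoundary (x₀ x₁ y₀ y₁ : ℝ) : Set ℂ :=
  {z | (z.re ∈ Icc x₀ x₁ ∧ (z.im = y₀ ∨ z.im = y₁)) ∨
    (z.im ∈ Icc y₀ y₁ ∧ (z.re = x₀ ∨ z.re = x₁))}

section
variable {x₀ x₁ y₀ y₁ : ℝ} (hx : x₀ ≤ x₁) (hy : y₀ ≤ y₁)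
include hx hy

theorem rectIntegral_congr {F G : ℂ → ℂ} (h : EqOn F G (rectBoundary x₀ x₁ y₀ y₁)) :
    rectIntegral F x₀ x₁ y₀ y₁ = rectIntegral G x₀ x₁ y₀ y₁ := by
  unfold rectIntegral
  congr 1
  · congr 1
    · congr 1 <;>
      · refine intervalIntegral.integral_congr fun x hx' => h ?_
        rw [uIcc_of_le hx] at hx'
        left; simpa using hx'
    · congr 1
      refine intervalIntegral.integral_congr fun x hx' => h ?_
      rw [uIcc_of_le hy] at hx'
      right; simpa using hx'
  · congr 1
    refine intervalIntegral.integral_congr fun x hx' => h ?_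
    rw [uIcc_of_le hy] at hx'
    right; simpa using hx'

theorem rectIntegral_add {F G : ℂ → ℂ} (hF : ContinuousOn F (rectBoundary x₀ x₁ y₀ y₁))
    (hG : ContinuousOn G (rectBoundary x₀ x₁ y₀ y₁)) :
    rectIntegral (fun z => F z + G z) x₀ x₁ y₀ y₁
      = rectIntegral F x₀ x₁ y₀ y₁ + rectIntegral G x₀ x₁ y₀ y₁ := by
  have key1 : ∀ {F : ℂ → ℂ}, ContinuousOn F (rectBoundary x₀ x₁ y₀ y₁) → ∀ y, (y = y₀ ∨ y = y₁) →
      IntervalIntegrable (fun x : ℝ => F (x + y * Complex.I)) volume x₀ x₁ := by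
    intro F hF y h
    refine ContinuousOn.intervalIntegrable (hF.comp (by fun_prop) fun x hx' => ?_)
    rw [uIcc_of_le hx] at hx'
    left; simpa [h] using hx'
  have key2 : ∀ {F : ℂ → ℂ}, ContinuousOn F (rectBoundary x₀ x₁ y₀ y₁) → ∀ x, (x = x₀ ∨ x = x₁) →
      IntervalIntegrable (fun y : ℝ => F (x + y * Complex.I)) volume y₀ y₁ := by
    intro F hF y h
    refine ContinuousOn.intervalIntegrable (hF.comp (by fun_prop) fun x hx' => ?_)
    rw [uIcc_of_le hy] at hx'
    right; simpa [h] using hx'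
  unfold rectIntegral
  rw [intervalIntegral.integral_add (key1 hF _ (.inl rfl)) (key1 hG _ (.inl rfl)),
    intervalIntegral.integral_add (key1 hF _ (.inr rfl)) (key1 hG _ (.inr rfl)),
    intervalIntegral.integral_add (key2 hF _ (.inl rfl)) (key2 hG _ (.inl rfl)),
    intervalIntegral.integral_add (key2 hF _ (.inr rfl)) (key2 hG _ (.inr rfl))]
  simp only [smul_eq_mul]
  ring

end

theorem rectIntegral_const_mul (c : ℂ) (F : ℂ → ℂ) (x₀ x₁ y₀ y₁ : ℝ) :
    rectIntegral (fun z => c * F z) x₀ x₁ y₀ y₁ = c * rectIntegral F x₀ x₁ y₀ y₁ := by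
  simp only [rectIntegral, intervalIntegral.integral_const_mul, smul_eq_mul]
  ring

theorem integral_horizontal_eq_sub {f H : ℂ → ℂ} {a b y : ℝ} (hab : a ≤ b)
    (h : ∀ x ∈ Icc a b, HasDerivAt H (f (x + y * Complex.I)) (x + y * Complex.I))
    (hf : ∀ x ∈ Icc a b, ContinuousAt f (x + y * Complex.I)) :
    ∫ x : ℝ in a..b, f (x + y * Complex.I) = H (b + y * Complex.I) - H (a + y * Complex.I) := by
  refine intervalIntegral.integral_eq_sub_of_hasDerivAt
    (f := fun x : ℝ => H (x + y * Complex.I)) (fun x hx => ?_) ?_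
  · rw [uIcc_of_le hab] at hx
    have h1 : HasDerivAt (fun t : ℝ => (t : ℂ) + y * Complex.I) 1 x :=
      (Complex.ofRealCLM.hasDerivAt (x := x)).add_const _
    exact (by simpa using (h x hx).comp x h1 : HasDerivAt (H ∘ fun t : ℝ => (t : ℂ) + y * Complex.I) _ x)
  · refine ContinuousOn.intervalIntegrable fun x hx => ?_
    rw [uIcc_of_le hab] at hx
    exact (ContinuousAt.comp (f := fun t : ℝ => (t : ℂ) + y * Complex.I) (hf x hx)
      (by fun_prop)).continuousWithinAt

theorem integral_vertical_eq_sub {f H : ℂ → ℂ} {a b x : ℝ} (hab : a ≤ b)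
    (h : ∀ y ∈ Icc a b, HasDerivAt H (f (x + y * Complex.I)) (x + y * Complex.I))
    (hf : ∀ y ∈ Icc a b, ContinuousAt f (x + y * Complex.I)) :
    Complex.I • ∫ y : ℝ in a..b, f (x + y * Complex.I)
      = H (x + b * Complex.I) - H (x + a * Complex.I) := by
  rw [smul_eq_mul, ← intervalIntegral.integral_const_mul]
  refine intervalIntegral.integral_eq_sub_of_hasDerivAt
    (f := fun y : ℝ => H (x + y * Complex.I)) (fun y hy => ?_) ?_
  · rw [uIcc_of_le hab] at hy
    have h1 : HasDerivAt (fun t : ℝ => (x : ℂ) + t * Complex.I) Complex.I y := by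
      simpa using ((Complex.ofRealCLM.hasDerivAt (x := y)).mul_const Complex.I).const_add (x : ℂ)
    rw [mul_comm]
    exact (h y hy).comp y h1
  · refine ContinuousOn.intervalIntegrable fun y hy => ?_
    rw [uIcc_of_le hab] at hy
    exact ((ContinuousAt.comp (f := fun t : ℝ => (x : ℂ) + t * Complex.I) (hf y hy)
      (by fun_prop)).const_mul _ |>.continuousWithinAt)

/-- A quarter turn of the right half-plane does not cross the branch cut. This is the jump between
the primitives of two consecutive sides at a corner of the rectangle. -/
theorem log_mul_I_of_pos_of_neg {w : ℂ} (h1 : 0 < w.re) :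
    Complex.log (w * Complex.I) = Complex.log w + Real.pi / 2 * Complex.I := by
  have hw : w ≠ 0 := by rintro rfl; simp at h1
  have h3 := Complex.abs_arg_lt_pi_div_two_iff.2 (.inl h1)
  rw [abs_lt] at h3
  rw [Complex.log_mul hw Complex.I_ne_zero, Complex.log_I]
  rw [Complex.arg_I]
  constructor <;> linarith [h3.1, h3.2, Real.pi_pos]

variable {x₀ x₁ y₀ y₁ : ℝ} {p : ℂ}

/-- Each side lies in a half-plane bounded by a line through p, which one of the factors I, -I, 1,
-1 rotates onto the right half-plane. So log((z - p)c) is a primitive on that side, and the four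
corners contribute πi/2 each. -/
theorem rectIntegral_sub_inv (hx0 : x₀ < p.re) (hx1 : p.re < x₁) (hy0 : y₀ < p.im)
    (hy1 : p.im < y₁) :
    rectIntegral (fun z => (z - p)⁻¹) x₀ x₁ y₀ y₁ = 2 * Real.pi * Complex.I := by
  have hd : ∀ (c z : ℂ), c ≠ 0 → (z - p) * c ∈ Complex.slitPlane →
      HasDerivAt (fun z => Complex.log ((z - p) * c)) (z - p)⁻¹ z := by
    intro c z hc h
    have h2 := Complex.slitPlane_ne_zero h
    have h3 : z - p ≠ 0 := left_ne_zero_of_mul h2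
    have h4 : HasDerivAt (fun z => (z - p) * c) c z := by
      simpa using ((hasDerivAt_id z).sub_const p).mul_const c
    convert h4.clog h using 1
    field_simp
  have hc : ∀ z : ℂ, z - p ≠ 0 → ContinuousAt (fun z => (z - p)⁻¹) z := fun z hz =>
    ContinuousAt.inv₀ (by fun_prop) hz
  have hx : x₀ ≤ x₁ := (hx0.trans hx1).le
  have hy : y₀ ≤ y₁ := (hy0.trans hy1).le
  have hne : ∀ z : ℂ, (z.re ≠ p.re ∨ z.im ≠ p.im) → z - p ≠ 0 := by
    intro z hz h
    rw [sub_eq_zero] at h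
    subst h; simp at hz
  unfold rectIntegral
  rw [integral_horizontal_eq_sub (f := fun z => (z - p)⁻¹)
      (H := fun z => Complex.log ((z - p) * Complex.I)) hx
      (fun x _ => hd _ _ Complex.I_ne_zero (.inl (by simp; linarith)))
      (fun x _ => hc _ (hne _ (.inr (by simp; linarith)))),
    integral_horizontal_eq_sub (f := fun z => (z - p)⁻¹)
      (H := fun z => Complex.log ((z - p) * (-Complex.I))) hx
      (fun x _ => hd _ _ (by simp) (.inl (by simp; linarith)))
      (fun x _ => hc _ (hne _ (.inr (by simp; linarith)))),
    integral_vertical_eq_sub (f := fun z => (z - p)⁻¹)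
      (H := fun z => Complex.log ((z - p) * 1)) hy
      (fun x _ => hd _ _ (by simp) (.inl (by simp; linarith)))
      (fun x _ => hc _ (hne _ (.inl (by simp; linarith)))),
    integral_vertical_eq_sub (f := fun z => (z - p)⁻¹)
      (H := fun z => Complex.log ((z - p) * (-1))) hy
      (fun x _ => hd _ _ (by simp) (.inl (by simp; linarith)))
      (fun x _ => hc _ (hne _ (.inl (by simp; linarith))))]
  have e10 := log_mul_I_of_pos_of_neg (w := ((x₁ : ℂ) + y₀ * Complex.I - p) * 1)
    (by simp; linarith)
  have e11 := log_mul_I_of_pos_of_neg (w := ((x₁ : ℂ) + y₁ * Complex.I - p) * (-Complex.I))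
    (by simp; linarith)
  have e01 := log_mul_I_of_pos_of_neg (w := ((x₀ : ℂ) + y₁ * Complex.I - p) * (-1))
    (by simp; linarith)
  have e00 := log_mul_I_of_pos_of_neg (w := ((x₀ : ℂ) + y₀ * Complex.I - p) * Complex.I)
    (by simp; linarith)
  rw [mul_assoc] at e10 e11 e01 e00
  simp only [one_mul, mul_one, neg_mul, Complex.I_mul_I, neg_neg] at e10 e11 e01 e00 ⊢
  rw [e10, e11, e00, e01]
  ring

theorem rectIntegral_sub_inv_pow (n : ℕ) (hx0 : x₀ < p.re) (hx1 : p.re < x₁) (hy0 : y₀ < p.im)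
    (hy1 : p.im < y₁) :
    rectIntegral (fun z => ((z - p) ^ (n + 2))⁻¹) x₀ x₁ y₀ y₁ = 0 := by
  have hne : ∀ z : ℂ, (z.re ≠ p.re ∨ z.im ≠ p.im) → z - p ≠ 0 := by
    intro z hz h
    rw [sub_eq_zero] at h
    subst h; simp at hz
  have hd : ∀ z : ℂ, (z.re ≠ p.re ∨ z.im ≠ p.im) →
      HasDerivAt (fun z => -((n : ℂ) + 1)⁻¹ * ((z - p) ^ (n + 1))⁻¹) ((z - p) ^ (n + 2))⁻¹ z := by
    intro z hz
    have h := hne z hz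
    have h1 : HasDerivAt (fun z => z - p) 1 z := (hasDerivAt_id z).sub_const p
    have h2 : HasDerivAt (fun z => (z - p) ^ (n + 1)) _ z := h1.fun_pow (n + 1)
    refine ((h2.fun_inv (pow_ne_zero _ h)).const_mul (-((n : ℂ) + 1)⁻¹)).congr_deriv ?_
    have : (n : ℂ) + 1 ≠ 0 := by exact_mod_cast n.succ_ne_zero
    push_cast
    field_simp
    ring
  have hc : ∀ z : ℂ, (z.re ≠ p.re ∨ z.im ≠ p.im) →
      ContinuousAt (fun z => ((z - p) ^ (n + 2))⁻¹) z := fun z hz =>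
    ContinuousAt.inv₀ (by fun_prop) (pow_ne_zero _ (hne z hz))
  have hx : x₀ ≤ x₁ := (hx0.trans hx1).le
  have hy : y₀ ≤ y₁ := (hy0.trans hy1).le
  unfold rectIntegral
  rw [integral_horizontal_eq_sub (f := fun z => ((z - p) ^ (n + 2))⁻¹) hx
      (fun x _ => hd _ (.inr (by simp; linarith))) (fun x _ => hc _ (.inr (by simp; linarith))),
    integral_horizontal_eq_sub (f := fun z => ((z - p) ^ (n + 2))⁻¹) hx
      (fun x _ => hd _ (.inr (by simp; linarith))) (fun x _ => hc _ (.inr (by simp; linarith))),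
    integral_vertical_eq_sub (f := fun z => ((z - p) ^ (n + 2))⁻¹) hy
      (fun x _ => hd _ (.inl (by simp; linarith))) (fun x _ => hc _ (.inl (by simp; linarith))),
    integral_vertical_eq_sub (f := fun z => ((z - p) ^ (n + 2))⁻¹) hy
      (fun x _ => hd _ (.inl (by simp; linarith))) (fun x _ => hc _ (.inl (by simp; linarith)))]
  ring

/-- The `n`-th Taylor coefficient at `p`. -/
noncomputable def taylorCoeff (p : ℂ) (n : ℕ) (G : ℂ → ℂ) : ℂ := ((fun H => dslope H p)^[n] G) p

theorem taylorCoeff_succ (p : ℂ) (n : ℕ) (G : ℂ → ℂ) :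
    taylorCoeff p (n + 1) G = taylorCoeff p n (dslope G p) := by
  simp [taylorCoeff, Function.iterate_succ_apply]

theorem taylorCoeff_one (p : ℂ) (G : ℂ → ℂ) : taylorCoeff p 1 G = deriv G p := by
  simp [taylorCoeff]

/-- On the circle of radius r a divided difference of G is at most 2M/r, and the maximum principle
carries this bound to the disc. Iterating loses a factor 2 per step against Cauchy's estimate, which
is harmless here. -/
theorem norm_taylorCoeff_le {p : ℂ} {r M : ℝ} (hr : 0 < r) (n : ℕ) {G : ℂ → ℂ} {U : Set ℂ}
    (hU : IsOpen U) (hG : DifferentiableOn ℂ G U) (hpU : Metric.closedBall p r ⊆ U)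
    (hM : ∀ z ∈ Metric.closedBall p r, ‖G z‖ ≤ M) :
    ‖taylorCoeff p n G‖ ≤ M * (2 / r) ^ n := by
  have hpm : p ∈ Metric.closedBall p r := Metric.mem_closedBall_self hr.le
  induction n generalizing G M with
  | zero => simpa [taylorCoeff] using hM p hpm
  | succ n ih =>
    have hd : DifferentiableOn ℂ (dslope G p) U :=
      (Complex.differentiableOn_dslope (hU.mem_nhds (hpU hpm))).2 hG
    rw [taylorCoeff_succ]
    refine (ih hd (M := M * (2 / r)) fun z hz => ?_).trans_eq (by rw [pow_succ]; ring)
    have hb : Bornology.IsBounded (Metric.ball p r) := Metric.isBounded_ball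
    have hcl : closure (Metric.ball p r) = Metric.closedBall p r := closure_ball _ hr.ne'
    refine Complex.norm_le_of_forall_mem_frontier_norm_le hb
      ((hd.mono (hcl ▸ hpU)).diffContOnCl) (fun w hw => ?_) (hcl ▸ hz)
    rw [frontier_ball _ hr.ne', mem_sphere_iff_norm] at hw
    have hwp : w ≠ p := by rintro rfl; simp at hw; linarith
    rw [dslope_of_ne _ hwp, slope_def_field, norm_div, hw]
    have h1 := hM w (by simp [Metric.mem_closedBall, dist_eq_norm, hw])
    have h2 := hM p hpm
    rw [div_le_iff₀ hr]
    calc _ ≤ _ := norm_sub_le _ _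
      _ ≤ M * (2 / r) * r := by rw [mul_assoc, div_mul_cancel₀ _ hr.ne']; linarith

/-- The residue theorem for one pole in a rectangle. -/
theorem rectIntegral_div_pow (n : ℕ) {G : ℂ → ℂ} {U : Set ℂ} (hU : IsOpen U)
    (hG : DifferentiableOn ℂ G U) (hR : [[x₀, x₁]] ×ℂ [[y₀, y₁]] ⊆ U)
    (hx0 : x₀ < p.re) (hx1 : p.re < x₁) (hy0 : y₀ < p.im) (hy1 : p.im < y₁) :
    rectIntegral (fun z => G z * ((z - p) ^ (n + 1))⁻¹) x₀ x₁ y₀ y₁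
      = 2 * Real.pi * Complex.I * taylorCoeff p n G := by
  have hx : x₀ ≤ x₁ := (hx0.trans hx1).le
  have hy : y₀ ≤ y₁ := (hy0.trans hy1).le
  have hp : p ∈ U := hR (by
    rw [Complex.mem_reProdIm, uIcc_of_le hx, uIcc_of_le hy]
    exact ⟨⟨hx0.le, hx1.le⟩, ⟨hy0.le, hy1.le⟩⟩)
  have hbU : rectBoundary x₀ x₁ y₀ y₁ ⊆ U := by
    refine subset_trans ?_ hR
    rw [uIcc_of_le hx, uIcc_of_le hy]
    rintro z (⟨h1, h2 | h2⟩ | ⟨h1, h2 | h2⟩) <;> simp only [Complex.mem_reProdIm, h1, h2, and_true, left_mem_Icc, right_mem_Icc, hx, hy]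
  have hbp : ∀ z ∈ rectBoundary x₀ x₁ y₀ y₁, z - p ≠ 0 := by
    rintro z hz h
    rw [sub_eq_zero] at h
    subst h
    rcases hz with ⟨h1, h2 | h2⟩ | ⟨h1, h2 | h2⟩ <;> linarith
  have hci : ∀ m : ℕ, ContinuousOn (fun z => ((z - p) ^ m)⁻¹) (rectBoundary x₀ x₁ y₀ y₁) :=
    fun m => ContinuousOn.inv₀ (by fun_prop) fun z hz => pow_ne_zero _ (hbp z hz)
  -- Writing G(z) = G(p) + (z - p) · `dslope G p z` lowers the order of the pole by one. The term
  -- with G(p) contributes only when the pole is simple.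
  induction n generalizing G with
  | zero =>
    have hd : DifferentiableOn ℂ (dslope G p) U :=
      (Complex.differentiableOn_dslope (hU.mem_nhds hp)).2 hG
    have e : EqOn (fun z => G z * ((z - p) ^ (0 + 1))⁻¹)
        (fun z => G p * (z - p)⁻¹ + dslope G p z) (rectBoundary x₀ x₁ y₀ y₁) := by
      intro z hz
      have h1 := hbp z hz
      have h2 : z ≠ p := sub_ne_zero.1 h1
      simp only [dslope_of_ne _ h2, slope_def_field]
      field_simp
      ring
    rw [rectIntegral_congr hx hy e, rectIntegral_add hx hy _ (hd.continuousOn.mono hbU),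
      rectIntegral_const_mul, rectIntegral_sub_inv hx0 hx1 hy0 hy1,
      rectIntegral_eq_zero (hd.mono hR)]
    · simp [taylorCoeff]; ring
    · have := (continuousOn_const (c := G p)).mul (hci 1)
      simp only [pow_one] at this
      exact this
  | succ n ih =>
    have hd : DifferentiableOn ℂ (dslope G p) U :=
      (Complex.differentiableOn_dslope (hU.mem_nhds hp)).2 hG
    have e : EqOn (fun z => G z * ((z - p) ^ (n + 1 + 1))⁻¹)
        (fun z => G p * ((z - p) ^ (n + 2))⁻¹ + dslope G p z * ((z - p) ^ (n + 1))⁻¹)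
        (rectBoundary x₀ x₁ y₀ y₁) := by
      intro z hz
      have h1 := hbp z hz
      have h2 : z ≠ p := sub_ne_zero.1 h1
      simp only [dslope_of_ne _ h2, slope_def_field]
      field_simp
      ring
    rw [rectIntegral_congr hx hy e, rectIntegral_add hx hy, rectIntegral_const_mul,
      rectIntegral_sub_inv_pow n hx0 hx1 hy0 hy1, ih hd, taylorCoeff_succ]
    · simp
    · exact continuousOn_const.mul (hci _)
    · exact (hd.continuousOn.mono hbU).mul (hci _)

/-- The vertical sides have fixed length and the integrand on them is at most B(T) → 0, so only the
two horizontal lines survive. -/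
theorem tendsto_rectIntegral {F : ℂ → ℂ} {a b : ℝ} (hab : a ≤ b) {B : ℝ → ℝ} {T₀ : ℝ}
    (hB : Tendsto B atTop (𝓝 0)) (hFB : ∀ z : ℂ, z.im ∈ Icc a b → T₀ ≤ |z.re| → ‖F z‖ ≤ B |z.re|)
    (ha : Integrable fun x : ℝ => F (x + a * Complex.I))
    (hb : Integrable fun x : ℝ => F (x + b * Complex.I)) :
    Tendsto (fun T : ℝ => rectIntegral F (-T) T a b) atTop
      (𝓝 ((∫ x : ℝ, F (x + a * Complex.I)) - ∫ x : ℝ, F (x + b * Complex.I))) := by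
  have hv : ∀ s : ℝ → ℝ, (∀ T, |s T| = |T|) → Tendsto (fun T : ℝ =>
      Complex.I • (∫ y : ℝ in a..b, F ((s T : ℝ) + y * Complex.I))) atTop (𝓝 0) := by
    intro s hs
    have h0 : Tendsto (fun T => B T * |b - a|) atTop (𝓝 0) := by simpa using hB.mul_const |b - a|
    refine squeeze_zero_norm' ?_ h0
    filter_upwards [eventually_ge_atTop 0, eventually_ge_atTop T₀] with T hT hT0
    rw [norm_smul, Complex.norm_I, one_mul]
    refine intervalIntegral.norm_integral_le_of_norm_le_const fun y hy => ?_
    rw [uIoc_of_le hab] at hy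
    have := hFB ((s T : ℝ) + y * Complex.I) (by simpa using ⟨hy.1.le, hy.2⟩)
      (by simpa [hs, abs_of_nonneg hT] using hT0)
    simpa [hs, abs_of_nonneg hT] using this
  have h1 := intervalIntegral_tendsto_integral ha tendsto_neg_atTop_atBot tendsto_id
  have h2 := intervalIntegral_tendsto_integral hb tendsto_neg_atTop_atBot tendsto_id
  have := ((h1.sub h2).add (hv (fun T => T) fun _ => rfl)).sub
    (hv (fun T => -T) fun T => abs_neg T)
  simp only [add_zero, sub_zero] at this
  exact this

/-- Shift of the line of integration through a strip without poles. -/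
theorem integral_line_eq {F : ℂ → ℂ} {a b : ℝ} (hab : a ≤ b) {B : ℝ → ℝ} {T₀ : ℝ}
    (hB : Tendsto B atTop (𝓝 0)) (hFB : ∀ z : ℂ, z.im ∈ Icc a b → T₀ ≤ |z.re| → ‖F z‖ ≤ B |z.re|)
    (ha : Integrable fun x : ℝ => F (x + a * Complex.I))
    (hb : Integrable fun x : ℝ => F (x + b * Complex.I))
    (hF : DifferentiableOn ℂ F {z | z.im ∈ Icc a b}) :
    ∫ x : ℝ, F (x + a * Complex.I) = ∫ x : ℝ, F (x + b * Complex.I) := by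
  refine sub_eq_zero.1 (tendsto_nhds_unique (tendsto_rectIntegral hab hB hFB ha hb) ?_)
  refine tendsto_const_nhds.congr fun T => (rectIntegral_eq_zero (hF.mono ?_)).symm
  intro z hz
  rw [Complex.mem_reProdIm, uIcc_of_le hab] at hz
  exact hz.2

/-- Shift of the line of integration across one pole. -/
theorem integral_line_sub_integral_line {F G : ℂ → ℂ} {a b : ℝ} {B : ℝ → ℝ} {T₀ : ℝ}
    (hB : Tendsto B atTop (𝓝 0))
    (hFB : ∀ z : ℂ, z.im ∈ Icc a b → T₀ ≤ |z.re| → ‖F z‖ ≤ B |z.re|)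
    (ha : Integrable fun x : ℝ => F (x + a * Complex.I))
    (hb : Integrable fun x : ℝ => F (x + b * Complex.I)) (n : ℕ) {U : Set ℂ} (hU : IsOpen U)
    (hG : DifferentiableOn ℂ G U) (hUab : {z : ℂ | z.im ∈ Icc a b} ⊆ U) (hpa : a < p.im)
    (hpb : p.im < b)
    (hFG : ∀ z : ℂ, z.im ∈ Icc a b → z ≠ p → F z = G z * ((z - p) ^ (n + 1))⁻¹) :
    (∫ x : ℝ, F (x + a * Complex.I)) - ∫ x : ℝ, F (x + b * Complex.I)
      = 2 * Real.pi * Complex.I * taylorCoeff p n G := by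
  have hab : a ≤ b := (hpa.trans hpb).le
  refine tendsto_nhds_unique (tendsto_rectIntegral hab hB hFB ha hb)
    (tendsto_const_nhds.congr' ?_)
  filter_upwards [eventually_gt_atTop |p.re|] with T hT
  have hTp := abs_lt.1 hT
  have hT0 : 0 ≤ T := (abs_nonneg _).trans hT.le
  have hsub : [[-T, T]] ×ℂ [[a, b]] ⊆ {z : ℂ | z.im ∈ Icc a b} := by
    intro z hz
    rw [Complex.mem_reProdIm, uIcc_of_le hab] at hz
    exact hz.2
  rw [← rectIntegral_div_pow n hU hG (hsub.trans hUab) hTp.1 hTp.2 hpa hpb]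
  refine (rectIntegral_congr (F := F) (by linarith) hab fun z hz => hFG z ?_ ?_).symm
  · rcases hz with ⟨h1, h2 | h2⟩ | ⟨h1, h2 | h2⟩
    · rw [h2]; exact ⟨le_rfl, hab⟩
    · rw [h2]; exact ⟨hab, le_rfl⟩
    · exact h1
    · exact h1
  · rintro rfl
    rcases hz with ⟨h1, h2 | h2⟩ | ⟨h1, h2 | h2⟩ <;> linarith

end UnwoundWorm

/-! ### The Laplace transform of a strip weight and the associated kernel function -/

namespace UnwoundWorm
open MeasureTheory Filter Topology Set
open scoped Interval

/-- Continuous functions on the line that are positive exactly on `(-β, β)`. -/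
structure IsStripWeight (β : ℝ) (ω : ℝ → ℝ) : Prop where
  beta_pos : 0 < β
  continuous : Continuous ω
  pos : ∀ y ∈ Ioo (-β) β, 0 < ω y
  zero : ∀ y ∉ Ioo (-β) β, ω y = 0

/-- The two-sided Laplace transform `ξ ↦ ∫ ω(y) e^{-2yξ} dy`. -/
noncomputable def lap (ω : ℝ → ℝ) (ξ : ℝ) : ℝ := ∫ y : ℝ, ω y * Real.exp (-2 * y * ξ)

/-- The function `k` such that `k(ζ - conj ζ')` is the reproducing kernel of the weighted
Bergman space of a strip. -/
noncomputable def stripKernel (ω : ℝ → ℝ) (τ : ℂ) : ℂ :=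
  ∫ ξ : ℝ, Complex.exp (Complex.I * τ * ξ) / (2 * Real.pi * lap ω ξ : ℝ)

theorem norm_exp_I_mul (τ : ℂ) (ξ : ℝ) :
    ‖Complex.exp (Complex.I * τ * ξ)‖ = Real.exp (-τ.im * ξ) := by
  rw [Complex.norm_exp]; simp

theorem integrable_exp_neg_mul_abs {a : ℝ} (ha : 0 < a) :
    Integrable fun x : ℝ => Real.exp (-a * |x|) := by
  have h1 : IntegrableOn (fun x : ℝ => Real.exp (-a * |x|)) (Ioi 0) := by
    refine (integrableOn_exp_mul_Ioi (neg_lt_zero.2 ha) 0).congr_fun (fun x hx => ?_)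
      measurableSet_Ioi
    simp [abs_of_pos (mem_Ioi.1 hx)]
  have h2 : IntegrableOn (fun x : ℝ => Real.exp (-a * |x|)) (Iic 0) := by
    refine (integrableOn_exp_mul_Iic ha 0).congr_fun (fun x hx => ?_) measurableSet_Iic
    simp [abs_of_nonpos (mem_Iic.1 hx)]
  rw [← integrableOn_univ, ← Iic_union_Ioi (a := (0 : ℝ))]
  exact h2.union h1

namespace IsStripWeight
variable {β : ℝ} {ω : ℝ → ℝ} (h : IsStripWeight β ω)
include h

theorem nonneg (y : ℝ) : 0 ≤ ω y := by
  by_cases hy : y ∈ Ioo (-β) β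
  · exact (h.pos y hy).le
  · exact (h.zero y hy).ge

theorem hasCompactSupport : HasCompactSupport ω :=
  HasCompactSupport.intro (isCompact_Icc (a := -β) (b := β)) fun y hy =>
    h.zero y fun hy' => hy ⟨hy'.1.le, hy'.2.le⟩

theorem exists_pos_le {b : ℝ} (hb : b < β) : ∃ c, 0 < c ∧ ∀ y ∈ Icc (-b) b, c ≤ ω y := by
  by_cases hb0 : 0 ≤ b
  · obtain ⟨y, hy, hmin⟩ := isCompact_Icc.exists_isMinOn (s := Icc (-b) b) ⟨0, by simpa⟩
      h.continuous.continuousOn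
    exact ⟨ω y, h.pos y ⟨by linarith [hy.1], by linarith [hy.2]⟩, fun z hz => hmin hz⟩
  · exact ⟨1, one_pos, fun y hy => absurd (hy.1.trans hy.2) (by linarith)⟩

theorem integrable_mul {g : ℝ → ℝ} (hg : Continuous g) : Integrable fun y => ω y * g y :=
  (h.continuous.mul hg).integrable_of_hasCompactSupport h.hasCompactSupport.mul_right

/-- Only the part of the support near the end where -yξ > 0 is kept: for y between b and b' in
absolute value, with b < b' < β, the weight is bounded below and e^{-2yξ} ≥ e^{2b|ξ|}. This growth
makes the kernel integral converge for |Im τ| < 2β. -/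
theorem lap_lower {b : ℝ} (hb0 : 0 < b) (hb : b < β) :
    ∃ c, 0 < c ∧ ∀ ξ, c * Real.exp (2 * b * |ξ|) ≤ lap ω ξ := by
  obtain ⟨b', hb1, hb2⟩ := exists_between hb
  obtain ⟨c, hc, hcω⟩ := h.exists_pos_le hb2
  refine ⟨c * (b' - b), mul_pos hc (by linarith), fun ξ => ?_⟩
  have key : ∀ s : Set ℝ, MeasurableSet s → volume s = ENNReal.ofReal (b' - b) → s ⊆ Icc (-b') b' →
      (∀ y ∈ s, b * |ξ| ≤ -y * ξ) → c * (b' - b) * Real.exp (2 * b * |ξ|) ≤ lap ω ξ := by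
    intro s hs hvol hsub hle
    have hi : Integrable fun y => ω y * Real.exp (-2 * y * ξ) := h.integrable_mul (by fun_prop)
    calc c * (b' - b) * Real.exp (2 * b * |ξ|) = ∫ y in s, c * Real.exp (2 * b * |ξ|) := by
          rw [setIntegral_const, measureReal_def, hvol, ENNReal.toReal_ofReal (by linarith),
            smul_eq_mul]; ring
      _ ≤ ∫ y in s, ω y * Real.exp (-2 * y * ξ) := by
          refine setIntegral_mono_on (integrableOn_const (by simp [hvol])) hi.integrableOn hs
            fun y hy => ?_
          exact mul_le_mul (hcω y (hsub hy)) (Real.exp_le_exp.2 (by linarith [hle y hy]))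
            (Real.exp_pos _).le (h.nonneg y)
      _ ≤ _ := setIntegral_le_integral hi
          (Eventually.of_forall fun y => mul_nonneg (h.nonneg y) (Real.exp_pos _).le)
  rcases le_total 0 ξ with hξ | hξ
  · refine key (Icc (-b') (-b)) measurableSet_Icc (by rw [Real.volume_Icc]; ring_nf)
      (fun y hy => ⟨hy.1, by linarith [hy.2]⟩) fun y hy => ?_
    rw [abs_of_nonneg hξ]
    exact mul_le_mul_of_nonneg_right (by linarith [hy.2]) hξ
  · refine key (Icc b b') measurableSet_Icc (by rw [Real.volume_Icc])
      (fun y hy => ⟨by linarith [hy.1], hy.2⟩) fun y hy => ?_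
    rw [abs_of_nonpos hξ]
    nlinarith [hy.1]

theorem lap_pos (ξ : ℝ) : 0 < lap ω ξ := by
  obtain ⟨c, hc, hl⟩ := h.lap_lower (half_pos h.beta_pos) (half_lt_self h.beta_pos)
  exact (by positivity : 0 < c * Real.exp (2 * (β / 2) * |ξ|)).trans_le (hl ξ)

/-- Differentiation inserts the factor -2y, which is at most 2β in absolute value on the support.
The bound on the logarithmic derivative serves the integration by parts in `norm_stripKernel_le`. -/
theorem exists_hasDerivAt_lap : ∃ W' : ℝ → ℝ, (∀ ξ, HasDerivAt (lap ω) (W' ξ) ξ) ∧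
    Continuous W' ∧ ∀ ξ, |W' ξ| ≤ 2 * β * lap ω ξ := by
  have habs : ∀ y, ω y ≠ 0 → |y| ≤ β := fun y hy => by
    by_contra hcon
    exact hy (h.zero y fun hy' => hcon (abs_le.2 ⟨hy'.1.le, hy'.2.le⟩))
  -- The extra factor g lets one statement be used twice: g = 1 differentiates the transform, g =
  -- -2y differentiates the derivative and so shows that it is continuous.
  have gen : ∀ g : ℝ → ℝ, Continuous g → ∀ ξ : ℝ,
      HasDerivAt (fun ξ => ∫ y, ω y * (g y * Real.exp (-2 * y * ξ)))
        (∫ y, ω y * (g y * (-2 * y) * Real.exp (-2 * y * ξ))) ξ := by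
    intro g hg ξ
    refine (hasDerivAt_integral_of_dominated_loc_of_deriv_le (μ := volume)
      (F := fun ξ y => ω y * (g y * Real.exp (-2 * y * ξ)))
      (F' := fun ξ y => ω y * (g y * (-2 * y) * Real.exp (-2 * y * ξ)))
      (bound := fun y => ω y * (|g y| * (2 * |y|) * Real.exp (2 * |y| * (|ξ| + 1))))
      (Metric.ball_mem_nhds ξ one_pos) ?_ ?_ ?_ ?_ ?_ ?_).2
    · exact Eventually.of_forall fun x =>
        (h.integrable_mul (by fun_prop)).aestronglyMeasurable
    · exact h.integrable_mul (by fun_prop)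
    · exact (h.integrable_mul (by fun_prop)).aestronglyMeasurable
    · refine Eventually.of_forall fun y x hx => ?_
      rw [Metric.mem_ball, Real.dist_eq] at hx
      rw [norm_mul, Real.norm_of_nonneg (h.nonneg y), norm_mul, norm_mul, Real.norm_eq_abs,
        Real.norm_eq_abs, abs_mul, Real.norm_of_nonneg (Real.exp_pos _).le]
      have h0 := h.nonneg y
      have hx' : |x| ≤ |ξ| + 1 := by
        have := abs_sub_abs_le_abs_sub x ξ
        linarith
      have hexp : -2 * y * x ≤ 2 * |y| * (|ξ| + 1) := by
        calc -2 * y * x ≤ |-2 * y * x| := le_abs_self _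
          _ = 2 * |y| * |x| := by rw [abs_mul, abs_mul]; norm_num
          _ ≤ _ := by gcongr
      norm_num
      gcongr
      linarith
    · exact h.integrable_mul (by fun_prop)
    · refine Eventually.of_forall fun y x _ => ?_
      have h1 : HasDerivAt (fun x : ℝ => -2 * y * x) (-2 * y) x := by
        simpa using (hasDerivAt_id x).const_mul (-2 * y)
      refine ((h1.exp.const_mul (g y)).const_mul (ω y)).congr_deriv ?_
      ring
  refine ⟨fun ξ => ∫ y, ω y * ((-2 * y) * Real.exp (-2 * y * ξ)), fun ξ => ?_, ?_, fun ξ => ?_⟩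
  · have := gen (fun _ => 1) continuous_const ξ
    simp only [one_mul] at this
    exact this
  · exact continuous_iff_continuousAt.2 fun ξ =>
      (gen (fun y => -2 * y) (by fun_prop) ξ).continuousAt
  · rw [lap, ← integral_const_mul, ← Real.norm_eq_abs]
    refine norm_integral_le_of_norm_le
      ((h.integrable_mul (g := fun y => Real.exp (-2 * y * ξ)) (by fun_prop)).const_mul _)
      (Eventually.of_forall fun y => ?_)
    by_cases hy : ω y = 0
    · simp [hy]
    · rw [norm_mul, norm_mul, Real.norm_of_nonneg (h.nonneg y),
        Real.norm_of_nonneg (Real.exp_pos _).le, Real.norm_eq_abs, abs_mul]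
      have := habs y hy
      have h0 := h.nonneg y
      norm_num
      calc ω y * (2 * |y| * Real.exp (-(2 * y * ξ))) ≤ ω y * (2 * β * Real.exp (-(2 * y * ξ))) := by
            gcongr
        _ = _ := by ring

theorem continuous_lap : Continuous (lap ω) := by
  obtain ⟨W', hW, -, -⟩ := h.exists_hasDerivAt_lap
  exact continuous_iff_continuousAt.2 fun ξ => (hW ξ).continuousAt

theorem integrable_exp_div_lap {s : ℝ} (hs : s < 2 * β) :
    Integrable fun ξ : ℝ => Real.exp (s * |ξ|) / (2 * Real.pi * lap ω ξ) := by
  -- The maximum with 0 keeps b positive, as `lap_lower` requires, when s is negative.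
  obtain ⟨b, hb1, hb2⟩ := exists_between (max_lt (by linarith : s / 2 < β) h.beta_pos)
  obtain ⟨c, hc, hl⟩ := h.lap_lower ((le_max_right _ _).trans_lt hb1) hb2
  have hsb : s / 2 < b := (le_max_left _ _).trans_lt hb1
  have hne : ∀ ξ, 2 * Real.pi * lap ω ξ ≠ 0 := fun ξ => by
    have := h.lap_pos ξ
    positivity
  refine ((integrable_exp_neg_mul_abs (a := 2 * b - s) (by linarith)).const_mul
    (1 / (2 * Real.pi * c))).mono' ?_ (Eventually.of_forall fun ξ => ?_)
  · have := h.continuous_lap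
    exact Continuous.aestronglyMeasurable (by fun_prop (disch := exact hne _))
  · have h0 := h.lap_pos ξ
    rw [Real.norm_of_nonneg (by positivity), div_le_iff₀ (by positivity)]
    calc Real.exp (s * |ξ|)
        = 1 / (2 * Real.pi * c) * Real.exp (-(2 * b - s) * |ξ|) *
            (2 * Real.pi * (c * Real.exp (2 * b * |ξ|))) := by
          have : Real.exp (s * |ξ|) = Real.exp (-(2 * b - s) * |ξ|) * Real.exp (2 * b * |ξ|) := by
            rw [← Real.exp_add]; ring_nf
          rw [this]; field_simp
      _ ≤ _ := by gcongr; exact hl ξ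

theorem integrable_kernel {τ : ℂ} (hτ : |τ.im| < 2 * β) :
    Integrable fun ξ : ℝ => Complex.exp (Complex.I * τ * ξ) / (2 * Real.pi * lap ω ξ : ℝ) := by
  refine (h.integrable_exp_div_lap hτ).mono' ?_ (Eventually.of_forall fun ξ => ?_)
  · have hne : ∀ ξ, ((2 * Real.pi * lap ω ξ : ℝ) : ℂ) ≠ 0 := fun ξ => by
      have := h.lap_pos ξ
      exact_mod_cast (by positivity : 2 * Real.pi * lap ω ξ ≠ 0)
    have := h.continuous_lap
    exact Continuous.aestronglyMeasurable (by fun_prop (disch := exact hne _))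
  · have := h.lap_pos ξ
    rw [norm_div, norm_exp_I_mul, Complex.norm_real, Real.norm_of_nonneg (by positivity)]
    refine div_le_div_of_nonneg_right (Real.exp_le_exp.2 ?_) (by positivity)
    calc -τ.im * ξ ≤ |-τ.im * ξ| := le_abs_self _
      _ = _ := by rw [abs_mul, abs_neg]

/-- With E the integrand and W the transform, E' = iτE - (W'/W)E has integral 0 over ℝ, so τk(τ) is
bounded by 2β ∫|E|. One power of decay in τ is enough for square-integrability on the strip. -/
theorem norm_stripKernel_le {s : ℝ} (hs : s < 2 * β) : ∃ C, ∀ τ : ℂ, |τ.im| ≤ s →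
    ‖stripKernel ω τ‖ ≤ C ∧ ‖τ‖ * ‖stripKernel ω τ‖ ≤ C := by
  set M := ∫ ξ : ℝ, Real.exp (s * |ξ|) / (2 * Real.pi * lap ω ξ) with hM
  have hint := h.integrable_exp_div_lap hs
  have hM0 : 0 ≤ M := integral_nonneg fun ξ => by have := h.lap_pos ξ; positivity
  have hb : ∀ τ : ℂ, |τ.im| ≤ s → ∀ ξ : ℝ,
      ‖Complex.exp (Complex.I * τ * ξ) / (2 * Real.pi * lap ω ξ : ℝ)‖ ≤
        Real.exp (s * |ξ|) / (2 * Real.pi * lap ω ξ) := by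
    intro τ hτ ξ
    have := h.lap_pos ξ
    rw [norm_div, norm_exp_I_mul, Complex.norm_real, Real.norm_of_nonneg (by positivity)]
    refine div_le_div_of_nonneg_right (Real.exp_le_exp.2 ?_) (by positivity)
    calc -τ.im * ξ ≤ |-τ.im * ξ| := le_abs_self _
      _ = |τ.im| * |ξ| := by rw [abs_mul, abs_neg]
      _ ≤ _ := by gcongr
  have h1 : ∀ τ : ℂ, |τ.im| ≤ s → ‖stripKernel ω τ‖ ≤ M := fun τ hτ =>
    norm_integral_le_of_norm_le hint (Eventually.of_forall (hb τ hτ))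
  obtain ⟨W', hW, hWc, hWb⟩ := h.exists_hasDerivAt_lap
  refine ⟨max M (2 * β * M), fun τ hτ => ⟨(h1 τ hτ).trans (le_max_left _ _),
    le_trans ?_ (le_max_right _ _)⟩⟩
  set E : ℝ → ℂ := fun ξ => Complex.exp (Complex.I * τ * ξ) / (2 * Real.pi * lap ω ξ : ℝ) with hE
  have hEi : Integrable E := h.integrable_kernel (hτ.trans_lt hs)
  have hd : ∀ ξ : ℝ, HasDerivAt E
      (Complex.I * τ * E ξ - ((W' ξ / lap ω ξ : ℝ) : ℂ) * E ξ) ξ := by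
    intro ξ
    have hl : ((lap ω ξ : ℝ) : ℂ) ≠ 0 := by exact_mod_cast (h.lap_pos ξ).ne'
    have h2 : HasDerivAt (fun ξ : ℝ => Complex.exp (Complex.I * τ * ξ))
        (Complex.exp (Complex.I * τ * ξ) * (Complex.I * τ)) ξ := by
      have : HasDerivAt (fun ξ : ℝ => Complex.I * τ * (ξ : ℂ)) (Complex.I * τ) ξ := by
        simpa using (Complex.ofRealCLM.hasDerivAt (x := ξ)).const_mul (Complex.I * τ)
      exact this.cexp
    have h3 : HasDerivAt (fun ξ : ℝ => ((2 * Real.pi * lap ω ξ : ℝ) : ℂ))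
        ((2 * Real.pi * W' ξ : ℝ) : ℂ) ξ := ((hW ξ).const_mul (2 * Real.pi)).ofReal_comp
    refine (h2.div h3 (by push_cast; simp [hl, Real.pi_ne_zero])).congr_deriv ?_
    simp only [hE]
    push_cast
    have : (Real.pi : ℂ) ≠ 0 := by exact_mod_cast Real.pi_ne_zero
    field_simp
  have hq : ∀ ξ, ‖((W' ξ / lap ω ξ : ℝ) : ℂ)‖ ≤ 2 * β := fun ξ => by
    rw [Complex.norm_real, Real.norm_eq_abs, abs_div, abs_of_pos (h.lap_pos ξ),
      div_le_iff₀ (h.lap_pos ξ)]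
    exact hWb ξ
  have hqc : Continuous fun ξ => ((W' ξ / lap ω ξ : ℝ) : ℂ) :=
    Complex.continuous_ofReal.comp (hWc.div h.continuous_lap fun ξ => (h.lap_pos ξ).ne')
  have hi2 : Integrable fun ξ => ((W' ξ / lap ω ξ : ℝ) : ℂ) * E ξ :=
    hEi.bdd_mul hqc.aestronglyMeasurable (Eventually.of_forall hq)
  have h0 := integral_eq_zero_of_hasDerivAt_of_integrable hd
    ((hEi.const_mul _).sub hi2) hEi
  rw [integral_sub (hEi.const_mul _) hi2, integral_const_mul, sub_eq_zero] at h0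
  have h4 : ‖τ‖ * ‖stripKernel ω τ‖ = ‖∫ ξ, ((W' ξ / lap ω ξ : ℝ) : ℂ) * E ξ‖ := by
    rw [← h0, norm_mul, norm_mul, Complex.norm_I, one_mul]; rfl
  rw [h4, hM, ← integral_const_mul]
  refine norm_integral_le_of_norm_le (hint.const_mul _) (Eventually.of_forall fun ξ => ?_)
  rw [norm_mul]
  have := h.beta_pos
  exact mul_le_mul (hq ξ) (hb τ hτ ξ) (norm_nonneg _) (by positivity)

theorem differentiableAt_stripKernel {τ₀ : ℂ} (hτ : |τ₀.im| < 2 * β) :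
    DifferentiableAt ℂ (stripKernel ω) τ₀ := by
  -- The bound s holds for |Im τ| on the whole ball around τ₀; the gap s' - s absorbs the factor |ξ|
  -- created by the derivative in τ.
  obtain ⟨s, hs1, hs2⟩ := exists_between hτ
  obtain ⟨s', hs3, hs4⟩ := exists_between hs2
  have hε : 0 < s - |τ₀.im| := by linarith
  have hlc := h.continuous_lap
  have hne : ∀ ξ, ((2 * Real.pi * lap ω ξ : ℝ) : ℂ) ≠ 0 := fun ξ => by
    have := h.lap_pos ξ
    exact_mod_cast (by positivity : 2 * Real.pi * lap ω ξ ≠ 0)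
  refine (hasDerivAt_integral_of_dominated_loc_of_deriv_le (μ := volume)
    (F := fun (τ : ℂ) (ξ : ℝ) => Complex.exp (Complex.I * τ * ξ) / (2 * Real.pi * lap ω ξ : ℝ))
    (F' := fun (τ : ℂ) (ξ : ℝ) =>
      Complex.exp (Complex.I * τ * ξ) * (Complex.I * ξ) / (2 * Real.pi * lap ω ξ : ℝ))
    (bound := fun ξ => (s' - s)⁻¹ * (Real.exp (s' * |ξ|) / (2 * Real.pi * lap ω ξ)))
    (Metric.ball_mem_nhds τ₀ hε) ?_ (h.integrable_kernel hτ) ?_ ?_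
    ((h.integrable_exp_div_lap hs4).const_mul _) ?_).2.differentiableAt
  · exact Eventually.of_forall fun τ =>
      Continuous.aestronglyMeasurable (by fun_prop (disch := exact hne _))
  · exact Continuous.aestronglyMeasurable (by fun_prop (disch := exact hne _))
  · refine Eventually.of_forall fun ξ τ hτ' => ?_
    rw [Metric.mem_ball, dist_eq_norm] at hτ'
    have him : |τ.im| ≤ s := by
      have h1 := Complex.abs_im_le_norm (τ - τ₀)
      have h2 := abs_sub_abs_le_abs_sub τ.im τ₀.im
      rw [Complex.sub_im] at h1
      linarith
    have := h.lap_pos ξ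
    rw [norm_div, norm_mul, norm_exp_I_mul, Complex.norm_real,
      Real.norm_of_nonneg (by positivity : 0 ≤ 2 * Real.pi * lap ω ξ), ← mul_div_assoc, norm_mul,
      Complex.norm_I, one_mul, Complex.norm_real, Real.norm_eq_abs]
    refine div_le_div_of_nonneg_right ?_ (by positivity)
    have h1 : -τ.im * ξ ≤ s * |ξ| := by
      calc -τ.im * ξ ≤ |-τ.im * ξ| := le_abs_self _
        _ = |τ.im| * |ξ| := by rw [abs_mul, abs_neg]
        _ ≤ _ := by gcongr
    have h2 : (s' - s) * |ξ| ≤ Real.exp ((s' - s) * |ξ|) := by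
      linarith [Real.add_one_le_exp ((s' - s) * |ξ|)]
    have h3 : 0 < s' - s := by linarith
    calc Real.exp (-τ.im * ξ) * |ξ|
        ≤ Real.exp (s * |ξ|) * ((s' - s)⁻¹ * Real.exp ((s' - s) * |ξ|)) := by
          gcongr
          rw [inv_mul_eq_div, le_div_iff₀ h3]; linarith
      _ = (s' - s)⁻¹ * Real.exp (s' * |ξ|) := by
          rw [mul_left_comm, ← Real.exp_add]; ring_nf
  · refine Eventually.of_forall fun ξ τ _ => ?_
    have h1 : HasDerivAt (fun τ : ℂ => Complex.I * τ * ξ) (Complex.I * ξ) τ := by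
      simpa using ((hasDerivAt_id τ).const_mul Complex.I).mul_const (ξ : ℂ)
    exact h1.cexp.div_const _

end IsStripWeight

end UnwoundWorm

/-! ### Weighted measures on the strip and pointwise bounds from square-integrability -/

namespace UnwoundWorm
open MeasureTheory Filter Topology Set
open scoped Interval ENNReal

theorem isOpen_strip (β : ℝ) : IsOpen (strip β) := isOpen_Ioo.preimage Complex.continuous_im

theorem mem_bergman_iff {E : Type*} [NormedAddCommGroup E] [NormedSpace ℂ E] [MeasurableSpace E]
    {Ω : Set E} (hΩ : MeasurableSet Ω) {m : Measure E} {F : Ω → ℂ} :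
    F ∈ bergman Ω m ↔ ∃ g : E → ℂ, DifferentiableOn ℂ g Ω ∧ (∀ z : Ω, F z = g z) ∧
      MemLp g 2 (m.restrict Ω) := by
  have key : ∀ g : E → ℂ, MemLp (fun z : Ω => g z) 2 (m.comap (Subtype.val : Ω → E)) ↔
      MemLp g 2 (m.restrict Ω) := fun g => by
    rw [← map_comap_subtype_coe hΩ, (MeasurableEmbedding.subtype_coe hΩ).memLp_map_measure_iff]
    rfl
  constructor
  · rintro ⟨⟨g, hg, hFg⟩, h2⟩
    obtain rfl : F = fun z : Ω => g z := funext hFg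
    exact ⟨g, hg, hFg, (key g).1 h2⟩
  · rintro ⟨g, hg, hFg, h2⟩
    obtain rfl : F = fun z : Ω => g z := funext hFg
    exact ⟨⟨g, hg, hFg⟩, (key g).2 h2⟩

theorem bergmanInner_eq {E : Type*} [MeasurableSpace E] {Ω : Set E} (hΩ : MeasurableSet Ω)
    (m : Measure E) {F G : Ω → ℂ} {f g : E → ℂ} (hF : ∀ z : Ω, F z = f z) (hG : ∀ z : Ω, G z = g z) :
    bergmanInner Ω m F G = ∫ z in Ω, f z * conj (g z) ∂m := by
  rw [← integral_subtype_comap hΩ, bergmanInner]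
  simp only [hF, hG]

/-- The measure `ω(Im ζ) dV(ζ)`. -/
noncomputable def stripMeasure (ω : ℝ → ℝ) : Measure ℂ :=
  volume.withDensity fun ζ => ENNReal.ofReal (ω ζ.im)

/-- Subharmonicity of `‖g‖`, in area form. -/
theorem mul_enorm_le_lintegral_ball {g : ℂ → ℂ} {z : ℂ} {r : ℝ}
    (hg : DifferentiableOn ℂ g (Metric.ball z r)) :
    (∫⁻ ρ in Ioo 0 r, ENNReal.ofReal ρ) * (ENNReal.ofReal (2 * Real.pi) * ‖g z‖ₑ) ≤
      ∫⁻ w in Metric.ball z r, ‖g w‖ₑ := by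
  have hcirc : ∀ ρ ∈ Ioo 0 r, ENNReal.ofReal (2 * Real.pi) * ‖g z‖ₑ ≤
      ∫⁻ θ in Ioo (-Real.pi) Real.pi, ‖g (z + Complex.polarCoord.symm (ρ, θ))‖ₑ := by
    intro ρ hρ
    have hsub : Metric.closedBall z |ρ| ⊆ Metric.ball z r := by
      rw [abs_of_pos hρ.1]; exact Metric.closedBall_subset_ball hρ.2
    have hd : DiffContOnCl ℂ g (Metric.ball z |ρ|) := by
      refine (hg.mono ?_).diffContOnCl
      rwa [closure_ball _ (abs_pos.2 hρ.1.ne').ne']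
    have h1 := hd.circleAverage
    rw [Real.circleAverage_eq_integral_add (-Real.pi)] at h1
    rw [intervalIntegral.integral_comp_add_right (fun θ => g (circleMap z ρ θ))] at h1
    have h2 : (2 * Real.pi) • g z = ∫ θ in (-Real.pi)..Real.pi, g (circleMap z ρ θ) := by
      rw [← h1, smul_smul, mul_inv_cancel₀ (by positivity), one_smul]
      congr 1 <;> ring
    have h3 : ENNReal.ofReal (2 * Real.pi) * ‖g z‖ₑ = ‖(2 * Real.pi) • g z‖ₑ := by
      rw [enorm_smul, Real.enorm_of_nonneg (by positivity)]
    rw [h3, h2, intervalIntegral.integral_of_le (by linarith [Real.pi_pos]),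
      ← restrict_Ioo_eq_restrict_Ioc]
    refine (enorm_integral_le_lintegral_enorm _).trans_eq ?_
    refine lintegral_congr fun θ => ?_
    rw [Complex.polarCoord_symm_apply, circleMap, Complex.exp_mul_I, Complex.ofReal_cos,
      Complex.ofReal_sin]
  have hshift : ∫⁻ w in Metric.ball z r, ‖g w‖ₑ
      = ∫⁻ w, (Metric.ball 0 r).indicator (fun w => ‖g (z + w)‖ₑ) w := by
    rw [← lintegral_indicator Metric.isOpen_ball.measurableSet, ← lintegral_add_left_eq_self _ z]
    refine lintegral_congr fun w => ?_
    simp [indicator]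
  have hmeas : Measurable ((Metric.ball (0 : ℂ) r).indicator (fun w => ‖g (z + w)‖ₑ)) := by
    have hc : ContinuousOn (fun w => ‖g (z + w)‖ₑ) (Metric.ball 0 r) := by
      refine ContinuousOn.enorm (hg.continuousOn.comp (by fun_prop) fun w hw => ?_)
      simpa using hw
    classical
    rw [← piecewise_eq_indicator]
    exact hc.measurable_piecewise continuousOn_const Metric.isOpen_ball.measurableSet
  rw [hshift, ← Complex.lintegral_comp_polarCoord_symm, polarCoord_target,
    Measure.volume_eq_prod, ← Measure.prod_restrict,
    lintegral_prod _ (by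
      refine Measurable.aemeasurable ?_
      refine Measurable.mul (by fun_prop) (hmeas.comp ?_)
      exact (continuous_polarCoord_symm.measurable).comp measurable_id |> fun h =>
        (Complex.measurableEquivRealProd.symm.measurable.comp h)),
    ← lintegral_mul_const _ (by fun_prop)]
  calc ∫⁻ ρ in Ioo 0 r, ENNReal.ofReal ρ * (ENNReal.ofReal (2 * Real.pi) * ‖g z‖ₑ)
      ≤ ∫⁻ ρ in Ioo 0 r, ∫⁻ θ in Ioo (-Real.pi) Real.pi, ENNReal.ofReal ρ •
          (Metric.ball 0 r).indicator (fun w => ‖g (z + w)‖ₑ) (Complex.polarCoord.symm (ρ, θ)) := by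
        refine setLIntegral_mono' measurableSet_Ioo fun ρ hρ => ?_
        simp only [smul_eq_mul]
        rw [lintegral_const_mul' _ _ ENNReal.ofReal_ne_top]
        gcongr
        refine (hcirc ρ hρ).trans_eq (lintegral_congr fun θ => ?_)
        rw [indicator_of_mem]
        rw [mem_ball_zero_iff, Complex.norm_polarCoord_symm, abs_of_pos hρ.1]
        exact hρ.2
    _ ≤ _ := lintegral_mono_set Ioo_subset_Ioi_self

namespace IsStripWeight
variable {β : ℝ} {ω : ℝ → ℝ} (h : IsStripWeight β ω)
include h

theorem measurable_density : Measurable fun ζ : ℂ => ENNReal.ofReal (ω ζ.im) :=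
  (h.continuous.measurable.comp Complex.measurable_im).ennreal_ofReal

/-- The density vanishes off the strip; hence integrals over the strip can be treated as integrals
over ℂ. -/
theorem restrict_stripMeasure : (stripMeasure ω).restrict (strip β) = stripMeasure ω := by
  refine Measure.restrict_eq_self_of_ae_mem ?_
  rw [stripMeasure, ae_withDensity_iff h.measurable_density]
  refine Eventually.of_forall fun ζ hζ => ?_
  by_contra hcon
  exact hζ (by rw [h.zero _ hcon, ENNReal.ofReal_zero])

theorem integral_stripMeasure (f : ℂ → ℂ) :
    ∫ z, f z ∂(stripMeasure ω) = ∫ z : ℂ, (ω z.im : ℂ) * f z := by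
  rw [stripMeasure, integral_withDensity_eq_integral_toReal_smul h.measurable_density
    (Eventually.of_forall fun _ => ENNReal.ofReal_lt_top)]
  simp only [ENNReal.toReal_ofReal (h.nonneg _), Complex.real_smul]

theorem integrable_stripMeasure_iff {f : ℂ → ℂ} :
    Integrable f (stripMeasure ω) ↔ Integrable fun z : ℂ => (ω z.im : ℂ) * f z := by
  rw [stripMeasure, integrable_withDensity_iff_integrable_smul' h.measurable_density
    (Eventually.of_forall fun _ => ENNReal.ofReal_lt_top)]
  simp only [ENNReal.toReal_ofReal (h.nonneg _), Complex.real_smul]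

/-- The mean value inequality is applied on discs of a fixed radius r, which stay in |Im z| ≤ b + r
< β, where the weight is bounded below. The area of the disc and the L² norm do not involve Re z, so
the bound is uniform along the strip. -/
theorem exists_norm_le {g : ℂ → ℂ} (hg : DifferentiableOn ℂ g (strip β))
    (hL : MemLp g 2 (stripMeasure ω)) {b : ℝ} (hb : b < β) :
    ∃ C, ∀ z : ℂ, |z.im| ≤ b → ‖g z‖ ≤ C := by
  set r := (β - b) / 2 with hr
  have hr0 : 0 < r := by linarith
  obtain ⟨c, hc, hcω⟩ := h.exists_pos_le (by linarith : b + r < β)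
  have hN : ∫⁻ w, ‖g w‖ₑ ^ 2 ∂(stripMeasure ω) < ∞ := by
    have := hL.eLpNorm_lt_top
    rw [eLpNorm_lt_top_iff_lintegral_rpow_enorm_lt_top (by norm_num) (by norm_num)] at this
    simpa using this
  set N := ∫⁻ w, ‖g w‖ₑ ^ 2 ∂(stripMeasure ω) with hNdef
  set V := volume (Metric.ball (0 : ℂ) r) with hV
  have hVtop : V < ∞ := measure_ball_lt_top
  set A := (∫⁻ ρ in Ioo 0 r, ENNReal.ofReal ρ) * ENNReal.ofReal (2 * Real.pi) with hA
  have hA0 : A ≠ 0 := by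
    refine mul_ne_zero ?_ (by simp [Real.pi_pos])
    rw [← pos_iff_ne_zero, setLIntegral_pos_iff (by fun_prop)]
    have : Function.support (fun ρ : ℝ => ENNReal.ofReal ρ) ∩ Ioo 0 r = Ioo 0 r := by
      ext x; simp only [Function.mem_support, mem_inter_iff, mem_Ioo]
      constructor
      · exact fun hx => hx.2
      · exact fun hx => ⟨by simp [hx.1], hx⟩
    rw [this, Real.volume_Ioo]
    simpa using hr0
  have hmain : ∀ z : ℂ, |z.im| ≤ b → A * ‖g z‖ₑ ≤ V + ENNReal.ofReal c⁻¹ * N := by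
    intro z hz
    have hball : ∀ w ∈ Metric.ball z r, w.im ∈ Icc (-(b + r)) (b + r) := by
      intro w hw
      rw [Metric.mem_ball, dist_eq_norm] at hw
      have h1 := (Complex.abs_im_le_norm (w - z)).trans hw.le
      rw [Complex.sub_im, abs_le] at h1
      rw [abs_le] at hz
      constructor <;> linarith [h1.1, h1.2, hz.1, hz.2]
    have hsub : Metric.ball z r ⊆ strip β := fun w hw => by
      have := hball w hw
      exact ⟨by linarith [this.1], by linarith [this.2]⟩
    rw [hA, mul_assoc]
    refine (mul_enorm_le_lintegral_ball (hg.mono hsub)).trans ?_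
    calc ∫⁻ w in Metric.ball z r, ‖g w‖ₑ
        ≤ ∫⁻ w in Metric.ball z r,
            (1 + ENNReal.ofReal c⁻¹ * (ENNReal.ofReal (ω w.im) * ‖g w‖ₑ ^ 2)) := by
          refine setLIntegral_mono' Metric.isOpen_ball.measurableSet fun w hw => ?_
          have h1 : 1 ≤ ENNReal.ofReal c⁻¹ * ENNReal.ofReal (ω w.im) := by
            rw [← ENNReal.ofReal_mul (by positivity), ENNReal.one_le_ofReal, inv_mul_eq_div,
              one_le_div hc]
            exact hcω _ (hball w hw)
          -- This elementary bound replaces Cauchy–Schwarz in the passage from L² to L¹ on the disc.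
          have h2 : ‖g w‖ₑ ≤ 1 + ‖g w‖ₑ ^ 2 := by
            rcases le_total ‖g w‖ₑ 1 with h3 | h3
            · exact h3.trans le_self_add
            · calc ‖g w‖ₑ = ‖g w‖ₑ * 1 := (mul_one _).symm
                _ ≤ ‖g w‖ₑ * ‖g w‖ₑ := by gcongr
                _ ≤ _ := by rw [sq]; exact le_add_self
          calc ‖g w‖ₑ ≤ 1 + 1 * ‖g w‖ₑ ^ 2 := by rwa [one_mul]
            _ ≤ _ := by rw [← mul_assoc]; gcongr
      _ = V + ∫⁻ w in Metric.ball z r,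
            ENNReal.ofReal c⁻¹ * (ENNReal.ofReal (ω w.im) * ‖g w‖ₑ ^ 2) := by
          rw [lintegral_add_left measurable_const, setLIntegral_one, hV,
            Complex.volume_ball, Complex.volume_ball]
      _ ≤ V + ENNReal.ofReal c⁻¹ * N := by
          gcongr
          rw [lintegral_const_mul' _ _ ENNReal.ofReal_ne_top]
          gcongr
          rw [hNdef, stripMeasure, lintegral_withDensity_eq_lintegral_mul_non_measurable _
            h.measurable_density (Eventually.of_forall fun _ => ENNReal.ofReal_lt_top)]
          exact setLIntegral_le_lintegral _ _
  refine ⟨((V + ENNReal.ofReal c⁻¹ * N) / A).toReal, fun z hz => ?_⟩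
  have hfin : V + ENNReal.ofReal c⁻¹ * N ≠ ∞ :=
    ENNReal.add_ne_top.2 ⟨hVtop.ne, ENNReal.mul_ne_top ENNReal.ofReal_ne_top hN.ne⟩
  have h1 : ‖g z‖ₑ ≤ (V + ENNReal.ofReal c⁻¹ * N) / A := by
    rw [ENNReal.le_div_iff_mul_le (.inl hA0) (.inr hfin), mul_comm]
    exact hmain z hz
  rw [← toReal_enorm]
  exact ENNReal.toReal_mono (ENNReal.div_ne_top hfin hA0) h1

end IsStripWeight

end UnwoundWorm

/-! ### Fourier analysis on the strip and the reproducing property -/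

namespace UnwoundWorm
open MeasureTheory Filter Topology Set
open scoped Interval ENNReal FourierTransform

/-- Holomorphic functions on the strip with Gaussian decay along smaller strips. -/
structure GaussianDecay (β : ℝ) (u : ℂ → ℂ) : Prop where
  diff : DifferentiableOn ℂ u (strip β)
  decay : ∃ δ > 0, ∀ b < β, ∃ C, ∀ z : ℂ, |z.im| ≤ b → ‖u z‖ ≤ C * Real.exp (-δ * z.re ^ 2)

/-- The Fourier transform `ξ ↦ ∫ u(x) e^{-ixξ} dx` of the restriction to the real line. -/
noncomputable def lineFourier (u : ℂ → ℂ) (ξ : ℝ) : ℂ :=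
  ∫ x : ℝ, u x * Complex.exp (-Complex.I * x * ξ)

namespace GaussianDecay
variable {β : ℝ} {u : ℂ → ℂ} (hu : GaussianDecay β u)
include hu

theorem continuous_line {y : ℝ} (hy : |y| < β) :
    Continuous fun x : ℝ => u (x + y * Complex.I) := by
  refine continuous_iff_continuousAt.2 fun x => ?_
  have hm : (x + y * Complex.I : ℂ) ∈ strip β := by simpa [strip] using abs_lt.1 hy
  have h1 : ContinuousAt u (x + y * Complex.I) :=
    (hu.diff.differentiableAt ((isOpen_strip β).mem_nhds hm)).continuousAt
  exact h1.comp (f := fun x : ℝ => (x + y * Complex.I : ℂ)) (by fun_prop)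

theorem integrable_line {y : ℝ} (hy : |y| < β) :
    Integrable fun x : ℝ => u (x + y * Complex.I) := by
  obtain ⟨δ, hδ, hdec⟩ := hu.decay
  obtain ⟨C, hC⟩ := hdec _ hy
  refine ((integrable_exp_neg_mul_sq hδ).const_mul C).mono'
    (hu.continuous_line hy).aestronglyMeasurable (Eventually.of_forall fun x => ?_)
  simpa using hC (x + y * Complex.I) (by simp)

theorem integral_line_eq {a b : ℝ} (hab : a ≤ b) (ha : |a| < β) (hb : |b| < β) (ξ : ℝ) :
    ∫ x : ℝ, u (x + a * Complex.I) * Complex.exp (-Complex.I * (x + a * Complex.I) * ξ) =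
      ∫ x : ℝ, u (x + b * Complex.I) * Complex.exp (-Complex.I * (x + b * Complex.I) * ξ) := by
  obtain ⟨δ, hδ, hdec⟩ := hu.decay
  obtain ⟨C, hC⟩ := hdec (max |a| |b|) (max_lt ha hb)
  have hle : ∀ t ∈ Icc a b, |t| ≤ max |a| |b| := fun t ht => abs_le_max_abs_abs ht.1 ht.2
  have hnorm : ∀ z : ℂ, ‖Complex.exp (-Complex.I * z * ξ)‖ = Real.exp (z.im * ξ) := fun z => by
    rw [Complex.norm_exp]; simp
  have hint : ∀ t, |t| < β → Integrable fun x : ℝ =>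
      u (x + t * Complex.I) * Complex.exp (-Complex.I * (x + t * Complex.I) * ξ) := fun t ht => by
    refine (hu.integrable_line ht).mul_bdd (c := Real.exp (t * ξ))
      (Continuous.aestronglyMeasurable (by fun_prop)) (Eventually.of_forall fun x => ?_)
    rw [hnorm]; simp
  have hC0 : 0 ≤ C := by
    have := (norm_nonneg _).trans (hC (a * Complex.I) (by simp))
    simpa using this
  refine UnwoundWorm.integral_line_eq (F := fun z => u z * Complex.exp (-Complex.I * z * ξ)) hab
    (B := fun x => C * Real.exp (max |a| |b| * |ξ|) * Real.exp (-δ * x ^ 2)) (T₀ := 0) ?_ ?_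
    (hint a ha) (hint b hb) ?_
  · have h1 : Tendsto (fun x : ℝ => Real.exp (-δ * x ^ 2)) atTop (𝓝 0) :=
      Real.tendsto_exp_atBot.comp
        ((tendsto_pow_atTop two_ne_zero).const_mul_atTop_of_neg (neg_lt_zero.2 hδ))
    simpa using h1.const_mul (C * Real.exp (max |a| |b| * |ξ|))
  · intro z hz _
    have hzi := hle _ hz
    rw [norm_mul, hnorm, sq_abs]
    calc ‖u z‖ * Real.exp (z.im * ξ)
        ≤ (C * Real.exp (-δ * z.re ^ 2)) * Real.exp (max |a| |b| * |ξ|) := by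
          refine mul_le_mul (hC z hzi) (Real.exp_le_exp.2 ?_) (Real.exp_pos _).le (by positivity)
          calc z.im * ξ ≤ |z.im * ξ| := le_abs_self _
            _ = |z.im| * |ξ| := abs_mul _ _
            _ ≤ _ := by gcongr
      _ = _ := by ring
  · refine DifferentiableOn.mul (hu.diff.mono fun z hz => ?_) (by fun_prop)
    have := hle _ hz
    exact abs_lt.1 (this.trans_lt (max_lt ha hb))

/-- Cauchy's theorem: u(z)e^{-izξ} has the same integral on every horizontal line of the strip, and
on Im z = y the exponential carries the extra factor e^{yξ}. -/
theorem lineFourier_eq {y : ℝ} (hy : |y| < β) (ξ : ℝ) :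
    ∫ x : ℝ, u (x + y * Complex.I) * Complex.exp (-Complex.I * x * ξ) =
      Complex.exp (-y * ξ) * lineFourier u ξ := by
  have hβ : |(0 : ℝ)| < β := by simpa using (abs_nonneg y).trans_lt hy
  have h1 : lineFourier u ξ = ∫ x : ℝ, u (x + y * Complex.I) *
      Complex.exp (-Complex.I * (x + y * Complex.I) * ξ) := by
    have h0 : lineFourier u ξ = ∫ x : ℝ, u (x + (0 : ℝ) * Complex.I) *
      Complex.exp (-Complex.I * (x + (0 : ℝ) * Complex.I) * ξ) := by simp [lineFourier]
    rw [h0]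
    rcases le_total 0 y with h | h
    · exact hu.integral_line_eq h hβ hy ξ
    · exact (hu.integral_line_eq h hy hβ ξ).symm
  rw [h1, ← integral_const_mul]
  refine integral_congr_ae (Eventually.of_forall fun x => ?_)
  have : Complex.exp (-y * ξ) * Complex.exp (-Complex.I * (x + y * Complex.I) * ξ)
      = Complex.exp (-Complex.I * x * ξ) := by
    rw [← Complex.exp_add]
    congr 1
    linear_combination (-(y : ℂ) * ξ) * Complex.I_mul_I
  simp only
  rw [mul_left_comm, this]

/-- The line is moved to Im z = -b for ξ ≥ 0 and to Im z = b for ξ ≤ 0. -/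
theorem exists_norm_lineFourier_le {b : ℝ} (hb0 : 0 ≤ b) (hb : b < β) :
    ∃ C, ∀ ξ, ‖lineFourier u ξ‖ ≤ C * Real.exp (-b * |ξ|) := by
  have hbound : ∀ y, |y| < β → ∀ ξ, ‖lineFourier u ξ‖ ≤
      (∫ x : ℝ, ‖u (x + y * Complex.I)‖) * Real.exp (y * ξ) := by
    intro y hy ξ
    have h1 : ‖Complex.exp (-y * ξ) * lineFourier u ξ‖ ≤ ∫ x : ℝ, ‖u (x + y * Complex.I)‖ := by
      rw [← hu.lineFourier_eq hy]
      refine norm_integral_le_of_norm_le (hu.integrable_line hy).norm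
        (Eventually.of_forall fun x => ?_)
      rw [norm_mul, Complex.norm_exp]; simp
    rw [norm_mul, Complex.norm_exp] at h1
    simp only [Complex.mul_re, Complex.neg_re, Complex.ofReal_re, Complex.neg_im,
      Complex.ofReal_im, neg_zero, mul_zero, sub_zero] at h1
    calc ‖lineFourier u ξ‖ = Real.exp (-y * ξ) * ‖lineFourier u ξ‖ * Real.exp (y * ξ) := by
          rw [mul_right_comm, ← Real.exp_add]; simp
      _ ≤ _ := by gcongr
  set C₁ := ∫ x : ℝ, ‖u (x + b * Complex.I)‖
  set C₂ := ∫ x : ℝ, ‖u (x + (-b : ℝ) * Complex.I)‖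
  refine ⟨max C₁ C₂, fun ξ => ?_⟩
  rcases le_total 0 ξ with hξ | hξ
  · rw [abs_of_nonneg hξ]
    refine (hbound (-b) (by rwa [abs_neg, abs_of_nonneg hb0]) ξ).trans ?_
    gcongr
    exact le_max_right _ _
  · rw [abs_of_nonpos hξ]
    refine (hbound b (by rwa [abs_of_nonneg hb0]) ξ).trans ?_
    rw [neg_mul_neg]
    gcongr
    exact le_max_left _ _

theorem continuous_lineFourier (hβ : 0 < β) : Continuous (lineFourier u) := by
  have hi := hu.integrable_line (y := 0) (by simpa)
  have hc := hu.continuous_line (y := 0) (by simpa)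
  simp only [Complex.ofReal_zero, zero_mul, add_zero] at hi hc
  refine continuous_of_dominated (bound := fun x : ℝ => ‖u x‖) (fun ξ => ?_) (fun ξ => ?_) hi.norm ?_
  · exact (hc.mul (by fun_prop)).aestronglyMeasurable
  · refine Eventually.of_forall fun x => ?_
    rw [norm_mul, Complex.norm_exp]; simp
  · exact Eventually.of_forall fun x => by fun_prop

theorem integrable_mul_lineFourier {s : ℂ} (hs : |s.im| < β) :
    Integrable fun ξ : ℝ => Complex.exp (Complex.I * s * ξ) * lineFourier u ξ := by
  obtain ⟨b, hb1, hb2⟩ := exists_between hs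
  obtain ⟨C, hC⟩ := hu.exists_norm_lineFourier_le ((abs_nonneg _).trans hb1.le) hb2
  have hc := hu.continuous_lineFourier ((abs_nonneg _).trans_lt hs)
  refine ((integrable_exp_neg_mul_abs (a := b - |s.im|) (by linarith)).const_mul C).mono'
    (Continuous.aestronglyMeasurable (by fun_prop)) (Eventually.of_forall fun ξ => ?_)
  rw [norm_mul, norm_exp_I_mul]
  have h1 : -s.im * ξ ≤ |s.im| * |ξ| := by
    rw [← abs_neg s.im, ← abs_mul]; exact le_abs_self _
  calc Real.exp (-s.im * ξ) * ‖lineFourier u ξ‖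
      ≤ Real.exp (|s.im| * |ξ|) * (C * Real.exp (-b * |ξ|)) := by gcongr; exact hC ξ
    _ = C * Real.exp (-(b - |s.im|) * |ξ|) := by
      rw [mul_left_comm, ← Real.exp_add]; ring_nf

theorem inversion {s : ℂ} (hs : s ∈ strip β) :
    ∫ ξ : ℝ, Complex.exp (Complex.I * s * ξ) * lineFourier u ξ = 2 * Real.pi * u s := by
  have hs' : |s.im| < β := abs_lt.2 hs
  set f : ℝ → ℂ := fun x => u (x + s.im * Complex.I) with hf
  -- `𝓕` uses the exponent -2πixw, so ξ = 2πw; this substitution is the source of the factor 2π in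
  -- the conclusion.
  have hF : 𝓕 f = fun w : ℝ => Complex.exp (Complex.I * (s.im * Complex.I) * (2 * Real.pi * w : ℝ)) *
      lineFourier u (2 * Real.pi * w) := by
    ext w
    rw [Real.fourier_real_eq_integral_exp_smul]
    have := hu.lineFourier_eq hs' (2 * Real.pi * w)
    have e : Complex.I * (s.im * Complex.I) * (2 * Real.pi * w : ℝ)
        = -s.im * (2 * Real.pi * w : ℝ) := by
      linear_combination (s.im * (2 * Real.pi * w : ℝ) : ℂ) * Complex.I_mul_I
    rw [e, ← this]
    refine integral_congr_ae (Eventually.of_forall fun x => ?_)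
    simp only [smul_eq_mul, hf]
    rw [mul_comm]
    congr 2
    push_cast; ring
  have hFi : Integrable (𝓕 f) := by
    rw [hF]
    exact (hu.integrable_mul_lineFourier (s := s.im * Complex.I) (by simpa)).comp_mul_left'
      (by positivity)
  have hinv := congrFun ((hu.continuous_line hs').fourierInv_fourier_eq
    (hu.integrable_line hs') hFi) s.re
  rw [Real.fourierInv_eq'] at hinv
  have hcov := Measure.integral_comp_mul_left
    (fun ξ : ℝ => Complex.exp (Complex.I * s * ξ) * lineFourier u ξ) (2 * Real.pi)
  have hs2 : (s.re + s.im * Complex.I : ℂ) = s := Complex.re_add_im s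
  have hl : ∫ w : ℝ, Complex.exp (Complex.I * s * (2 * Real.pi * w : ℝ)) *
      lineFourier u (2 * Real.pi * w) = u s := by
    rw [← hs2, ← hinv]
    refine integral_congr_ae (Eventually.of_forall fun w => ?_)
    simp only [smul_eq_mul, RCLike.inner_apply, conj_trivial, hs2]
    rw [← hf, hF, ← mul_assoc, ← Complex.exp_add]
    congr 2
    nth_rw 1 [← hs2]
    push_cast
    ring
  rw [hl, abs_of_pos (by positivity), Complex.real_smul] at hcov
  rw [hcov]
  push_cast
  have : (Real.pi : ℂ) ≠ 0 := by exact_mod_cast Real.pi_ne_zero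
  field_simp

end GaussianDecay

theorem conj_stripKernel (ω : ℝ → ℝ) (ζ ζ' : ℂ) : conj (stripKernel ω (ζ - conj ζ')) =
    ∫ ξ : ℝ, Complex.exp (-Complex.I * (conj ζ - ζ') * ξ) / (2 * Real.pi * lap ω ξ : ℝ) := by
  rw [stripKernel, ← integral_conj]
  refine integral_congr_ae (Eventually.of_forall fun ξ => ?_)
  simp only [map_div₀, ← Complex.exp_conj, map_mul, Complex.conj_I, Complex.conj_ofReal, map_sub,
    Complex.conj_conj]

namespace IsStripWeight
variable {β : ℝ} {ω : ℝ → ℝ} (h : IsStripWeight β ω)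
include h

/-- Parseval on the line Im z = y. The conjugated kernel and the Fourier transform of u on that line
each give e^{-yξ}; the product e^{-2yξ} is what ω turns into `lap ω ξ` upon integration in y. -/
theorem integral_line_mul_conj_stripKernel {u : ℂ → ℂ} (hu : GaussianDecay β u) {y : ℝ}
    (hy : |y| < β) {ζ' : ℂ} (hζ' : ζ' ∈ strip β) :
    ∫ x : ℝ, u (x + y * Complex.I) * conj (stripKernel ω (x + y * Complex.I - conj ζ')) =
      ∫ ξ : ℝ, Complex.exp (-2 * y * ξ) *
        (Complex.exp (Complex.I * ζ' * ξ) * lineFourier u ξ / (2 * Real.pi * lap ω ξ : ℝ)) := by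
  have hζ : |ζ'.im| < β := abs_lt.2 hζ'
  have hlc := h.continuous_lap
  have hne : ∀ ξ, ((2 * Real.pi * lap ω ξ : ℝ) : ℂ) ≠ 0 := fun ξ => by
    have := h.lap_pos ξ
    exact_mod_cast (by positivity : 2 * Real.pi * lap ω ξ ≠ 0)
  set k : ℝ → ℂ := fun ξ => Complex.exp (Complex.I * (ζ' + y * Complex.I) * ξ) /
    (2 * Real.pi * lap ω ξ : ℝ) with hk
  have hki : Integrable k := h.integrable_kernel (by
    simp only [Complex.add_im, Complex.mul_im, Complex.ofReal_re, Complex.I_im, mul_one,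
      Complex.ofReal_im, Complex.I_re, mul_zero, add_zero]
    linarith [abs_add_le ζ'.im y])
  have hprod : Integrable (Function.uncurry fun x ξ : ℝ =>
      u (x + y * Complex.I) * (Complex.exp (-Complex.I * x * ξ) * k ξ)) (volume.prod volume) := by
    have h1 := (hu.integrable_line hy).mul_prod hki
    refine (h1.bdd_mul (c := 1) (f := fun p : ℝ × ℝ => Complex.exp (-Complex.I * p.1 * p.2))
      (Continuous.aestronglyMeasurable (by fun_prop)) (Eventually.of_forall fun p => ?_)).congr
      (Eventually.of_forall fun p => ?_)
    · rw [Complex.norm_exp]; simp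
    · simp only [Function.uncurry]; ring
  calc _ = ∫ x : ℝ, ∫ ξ : ℝ, u (x + y * Complex.I) * (Complex.exp (-Complex.I * x * ξ) * k ξ) := by
        refine integral_congr_ae (Eventually.of_forall fun x => ?_)
        simp only
        rw [conj_stripKernel, ← integral_const_mul]
        refine integral_congr_ae (Eventually.of_forall fun ξ => ?_)
        simp only [hk]
        rw [← mul_div_assoc (Complex.exp _), ← Complex.exp_add]
        congr 3
        simp only [map_add, map_mul, Complex.conj_ofReal, Complex.conj_I]
        ring
    _ = ∫ ξ : ℝ, ∫ x : ℝ, u (x + y * Complex.I) * (Complex.exp (-Complex.I * x * ξ) * k ξ) :=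
        integral_integral_swap hprod
    _ = _ := by
        refine integral_congr_ae (Eventually.of_forall fun ξ => ?_)
        simp only [← mul_assoc]
        rw [integral_mul_const, hu.lineFourier_eq hy]
        have e : Complex.exp (-y * ξ) * Complex.exp (Complex.I * (ζ' + y * Complex.I) * ξ)
            = Complex.exp (-2 * y * ξ) * Complex.exp (Complex.I * ζ' * ξ) := by
          rw [← Complex.exp_add, ← Complex.exp_add]
          congr 1
          linear_combination (y * ξ : ℂ) * Complex.I_mul_I
        simp only [hk]
        rw [← mul_div_assoc, ← mul_div_assoc, mul_right_comm, e]
        ring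

/-- After the integral in y the factor `lap ω ξ` cancels the denominator, and Fourier inversion at
ζ' remains. -/
theorem integral_mul_conj_stripKernel {u : ℂ → ℂ} (hu : GaussianDecay β u) {ζ' : ℂ}
    (hζ' : ζ' ∈ strip β)
    (hi : Integrable (fun z => u z * conj (stripKernel ω (z - conj ζ'))) (stripMeasure ω)) :
    ∫ z, u z * conj (stripKernel ω (z - conj ζ')) ∂(stripMeasure ω) = u ζ' := by
  have hlc := h.continuous_lap
  have hζ : |ζ'.im| < β := abs_lt.2 hζ'
  have hgc := hu.continuous_lineFourier ((abs_nonneg _).trans_lt hζ)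
  have hne : ∀ ξ, ((2 * Real.pi * lap ω ξ : ℝ) : ℂ) ≠ 0 := fun ξ => by
    have := h.lap_pos ξ
    exact_mod_cast (by positivity : 2 * Real.pi * lap ω ξ ≠ 0)
  rw [h.integrable_stripMeasure_iff] at hi
  rw [h.integral_stripMeasure]
  set Φ : ℂ → ℂ := fun z => (ω z.im : ℂ) * (u z * conj (stripKernel ω (z - conj ζ'))) with hΦ
  have hmp := Complex.volume_preserving_equiv_real_prod.symm
  have hi2 : Integrable (fun p : ℝ × ℝ => Φ (p.1 + p.2 * Complex.I)) (volume.prod volume) := by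
    have := (hmp.integrable_comp_emb Complex.measurableEquivRealProd.symm.measurableEmbedding).2 hi
    refine this.congr (Eventually.of_forall fun p => ?_)
    simp [Complex.measurableEquivRealProd_symm_apply, Complex.mk_eq_add_mul_I]
  have e1 : ∫ z, Φ z = ∫ p : ℝ × ℝ, Φ (p.1 + p.2 * Complex.I) ∂(volume.prod volume) := by
    rw [← hmp.integral_comp Complex.measurableEquivRealProd.symm.measurableEmbedding]
    refine integral_congr_ae (Eventually.of_forall fun p => ?_)
    simp [Complex.measurableEquivRealProd_symm_apply, Complex.mk_eq_add_mul_I]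
  set A : ℝ → ℂ := fun ξ => Complex.exp (Complex.I * ζ' * ξ) * lineFourier u ξ with hA
  have hAi : Integrable A := hu.integrable_mul_lineFourier hζ
  have hAc : Continuous A := by fun_prop
  set Ψ : ℝ → ℝ → ℂ := fun y ξ =>
    (ω y : ℂ) * (Complex.exp (-2 * y * ξ) * (A ξ / (2 * Real.pi * lap ω ξ : ℝ))) with hΨ
  have hω := h.continuous
  have hΨn : ∀ ξ y, ‖Ψ y ξ‖ = ω y * Real.exp (-2 * y * ξ) *
      (‖A ξ‖ / (2 * Real.pi * lap ω ξ)) := by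
    intro ξ y
    have := h.lap_pos ξ
    simp only [hΨ]
    rw [norm_mul, norm_mul, norm_div, Complex.norm_real, Complex.norm_real,
      Real.norm_of_nonneg (h.nonneg y), Real.norm_of_nonneg (by positivity), Complex.norm_exp]
    simp [mul_assoc]
  -- The same cancellation justifies Fubini: the integral of ‖Ψ‖ in y is exactly ‖A ξ‖ / (2π), which
  -- is integrable.
  have hΨi : Integrable (Function.uncurry Ψ) (volume.prod volume) := by
    refine (integrable_prod_iff' (Continuous.aestronglyMeasurable ?_)).2 ⟨?_, ?_⟩
    · simp only [Function.uncurry_def, hΨ]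
      fun_prop (disch := exact fun p => hne _)
    · refine Eventually.of_forall fun ξ => ?_
      have h1 := (h.integrable_mul (g := fun y => Real.exp (-2 * y * ξ)) (by fun_prop)).mul_const
        (‖A ξ‖ / (2 * Real.pi * lap ω ξ))
      refine h1.mono' (Continuous.aestronglyMeasurable ?_) (Eventually.of_forall fun y => ?_)
      · simp only [Function.uncurry_def, hΨ]
        fun_prop
      · exact (hΨn ξ y).le
    · have : (fun ξ => ∫ y, ‖Function.uncurry Ψ (y, ξ)‖) = fun ξ => ‖A ξ‖ / (2 * Real.pi) := by
        ext ξ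
        have h0 := (h.lap_pos ξ).ne'
        simp only [Function.uncurry_apply_pair, hΨn]
        rw [integral_mul_const]
        change lap ω ξ * _ = _
        field_simp
      rw [this]
      exact hAi.norm.div_const _
  have hpi : (Real.pi : ℂ) ≠ 0 := by exact_mod_cast Real.pi_ne_zero
  calc ∫ z, Φ z = ∫ y : ℝ, ∫ x : ℝ, Φ (x + y * Complex.I) := by
        rw [e1, integral_prod_symm _ hi2]
    _ = ∫ y : ℝ, ∫ ξ : ℝ, Ψ y ξ := by
        refine integral_congr_ae (Eventually.of_forall fun y => ?_)
        simp only [hΦ, hΨ, Complex.add_im, Complex.ofReal_im, Complex.mul_im, Complex.ofReal_re,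
          Complex.I_im, mul_one, Complex.I_re, mul_zero, add_zero, zero_add]
        rw [integral_const_mul, integral_const_mul]
        by_cases hy : y ∈ Ioo (-β) β
        · rw [h.integral_line_mul_conj_stripKernel hu (abs_lt.2 hy) hζ']
        · simp [h.zero y hy]
    _ = ∫ ξ : ℝ, ∫ y : ℝ, Ψ y ξ := integral_integral_swap hΨi
    _ = ∫ ξ : ℝ, A ξ / (2 * Real.pi) := by
        refine integral_congr_ae (Eventually.of_forall fun ξ => ?_)
        have h0 : ((lap ω ξ : ℝ) : ℂ) ≠ 0 := by exact_mod_cast (h.lap_pos ξ).ne'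
        have h1 : ∫ y : ℝ, (ω y : ℂ) * Complex.exp (-2 * y * ξ) = (lap ω ξ : ℂ) := by
          rw [lap, ← integral_complex_ofReal]
          push_cast
          rfl
        simp only [hΨ, ← mul_assoc]
        rw [integral_mul_const, h1]
        push_cast
        field_simp
    _ = u ζ' := by
        rw [integral_div, hu.inversion hζ']
        field_simp

/-- For z in the strip, |Im(z - conj ζ')| ≤ β + |Im ζ'| < 2β. The two bounds of
`norm_stripKernel_le` then give |k|² ≤ 2C² / (1 + (Re z - Re ζ')²), with C independent of z. -/
theorem memLp_stripKernel {ζ' : ℂ} (hζ' : ζ' ∈ strip β) :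
    MemLp (fun z => stripKernel ω (z - conj ζ')) 2 (stripMeasure ω) := by
  have hζ : |ζ'.im| < β := abs_lt.2 hζ'
  have him : ∀ z : ℂ, z ∈ strip β → |(z - conj ζ').im| ≤ β + |ζ'.im| := fun z hz => by
    have := abs_lt.2 hz
    rw [Complex.sub_im, Complex.conj_im, sub_neg_eq_add]
    linarith [abs_add_le z.im ζ'.im]
  obtain ⟨C, hC⟩ := h.norm_stripKernel_le (by linarith : β + |ζ'.im| < 2 * β)
  have hcont : ContinuousOn (fun z => stripKernel ω (z - conj ζ')) (strip β) := fun z hz => by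
    have h1 := h.differentiableAt_stripKernel ((him z hz).trans_lt (by linarith))
    exact (ContinuousAt.comp (f := fun z : ℂ => z - conj ζ') h1.continuousAt
      (by fun_prop)).continuousWithinAt
  have hm : AEStronglyMeasurable (fun z => stripKernel ω (z - conj ζ')) (stripMeasure ω) := by
    rw [← h.restrict_stripMeasure]
    exact hcont.aestronglyMeasurable (isOpen_strip β).measurableSet
  refine (memLp_two_iff_integrable_sq_norm hm).2 ?_
  have hbound : Integrable fun z : ℂ => (ω z.im * (2 * C ^ 2) * (1 + (z.re - ζ'.re) ^ 2)⁻¹ : ℝ) := by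
    have h1 : Integrable fun x : ℝ => (1 + (x - ζ'.re) ^ 2)⁻¹ :=
      integrable_inv_one_add_sq.comp_sub_right ζ'.re
    have h2 : Integrable fun y : ℝ => ω y * (2 * C ^ 2) := h.integrable_mul continuous_const
    have h3 := h1.mul_prod h2
    have := (Complex.volume_preserving_equiv_real_prod.integrable_comp_emb
      Complex.measurableEquivRealProd.measurableEmbedding).2 h3
    refine this.congr (Eventually.of_forall fun z => ?_)
    simp [Complex.measurableEquivRealProd_apply]
    ring
  rw [stripMeasure, integrable_withDensity_iff_integrable_smul' h.measurable_density
    (Eventually.of_forall fun _ => ENNReal.ofReal_lt_top)]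
  simp only [ENNReal.toReal_ofReal (h.nonneg _), smul_eq_mul]
  refine hbound.mono' ?_ (Eventually.of_forall fun z => ?_)
  · have h1 : AEStronglyMeasurable
        ((strip β).indicator fun z => ω z.im * ‖stripKernel ω (z - conj ζ')‖ ^ 2) volume := by
      refine (aestronglyMeasurable_indicator_iff (isOpen_strip β).measurableSet).2 ?_
      refine ContinuousOn.aestronglyMeasurable ?_ (isOpen_strip β).measurableSet
      exact (h.continuous.comp Complex.continuous_im).continuousOn.mul (hcont.norm.pow 2)
    refine h1.congr (Eventually.of_forall fun z => ?_)
    by_cases hz : z ∈ strip β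
    · rw [indicator_of_mem hz]
    · simp only [indicator_of_notMem hz, h.zero _ hz, zero_mul]
  · by_cases hz : z ∈ strip β
    · have h0 := h.nonneg z.im
      rw [norm_mul, Real.norm_of_nonneg h0, Real.norm_of_nonneg (by positivity), mul_assoc]
      refine mul_le_mul_of_nonneg_left ?_ h0
      obtain ⟨h1, h2⟩ := hC _ (him z hz)
      rw [← div_eq_mul_inv, le_div_iff₀ (by positivity), mul_add, mul_one]
      have h3 : |z.re - ζ'.re| ≤ ‖z - conj ζ'‖ := by
        simpa using Complex.abs_re_le_norm (z - conj ζ')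
      have h4 : (|z.re - ζ'.re| * ‖stripKernel ω (z - conj ζ')‖) ^ 2 ≤ C ^ 2 :=
        pow_le_pow_left₀ (by positivity)
          ((mul_le_mul_of_nonneg_right h3 (norm_nonneg _)).trans h2) 2
      have h5 := pow_le_pow_left₀ (norm_nonneg _) h1 2
      rw [mul_pow, sq_abs] at h4
      linarith
    · rw [h.zero _ hz]; simp

/-- The factor is chosen to equal 1 at z = s, so that for s = ζ' it leaves the value to be
reproduced unchanged. -/
theorem gaussianDecay_mul {g : ℂ → ℂ} (hg : DifferentiableOn ℂ g (strip β))
    (hL : MemLp g 2 (stripMeasure ω)) {δ : ℝ} (hδ : 0 < δ) (s : ℂ) :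
    GaussianDecay β fun z => g z * Complex.exp (-δ * (z ^ 2 - s ^ 2)) := by
  refine ⟨hg.mul (by fun_prop), δ, hδ, fun b hb => ?_⟩
  obtain ⟨C, hC⟩ := h.exists_norm_le hg hL hb
  refine ⟨C * Real.exp (δ * (b ^ 2 + (s ^ 2).re)), fun z hz => ?_⟩
  rw [norm_mul, Complex.norm_exp, mul_assoc, ← Real.exp_add]
  refine mul_le_mul (hC z hz) (Real.exp_le_exp.2 ?_) (Real.exp_pos _).le
    ((norm_nonneg _).trans (hC z hz))
  have h1 : (-(δ : ℂ) * (z ^ 2 - s ^ 2)).re = -δ * (z.re ^ 2 - z.im ^ 2 - (s ^ 2).re) := by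
    rw [← Complex.ofReal_neg, Complex.re_ofReal_mul]
    simp [sq]
  rw [h1]
  have h2 : z.im ^ 2 ≤ b ^ 2 := sq_le_sq.2 (hz.trans (le_abs_self b))
  nlinarith

/-- The regularised functions g(z) exp(-δ(z² - ζ'²)) all take the value g(ζ') at ζ'. For δ ≤ 1 the
factor is bounded on the strip because |Im z| < β, so dominated convergence lets δ tend to 0. -/
theorem reproducing {g : ℂ → ℂ} (hg : DifferentiableOn ℂ g (strip β))
    (hL : MemLp g 2 (stripMeasure ω)) {ζ' : ℂ} (hζ' : ζ' ∈ strip β) :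
    ∫ z, g z * conj (stripKernel ω (z - conj ζ')) ∂(stripMeasure ω) = g ζ' := by
  have hk := h.memLp_stripKernel hζ'
  have hkc : MemLp (fun z => conj (stripKernel ω (z - conj ζ'))) 2 (stripMeasure ω) := hk.star
  have hint : Integrable (fun z => g z * conj (stripKernel ω (z - conj ζ'))) (stripMeasure ω) :=
    hL.integrable_mul hkc
  set δ : ℕ → ℝ := fun n => 1 / ((n : ℝ) + 1) with hδ
  have hδ0 : ∀ n, 0 < δ n := fun n => by positivity
  have hδ1 : ∀ n, δ n ≤ 1 := fun n => by
    rw [hδ, div_le_one (by positivity)]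
    linarith [(Nat.cast_nonneg n : (0 : ℝ) ≤ n)]
  set M := Real.exp (β ^ 2 + |(ζ' ^ 2).re|) with hM
  have hae : ∀ᵐ z ∂(stripMeasure ω), z ∈ strip β := by
    have := ae_restrict_mem (μ := stripMeasure ω) (isOpen_strip β).measurableSet
    rwa [h.restrict_stripMeasure] at this
  have hbd : ∀ n, ∀ z ∈ strip β, ‖Complex.exp (-δ n * (z ^ 2 - ζ' ^ 2))‖ ≤ M := by
    intro n z hz
    rw [Complex.norm_exp, hM]
    refine Real.exp_le_exp.2 ?_
    have h1 : (-(δ n : ℂ) * (z ^ 2 - ζ' ^ 2)).re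
        = δ n * (z.im ^ 2 - z.re ^ 2 + (ζ' ^ 2).re) := by
      rw [← Complex.ofReal_neg, Complex.re_ofReal_mul]
      simp [sq]; ring
    have h2 : z.im ^ 2 ≤ β ^ 2 := sq_le_sq.2 ((abs_lt.2 hz).le.trans (le_abs_self _))
    rw [h1]
    calc δ n * (z.im ^ 2 - z.re ^ 2 + (ζ' ^ 2).re) ≤ δ n * (β ^ 2 + |(ζ' ^ 2).re|) := by
          refine mul_le_mul_of_nonneg_left ?_ (hδ0 n).le
          linarith [sq_nonneg z.re, le_abs_self (ζ' ^ 2).re]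
      _ ≤ 1 * (β ^ 2 + |(ζ' ^ 2).re|) :=
          mul_le_mul_of_nonneg_right (hδ1 n) (by positivity)
      _ = _ := one_mul _
  have hintn : ∀ n, Integrable (fun z => g z * Complex.exp (-δ n * (z ^ 2 - ζ' ^ 2)) *
      conj (stripKernel ω (z - conj ζ'))) (stripMeasure ω) := by
    intro n
    refine (hint.bdd_mul (c := M) (f := fun z => Complex.exp (-δ n * (z ^ 2 - ζ' ^ 2)))
      (Continuous.aestronglyMeasurable (by fun_prop)) ?_).congr
      (Eventually.of_forall fun z => by ring)
    filter_upwards [hae] with z hz using hbd n z hz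
  have hval : ∀ n, ∫ z, g z * Complex.exp (-δ n * (z ^ 2 - ζ' ^ 2)) *
      conj (stripKernel ω (z - conj ζ')) ∂(stripMeasure ω) = g ζ' := by
    intro n
    rw [h.integral_mul_conj_stripKernel (h.gaussianDecay_mul hg hL (hδ0 n) ζ') hζ' (hintn n)]
    simp
  have hlim := tendsto_integral_of_dominated_convergence
    (F := fun n z => g z * Complex.exp (-δ n * (z ^ 2 - ζ' ^ 2)) *
      conj (stripKernel ω (z - conj ζ')))
    (f := fun z => g z * conj (stripKernel ω (z - conj ζ')))
    (fun z => M * ‖g z * conj (stripKernel ω (z - conj ζ'))‖)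
    (fun n => (hintn n).aestronglyMeasurable) (hint.norm.const_mul M)
    (fun n => by
      filter_upwards [hae] with z hz
      rw [mul_right_comm, mul_comm, norm_mul]
      exact mul_le_mul_of_nonneg_right (hbd n z hz) (norm_nonneg _))
    (Eventually.of_forall fun z => by
      have h1 : Tendsto δ atTop (𝓝 0) := tendsto_one_div_add_atTop_nhds_zero_nat
      have h2 : Tendsto (fun n => Complex.exp (-δ n * (z ^ 2 - ζ' ^ 2))) atTop (𝓝 1) := by
        have hc : Continuous fun t : ℝ => Complex.exp (-t * (z ^ 2 - ζ' ^ 2)) := by fun_prop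
        have h3 := (hc.tendsto 0).comp h1
        simp only [Complex.ofReal_zero, neg_zero, zero_mul, Complex.exp_zero] at h3
        exact h3
      simpa using (h2.const_mul (g z)).mul_const (conj (stripKernel ω (z - conj ζ'))))
  simp only [hval] at hlim
  exact (tendsto_nhds_unique hlim tendsto_const_nhds)

theorem isReproducingKernel : IsReproducingKernel (strip β) (stripMeasure ω)
    (bergman (strip β) (stripMeasure ω))
    (fun ζ ζ' => stripKernel ω (ζ.1 - conj ζ'.1)) := by
  intro ζ'
  have hms : MeasurableSet (strip β) := (isOpen_strip β).measurableSet
  have hd : DifferentiableOn ℂ (fun z => stripKernel ω (z - conj ζ'.1)) (strip β) := fun z hz => by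
    have h1 : |(z - conj ζ'.1).im| < 2 * β := by
      have h1 := abs_lt.2 hz
      have h2 := abs_lt.2 ζ'.2
      rw [Complex.sub_im, Complex.conj_im, sub_neg_eq_add]
      linarith [abs_add_le z.im ζ'.1.im]
    exact ((h.differentiableAt_stripKernel h1).comp z (f := fun z => z - conj ζ'.1)
      (by fun_prop)).differentiableWithinAt
  refine ⟨(mem_bergman_iff hms).2 ⟨_, hd, fun _ => rfl, ?_⟩, fun F hF => ?_⟩
  · rw [h.restrict_stripMeasure]
    exact h.memLp_stripKernel ζ'.2
  · obtain ⟨g, hg, hFg, hL⟩ := (mem_bergman_iff hms).1 hF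
    rw [bergmanInner_eq hms _ hFg (g := fun z => stripKernel ω (z - conj ζ'.1)) fun _ => rfl]
    rw [h.restrict_stripMeasure] at hL ⊢
    rw [hFg, h.reproducing hg hL ζ'.2]

end IsStripWeight

theorem conj_bergmanInner {E : Type*} [MeasurableSpace E] (Ω : Set E) (m : Measure E)
    (F G : Ω → ℂ) : conj (bergmanInner Ω m F G) = bergmanInner Ω m G F := by
  rw [bergmanInner, ← integral_conj, bergmanInner]
  simp [mul_comm]

/-- Reproducing a section of one kernel with the other shows that K'(z, z') is the conjugate of
K(z', z). The same argument for K alone gives its Hermitian symmetry. -/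
theorem IsReproducingKernel.unique {E : Type*} [MeasurableSpace E] {Ω : Set E} {m : Measure E}
    {V : Submodule ℂ (Ω → ℂ)} {K K' : Ω → Ω → ℂ} (hK : IsReproducingKernel Ω m V K)
    (hK' : IsReproducingKernel Ω m V K') : K = K' := by
  ext z z'
  have h1 := (hK z).2 _ (hK' z').1
  have h2 := (hK' z').2 _ (hK z).1
  have h3 := (hK z).2 _ (hK z').1
  have h4 := (hK z').2 _ (hK z).1
  rw [← conj_bergmanInner, ← h2] at h1
  rw [← conj_bergmanInner, ← h4] at h3
  rw [h1, h3]

end UnwoundWorm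

/-! ### Convolutions of cut-off exponentials and the weights ω_{j,k} -/

namespace UnwoundWorm
open MeasureTheory Filter Topology Set
open scoped Interval ENNReal

/-- Bounded functions on the line that are positive exactly on `(-r, r)` and continuous off the
end points. -/
structure IsBump (r : ℝ) (f : ℝ → ℝ) : Prop where
  r_pos : 0 < r
  measurable : Measurable f
  bdd : ∃ M, ∀ y, f y ≤ M
  pos : ∀ y ∈ Ioo (-r) r, 0 < f y
  zero : ∀ y ∉ Ioo (-r) r, f y = 0
  continuousAt : ∀ y, y ≠ r → y ≠ -r → ContinuousAt f y

theorem conv_apply (f g : ℝ → ℝ) (y : ℝ) : conv f g y = ∫ s, f s * g (y - s) := by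
  simp [conv, convolution_def]

namespace IsBump

theorem isStripWeight {r : ℝ} {f : ℝ → ℝ} (hf : IsBump r f) (hc : Continuous f) :
    IsStripWeight r f := ⟨hf.r_pos, hc, hf.pos, hf.zero⟩

theorem nonneg {r : ℝ} {f : ℝ → ℝ} (hf : IsBump r f) (y : ℝ) : 0 ≤ f y := by
  by_cases hy : y ∈ Ioo (-r) r
  · exact (hf.pos y hy).le
  · exact (hf.zero y hy).ge

theorem integrable_mul {r : ℝ} {f : ℝ → ℝ} (hf : IsBump r f) {g : ℝ → ℝ} (hg : Continuous g) :
    Integrable fun y => f y * g y := by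
  obtain ⟨M, hM⟩ := hf.bdd
  have h1 : IntegrableOn g (Ioo (-r) r) :=
    (hg.integrableOn_Icc (a := -r) (b := r)).mono_set Ioo_subset_Icc_self
  have h2 : IntegrableOn (fun y => f y * g y) (Ioo (-r) r) :=
    Integrable.bdd_mul (c := M) h1 hf.measurable.aestronglyMeasurable
      (Eventually.of_forall fun y => by rw [Real.norm_of_nonneg (hf.nonneg y)]; exact hM y)
  refine (integrableOn_iff_integrable_of_support_subset fun y hy => ?_).1 h2
  by_contra hcon
  exact hy (by simp [hf.zero y hcon])

theorem integrable {r : ℝ} {f : ℝ → ℝ} (hf : IsBump r f) : Integrable f := by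
  simpa using hf.integrable_mul (g := fun _ => 1) continuous_const

variable {r R : ℝ} {f g : ℝ → ℝ} (hf : IsBump r f) (hg : IsBump R g)
include hf hg

theorem integrable_conv (y : ℝ) : Integrable fun s => f s * g (y - s) := by
  obtain ⟨M, hM⟩ := hg.bdd
  refine hf.integrable.mul_bdd (c := M) ?_ (Eventually.of_forall fun s => ?_)
  · exact (hg.measurable.comp (measurable_const.sub measurable_id)).aestronglyMeasurable
  · rw [Real.norm_of_nonneg (hg.nonneg _)]; exact hM _

theorem ofReal_conv (y : ℝ) : ENNReal.ofReal (conv f g y) =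
    ∫⁻ s, ENNReal.ofReal (f s) * ENNReal.ofReal (g (y - s)) := by
  rw [conv_apply, ofReal_integral_eq_lintegral_ofReal (hf.integrable_conv hg y)
    (Eventually.of_forall fun s => mul_nonneg (hf.nonneg _) (hg.nonneg _))]
  exact lintegral_congr fun s => ENNReal.ofReal_mul (hf.nonneg _)

/-- For fixed y the integrand is continuous in y except at the two points s = y ± R, a null set, so
dominated convergence applies despite the jumps of g. -/
theorem continuous_conv : Continuous (conv f g) := by
  obtain ⟨M, hM⟩ := hg.bdd
  have e : conv f g = fun y => ∫ s, f s * g (y - s) := funext (conv_apply f g)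
  rw [e]
  refine continuous_iff_continuousAt.2 fun y => continuousAt_of_dominated
    (bound := fun s => ‖f s‖ * M) (Eventually.of_forall fun y =>
      (hf.integrable_conv hg y).aestronglyMeasurable)
    (Eventually.of_forall fun y => Eventually.of_forall fun s => ?_)
    (hf.integrable.norm.mul_const M) ?_
  · rw [norm_mul, Real.norm_of_nonneg (hg.nonneg _)]
    exact mul_le_mul_of_nonneg_left (hM _) (norm_nonneg _)
  · have h1 : ∀ᵐ s : ℝ, s ≠ y - R := by simp [ae_iff]
    have h2 : ∀ᵐ s : ℝ, s ≠ y + R := by simp [ae_iff]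
    filter_upwards [h1, h2] with s hs1 hs2
    refine continuousAt_const.mul (ContinuousAt.comp (f := fun y => y - s) (g := g) ?_
      (by fun_prop))
    exact hg.continuousAt _ (fun h => hs1 (by linarith)) (fun h => hs2 (by linarith))

/-- The intervals (-r, r) and (y - R, y + R) meet, and then in an interval of positive length,
exactly when |y| < r + R. -/
theorem conv : IsBump (r + R) (conv f g) where
  r_pos := add_pos hf.r_pos hg.r_pos
  measurable := (hf.continuous_conv hg).measurable
  bdd := by
    obtain ⟨M, hM⟩ := hg.bdd
    refine ⟨∫ s, f s * M, fun y => ?_⟩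
    rw [conv_apply]
    exact integral_mono (hf.integrable_conv hg y) (hf.integrable.mul_const M) fun s =>
      mul_le_mul_of_nonneg_left (hM _) (hf.nonneg _)
  pos := by
    intro y hy
    have hr := hf.r_pos
    have hR := hg.r_pos
    rw [conv_apply, integral_pos_iff_support_of_nonneg
      (fun s => mul_nonneg (hf.nonneg _) (hg.nonneg _)) (hf.integrable_conv hg y)]
    have hlt : max (-r) (y - R) < min r (y + R) := by
      simp only [max_lt_iff, lt_min_iff]
      refine ⟨⟨by linarith, by linarith [hy.2]⟩, by linarith [hy.1], by linarith⟩
    refine lt_of_lt_of_le ?_ (measure_mono (s := Ioo (max (-r) (y - R)) (min r (y + R))) ?_)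
    · rw [Real.volume_Ioo]; simpa using hlt
    · intro s hs
      simp only [mem_Ioo, max_lt_iff, lt_min_iff] at hs
      exact (mul_pos (hf.pos s ⟨hs.1.1, hs.2.1⟩)
        (hg.pos _ ⟨by linarith [hs.2.2], by linarith [hs.1.2]⟩)).ne'
  zero := by
    intro y hy
    rw [conv_apply]
    refine integral_eq_zero_of_ae (Eventually.of_forall fun s => ?_)
    by_cases h1 : s ∈ Ioo (-r) r
    · by_cases h2 : y - s ∈ Ioo (-R) R
      · exact absurd ⟨by linarith [h1.1, h2.1], by linarith [h1.2, h2.2]⟩ hy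
      · simp [hg.zero _ h2]
    · simp [hf.zero _ h1]
  continuousAt := fun y _ _ => (hf.continuous_conv hg).continuousAt

/-- Since e^{-2yξ} = e^{-2sξ} e^{-2(y-s)ξ}, the twisted convolution is the convolution of the
twisted functions, whose integral is a product. -/
theorem lap_conv (ξ : ℝ) : lap (UnwoundWorm.conv f g) ξ = lap f ξ * lap g ξ := by
  have h1 := integral_convolution (μ := volume) (ν := volume) (ContinuousLinearMap.mul ℝ ℝ)
    (hf.integrable_mul (g := fun y => Real.exp (-2 * y * ξ)) (by fun_prop))
    (hg.integrable_mul (g := fun y => Real.exp (-2 * y * ξ)) (by fun_prop))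
  rw [ContinuousLinearMap.mul_apply'] at h1
  rw [lap, lap, lap, ← h1]
  refine integral_congr_ae (Eventually.of_forall fun y => ?_)
  simp only [conv_apply, convolution_def, ContinuousLinearMap.mul_apply']
  rw [← integral_mul_const]
  refine integral_congr_ae (Eventually.of_forall fun s => ?_)
  have : Real.exp (-2 * y * ξ) = Real.exp (-2 * s * ξ) * Real.exp (-2 * (y - s) * ξ) := by
    rw [← Real.exp_add]; ring_nf
  simp only [this]
  ring

end IsBump

theorem isBump_expCutoff (a : ℝ) {r : ℝ} (hr : 0 < r) : IsBump r (expCutoff a r) where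
  r_pos := hr
  measurable := Measurable.indicator (by fun_prop) measurableSet_Ioo
  bdd := by
    refine ⟨Real.exp (|a| * r), fun y => ?_⟩
    by_cases hy : y ∈ Ioo (-r) r
    · rw [expCutoff, indicator_of_mem hy]
      refine Real.exp_le_exp.2 ?_
      calc a * y ≤ |a * y| := le_abs_self _
        _ = |a| * |y| := abs_mul _ _
        _ ≤ _ := mul_le_mul_of_nonneg_left (abs_le.2 ⟨hy.1.le, hy.2.le⟩) (abs_nonneg _)
    · rw [expCutoff, indicator_of_notMem hy]
      positivity
  pos := fun y hy => by rw [expCutoff, indicator_of_mem hy]; positivity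
  zero := fun y hy => by rw [expCutoff, indicator_of_notMem hy]
  continuousAt := by
    intro y h1 h2
    have hfr : y ∉ frontier (Ioo (-r) r) := by
      rw [frontier_Ioo (by linarith)]
      simp [h1, h2]
    exact ContinuousOn.continuousAt_indicator (by fun_prop) hfr

theorem indicator_one_eq_expCutoff (r : ℝ) :
    indicator (Ioo (-r) r) (fun _ => (1 : ℝ)) = expCutoff 0 r := by
  simp [expCutoff]

theorem lap_expCutoff_zero {r : ℝ} (hr : 0 < r) {ξ : ℝ} (hξ : ξ ≠ 0) :
    lap (expCutoff 0 r) ξ = Real.sinh (2 * r * ξ) / ξ := by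
  have e : lap (expCutoff 0 r) ξ = ∫ y in (-r)..r, Real.exp (-2 * ξ * y) := by
    rw [intervalIntegral.integral_of_le (by linarith), integral_Ioc_eq_integral_Ioo,
      ← integral_indicator measurableSet_Ioo, lap]
    refine integral_congr_ae (Eventually.of_forall fun y => ?_)
    by_cases hy : y ∈ Ioo (-r) r
    · simp [expCutoff, hy]; ring_nf
    · simp [expCutoff, hy]
  rw [e, intervalIntegral.integral_comp_mul_left (fun y => Real.exp y) (by simpa using hξ),
    integral_exp, Real.sinh_eq, smul_eq_mul]
  have h1 : -2 * ξ * r = -(2 * r * ξ) := by ring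
  have h2 : -2 * ξ * -r = 2 * r * ξ := by ring
  rw [h1, h2]
  field_simp
  ring

/-- The weight `ω_{j,k}` as a function of the imaginary part. -/
noncomputable def profile (μ : ℝ) (j k : ℤ) (y : ℝ) : ℝ :=
  Real.pi ^ 2 * conv (expCutoff ((j : ℝ) + 1) μ) (conv (expCutoff ((k : ℝ) + 1) μ)
    (Set.indicator (Set.Ioo (-(Real.pi / 2)) (Real.pi / 2)) (fun _ => 1))) y

theorem weightedVolume_eq (μ : ℝ) (j k : ℤ) :
    weightedVolume μ j k = stripMeasure (profile μ j k) := rfl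

theorem isStripWeight_profile {μ : ℝ} (hμ : 0 < μ) (j k : ℤ) :
    IsStripWeight (halfWidth μ) (profile μ j k) := by
  have h3 := isBump_expCutoff 0 (half_pos Real.pi_pos)
  rw [← indicator_one_eq_expCutoff] at h3
  have h2 := (isBump_expCutoff ((k : ℝ) + 1) hμ).conv h3
  have h1 := (isBump_expCutoff ((j : ℝ) + 1) hμ)
  have h := (h1.conv h2).isStripWeight (h1.continuous_conv h2)
  have e : μ + (μ + Real.pi / 2) = halfWidth μ := by rw [halfWidth]; ring
  rw [e] at h
  exact ⟨h.beta_pos, continuous_const.mul h.continuous,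
    fun y hy => mul_pos (by positivity) (h.pos y hy),
    fun y hy => by rw [profile, h.zero y hy, mul_zero]⟩

theorem lap_profile {μ : ℝ} (hμ : 0 < μ) {ξ : ℝ} (hξ : ξ ≠ 0) :
    lap (profile μ (-1) (-1)) ξ = Real.pi ^ 2 *
      ((Real.sinh (2 * μ * ξ) / ξ) ^ 2 * (Real.sinh (Real.pi * ξ) / ξ)) := by
  have h3 := isBump_expCutoff 0 (half_pos Real.pi_pos)
  have h1 := isBump_expCutoff 0 hμ
  have e : lap (profile μ (-1) (-1)) ξ = Real.pi ^ 2 *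
      lap (conv (expCutoff 0 μ) (conv (expCutoff 0 μ) (expCutoff 0 (Real.pi / 2)))) ξ := by
    rw [lap, lap, ← integral_const_mul]
    refine integral_congr_ae (Eventually.of_forall fun y => ?_)
    simp only [profile, ← indicator_one_eq_expCutoff (Real.pi / 2)]
    norm_num
    ring
  rw [e, h1.lap_conv (h1.conv h3), h1.lap_conv h3, lap_expCutoff_zero hμ hξ,
    lap_expCutoff_zero (half_pos Real.pi_pos) hξ]
  have : 2 * (Real.pi / 2) * ξ = Real.pi * ξ := by ring
  rw [this]
  ring

/-- The two sides differ at ξ = 0: there `kernelIntegrand` has the default value of 0/0, while the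
left-hand side is not zero. -/
theorem kernelIntegrand_ae_eq {μ : ℝ} (hμ : 0 < μ) (τ : ℂ) :
    (fun ξ : ℝ => Complex.exp (Complex.I * τ * ξ) /
      (2 * Real.pi * lap (profile μ (-1) (-1)) ξ : ℝ)) =ᵐ[volume] kernelIntegrand μ τ := by
  have h1 : ∀ᵐ ξ : ℝ, ξ ≠ 0 := by simp [ae_iff]
  filter_upwards [h1] with ξ hξ
  rw [lap_profile hμ hξ, kernelIntegrand]
  have h2 : (ξ : ℂ) ≠ 0 := by exact_mod_cast hξ
  have h3 : ((Real.sinh (2 * μ * ξ) : ℝ) : ℂ) ≠ 0 := by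
    rw [Complex.ofReal_ne_zero, Real.sinh_ne_zero]; positivity
  have h4 : ((Real.sinh (Real.pi * ξ) : ℝ) : ℂ) ≠ 0 := by
    rw [Complex.ofReal_ne_zero, Real.sinh_ne_zero]; positivity
  have h5 : (Real.pi : ℂ) ≠ 0 := by exact_mod_cast Real.pi_ne_zero
  push_cast
  push_cast at h3 h4
  field_simp

end UnwoundWorm

/-! ### Geometry of D'_μ and the structure of isotypic functions -/

namespace UnwoundWorm
open MeasureTheory Filter Topology Set
open scoped Interval ENNReal

theorem mem_unwoundDomain_iff {μ : ℝ} {w : ℂ × ℂ × ℂ} : w ∈ unwoundDomain μ ↔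
    w.2.1 ≠ 0 ∧ w.2.2 ≠ 0 ∧
    w.1.im - Real.log (‖w.2.1‖ ^ 2) - Real.log (‖w.2.2‖ ^ 2) ∈
      Ioo (-(Real.pi / 2)) (Real.pi / 2) ∧
    Real.log (‖w.2.1‖ ^ 2) ∈ Ioo (-μ) μ ∧ Real.log (‖w.2.2‖ ^ 2) ∈ Ioo (-μ) μ := by
  refine and_congr_right fun h2 => and_congr_right fun h3 => ?_
  rw [norm_mul, mul_pow, Real.log_mul (by simpa using h2) (by simpa using h3), sub_sub]

theorem log_norm_exp_sq (z : ℂ) : Real.log (‖Complex.exp z‖ ^ 2) = 2 * z.re := by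
  rw [Complex.norm_exp, Real.log_pow, Real.log_exp]; norm_num

theorem mk_exp_mem_unwoundDomain_iff {μ : ℝ} {ζ a b : ℂ} :
    (ζ, Complex.exp a, Complex.exp b) ∈ unwoundDomain μ ↔
      ζ.im - 2 * a.re - 2 * b.re ∈ Ioo (-(Real.pi / 2)) (Real.pi / 2) ∧
      2 * a.re ∈ Ioo (-μ) μ ∧ 2 * b.re ∈ Ioo (-μ) μ := by
  rw [mem_unwoundDomain_iff]
  simp only [log_norm_exp_sq, ne_eq, Complex.exp_ne_zero, not_false_eq_true, true_and]

theorem isOpen_unwoundDomain (μ : ℝ) : IsOpen (unwoundDomain μ) := by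
  rw [isOpen_iff_mem_nhds]
  intro w hw
  obtain ⟨h2, h3, h1, hs, ht⟩ := mem_unwoundDomain_iff.1 hw
  have c2 : ContinuousAt (fun w : ℂ × ℂ × ℂ => Real.log (‖w.2.1‖ ^ 2)) w :=
    ContinuousAt.log (by fun_prop) (by simpa using h2)
  have c3 : ContinuousAt (fun w : ℂ × ℂ × ℂ => Real.log (‖w.2.2‖ ^ 2)) w :=
    ContinuousAt.log (by fun_prop) (by simpa using h3)
  have c1 : ContinuousAt (fun w : ℂ × ℂ × ℂ =>
      w.1.im - Real.log (‖w.2.1‖ ^ 2) - Real.log (‖w.2.2‖ ^ 2)) w :=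
    (ContinuousAt.sub (Complex.continuous_im.comp continuous_fst).continuousAt c2).sub c3
  have e2 : ∀ᶠ w : ℂ × ℂ × ℂ in 𝓝 w, w.2.1 ≠ 0 :=
    ContinuousAt.eventually_ne (by fun_prop) h2
  have e3 : ∀ᶠ w : ℂ × ℂ × ℂ in 𝓝 w, w.2.2 ≠ 0 :=
    ContinuousAt.eventually_ne (by fun_prop) h3
  filter_upwards [e2, e3, c1.eventually_mem (isOpen_Ioo.mem_nhds h1),
    c2.eventually_mem (isOpen_Ioo.mem_nhds hs), c3.eventually_mem (isOpen_Ioo.mem_nhds ht)]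
    with v h2' h3' h1' hs' ht'
  exact mem_unwoundDomain_iff.2 ⟨h2', h3', h1', hs', ht'⟩

/-- The monomial `w₂^j w₃^k`. -/
noncomputable def monomial (j k : ℤ) (w : ℂ × ℂ × ℂ) : ℂ := w.2.1 ^ j * w.2.2 ^ k

theorem monomial_ne_zero {μ : ℝ} (j k : ℤ) {w : ℂ × ℂ × ℂ} (hw : w ∈ unwoundDomain μ) :
    monomial j k w ≠ 0 := mul_ne_zero (zpow_ne_zero _ hw.1) (zpow_ne_zero _ hw.2.1)

theorem differentiableOn_monomial (μ : ℝ) (j k : ℤ) :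
    DifferentiableOn ℂ (monomial j k) (unwoundDomain μ) := by
  intro w hw
  refine DifferentiableAt.differentiableWithinAt ?_
  unfold monomial
  refine DifferentiableAt.mul ?_ ?_
  · exact DifferentiableAt.zpow (by fun_prop) (.inl hw.1)
  · exact DifferentiableAt.zpow (by fun_prop) (.inl hw.2.1)

theorem measurable_monomial (j k : ℤ) : Measurable (monomial j k) := by
  unfold monomial
  fun_prop

/-- A function on `ℂ²` that is invariant under imaginary translations of both variables is constant
on convex open sets where it is holomorphic. -/
theorem eq_of_forall_add_mul_I {φ : ℂ × ℂ → ℂ} {U : Set (ℂ × ℂ)} (hU : IsOpen U)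
    (hc : Convex ℝ U) (hφ : DifferentiableOn ℂ φ U)
    (h1 : ∀ p ∈ U, ∀ θ : ℝ, φ (p.1 + θ * Complex.I, p.2) = φ p)
    (h2 : ∀ p ∈ U, ∀ θ : ℝ, φ (p.1, p.2 + θ * Complex.I) = φ p) {p q : ℂ × ℂ} (hp : p ∈ U)
    (hq : q ∈ U) : φ p = φ q := by
  -- The derivative vanishes along iv by invariance, hence along v by complex linearity.
  have key : ∀ p ∈ U, ∀ v : ℂ × ℂ, (∀ θ : ℝ, φ (p + (θ : ℂ) • (Complex.I • v)) = φ p) →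
      fderiv ℂ φ p v = 0 := by
    intro p hp v hv
    have hd := (hφ.differentiableAt (hU.mem_nhds hp)).hasFDerivAt
    have hl : HasDerivAt (fun θ : ℝ => p + (θ : ℂ) • (Complex.I • v)) (Complex.I • v) 0 := by
      have h0 : HasDerivAt (fun θ : ℝ => (θ : ℂ)) 1 0 := Complex.ofRealCLM.hasDerivAt
      simpa using (h0.smul_const (Complex.I • v)).const_add p
    have hd' : HasFDerivAt φ (fderiv ℂ φ p) (p + ((0 : ℝ) : ℂ) • (Complex.I • v)) := by
      simpa using hd
    have h3 := (hd'.restrictScalars ℝ).comp_hasDerivAt (0 : ℝ) hl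
    have h4 : (φ ∘ fun θ : ℝ => p + (θ : ℂ) • (Complex.I • v)) = fun _ => φ p := funext hv
    rw [h4] at h3
    have h5 := h3.unique (hasDerivAt_const _ _)
    have h6 : Complex.I • fderiv ℂ φ p v = 0 := by simpa using h5
    simpa using h6
  have hz : EqOn (fderiv ℂ φ) 0 U := by
    intro p hp
    refine ContinuousLinearMap.ext fun v => ?_
    have e : v = v.1 • ((1 : ℂ), (0 : ℂ)) + v.2 • ((0 : ℂ), (1 : ℂ)) := by
      ext <;> simp
    rw [e, map_add, map_smul, map_smul, key p hp (1, 0), key p hp (0, 1)]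
    · simp
    · intro θ
      rw [← h2 p hp θ]
      congr 1
      ext <;> simp
    · intro θ
      rw [← h1 p hp θ]
      congr 1
      ext <;> simp
  exact hU.is_const_of_fderiv_eq_zero hc.isPreconnected hφ hz hp hq

/-- Pulled back by the exponential in both variables, the fibre becomes convex and each rotation
becomes an imaginary translation, under which the quotient by the monomial is invariant. Convexity
supplies the connectedness needed to compare any two points of the fibre. -/
theorem isotypic_fiber_eq {μ : ℝ} {j k : ℤ} {F : unwoundDomain μ → ℂ}
    (hF : F ∈ isotypic (unwoundDomain μ) j k) {w w' : unwoundDomain μ} (hw : w.1.1 = w'.1.1) :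
    F w * (monomial j k w)⁻¹ = F w' * (monomial j k w')⁻¹ := by
  obtain ⟨⟨⟨g, hg, hFg⟩, -⟩, hF1, hF2⟩ := hF
  set ζ := w.1.1 with hζ
  set E : ℂ × ℂ → ℂ × ℂ × ℂ := fun p => (ζ, Complex.exp p.1, Complex.exp p.2) with hE
  set U : Set (ℂ × ℂ) := E ⁻¹' unwoundDomain μ with hU
  set φ : ℂ × ℂ → ℂ := fun p => g (E p) * (monomial j k (E p))⁻¹ with hφ
  have hEd : Differentiable ℂ E := by
    refine (differentiable_const _).prodMk ((Complex.differentiable_exp.comp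
      differentiable_fst).prodMk (Complex.differentiable_exp.comp differentiable_snd))
  have hUo : IsOpen U := (isOpen_unwoundDomain μ).preimage hEd.continuous
  have hUc : Convex ℝ U := by
    intro p hp q hq a b ha hb hab
    simp only [hU, hE, mem_preimage, mk_exp_mem_unwoundDomain_iff, mem_Ioo] at hp hq ⊢
    have hre1 : ((a • p + b • q).1).re = a * p.1.re + b * q.1.re := by simp
    have hre2 : ((a • p + b • q).2).re = a * p.2.re + b * q.2.re := by simp
    obtain ⟨hp1, hp2, hp3⟩ := hp
    obtain ⟨hq1, hq2, hq3⟩ := hq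
    have comb : ∀ {l u x y : ℝ}, x ∈ Ioo l u → y ∈ Ioo l u → a * x + b * y ∈ Ioo l u :=
      fun hx hy => (convex_Ioo _ _) hx hy ha hb hab
    rw [hre1, hre2]
    refine ⟨?_, ?_, ?_⟩
    · have := comb (mem_Ioo.2 hp1) (mem_Ioo.2 hq1)
      have e : ζ.im - 2 * (a * p.1.re + b * q.1.re) - 2 * (a * p.2.re + b * q.2.re)
          = a * (ζ.im - 2 * p.1.re - 2 * p.2.re) + b * (ζ.im - 2 * q.1.re - 2 * q.2.re) := by
        linear_combination (-ζ.im) * hab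
      rw [e]; exact this
    · have := comb (mem_Ioo.2 hp2) (mem_Ioo.2 hq2)
      have e : 2 * (a * p.1.re + b * q.1.re) = a * (2 * p.1.re) + b * (2 * q.1.re) := by ring
      rw [e]; exact this
    · have := comb (mem_Ioo.2 hp3) (mem_Ioo.2 hq3)
      have e : 2 * (a * p.2.re + b * q.2.re) = a * (2 * p.2.re) + b * (2 * q.2.re) := by ring
      rw [e]; exact this
  have hφd : DifferentiableOn ℂ φ U := by
    refine DifferentiableOn.mul (hg.comp hEd.differentiableOn fun p hp => hp) ?_
    refine DifferentiableOn.inv ?_ fun p hp => monomial_ne_zero j k hp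
    exact (differentiableOn_monomial μ j k).comp hEd.differentiableOn fun p hp => hp
  have hzp : ∀ (n : ℤ) (z : ℂ), Complex.exp z ^ n = Complex.exp (n * z) := fun n z =>
    (Complex.exp_int_mul z n).symm
  have hrot1 : ∀ p ∈ U, ∀ θ : ℝ, φ (p.1 + θ * Complex.I, p.2) = φ p := by
    intro p hp θ
    have hp' : E (p.1 + θ * Complex.I, p.2) ∈ unwoundDomain μ := by
      simp only [hU, hE, mem_preimage, mk_exp_mem_unwoundDomain_iff] at hp ⊢
      simpa using hp
    have h1 := hF1 θ ⟨E p, hp⟩ ⟨_, hp'⟩ (by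
      simp only [hE]
      rw [← Complex.exp_add]; ring_nf)
    rw [hFg, hFg] at h1
    simp only [hφ]
    rw [h1]
    simp only [hE, monomial, hzp, ← Complex.exp_neg, ← Complex.exp_add, mul_assoc]
    rw [mul_left_comm, ← Complex.exp_add]
    ring_nf
  have hrot2 : ∀ p ∈ U, ∀ θ : ℝ, φ (p.1, p.2 + θ * Complex.I) = φ p := by
    intro p hp θ
    have hp' : E (p.1, p.2 + θ * Complex.I) ∈ unwoundDomain μ := by
      simp only [hU, hE, mem_preimage, mk_exp_mem_unwoundDomain_iff] at hp ⊢
      simpa using hp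
    have h1 := hF2 θ ⟨E p, hp⟩ ⟨_, hp'⟩ (by
      simp only [hE]
      rw [← Complex.exp_add]; ring_nf)
    rw [hFg, hFg] at h1
    simp only [hφ]
    rw [h1]
    simp only [hE, monomial, hzp, ← Complex.exp_neg, ← Complex.exp_add, mul_assoc]
    rw [mul_left_comm, ← Complex.exp_add]
    ring_nf
  have hrep : ∀ v : unwoundDomain μ, v.1.1 = ζ →
      E (Complex.log v.1.2.1, Complex.log v.1.2.2) = v.1 := by
    intro v hv
    simp only [hE, Complex.exp_log v.2.1, Complex.exp_log v.2.2.1, ← hv]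
  have hmem : ∀ v : unwoundDomain μ, v.1.1 = ζ →
      (Complex.log v.1.2.1, Complex.log v.1.2.2) ∈ U := fun v hv => by
    rw [hU, mem_preimage, hrep v hv]; exact v.2
  have := eq_of_forall_add_mul_I hUo hUc hφd hrot1 hrot2 (hmem w rfl) (hmem w' hw.symm)
  simpa only [hφ, hrep w rfl, hrep w' hw.symm, ← hFg] using this

/-- The point of `D'_μ` over `ζ` with `log |w₂|² = log |w₃|² = (μ/β) Im ζ`. -/
noncomputable def sect (μ : ℝ) (ζ : ℂ) : ℂ × ℂ × ℂ :=
  (ζ, Complex.exp ((ζ.im * μ / (2 * halfWidth μ) : ℝ)),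
    Complex.exp ((ζ.im * μ / (2 * halfWidth μ) : ℝ)))

/-- With t = Im ζ / β ∈ (-1, 1), both logarithms equal tμ and Im ζ - 2tμ = tπ/2, so all three
conditions hold at once. -/
theorem sect_mem {μ : ℝ} (hμ : 0 < μ) {ζ : ℂ} (hζ : ζ ∈ strip (halfWidth μ)) :
    sect μ ζ ∈ unwoundDomain μ := by
  have hβ : 0 < halfWidth μ := by unfold halfWidth; positivity
  set t := ζ.im / halfWidth μ with ht
  have ht1 : -1 < t := by rw [ht, lt_div_iff₀ hβ]; linarith [hζ.1]
  have ht2 : t < 1 := by rw [ht, div_lt_iff₀ hβ]; linarith [hζ.2]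
  have e1 : 2 * (ζ.im * μ / (2 * halfWidth μ)) = t * μ := by rw [ht]; field_simp
  have e2 : ζ.im = t * (2 * μ + Real.pi / 2) := by
    rw [ht, ← halfWidth]; field_simp
  rw [sect, mk_exp_mem_unwoundDomain_iff]
  simp only [Complex.ofReal_re, e1]
  have hp := Real.pi_pos
  refine ⟨⟨?_, ?_⟩, ⟨?_, ?_⟩, ⟨?_, ?_⟩⟩ <;> nlinarith

/-- The quotient of an isotypic function by its monomial, along `sect`, is holomorphic. -/
theorem differentiableOn_sect {μ : ℝ} (hμ : 0 < μ) {j k : ℤ} {F : unwoundDomain μ → ℂ}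
    (hF : F ∈ isotypic (unwoundDomain μ) j k) {g : ℂ × ℂ × ℂ → ℂ}
    (hg : DifferentiableOn ℂ g (unwoundDomain μ)) (hFg : ∀ w : unwoundDomain μ, F w = g w) :
    DifferentiableOn ℂ (fun ζ => g (sect μ ζ) * (monomial j k (sect μ ζ))⁻¹)
      (strip (halfWidth μ)) := by
  intro ζ₀ hζ₀
  refine DifferentiableAt.differentiableWithinAt ?_
  set w₀ := sect μ ζ₀ with hw₀
  have hw₀m : w₀ ∈ unwoundDomain μ := sect_mem hμ hζ₀
  -- `sect` is not holomorphic in ζ. Near ζ₀ the last two coordinates can be frozen at those of w₀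
  -- without leaving the domain, and by `isotypic_fiber_eq` the quotient does not change.
  have hc : ContinuousAt (fun ζ : ℂ => ((ζ, w₀.2) : ℂ × ℂ × ℂ)) ζ₀ := by fun_prop
  have hev : ∀ᶠ ζ in 𝓝 ζ₀, ((ζ, w₀.2) : ℂ × ℂ × ℂ) ∈ unwoundDomain μ :=
    hc.eventually_mem ((isOpen_unwoundDomain μ).mem_nhds hw₀m)
  have hd : DifferentiableAt ℂ (fun ζ : ℂ => g (ζ, w₀.2) * (monomial j k (ζ, w₀.2))⁻¹) ζ₀ := by
    have h1 : DifferentiableAt ℂ g (ζ₀, w₀.2) :=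
      hg.differentiableAt ((isOpen_unwoundDomain μ).mem_nhds hw₀m)
    have h2 : DifferentiableAt ℂ (fun ζ : ℂ => ((ζ, w₀.2) : ℂ × ℂ × ℂ)) ζ₀ :=
      differentiableAt_id.prodMk (differentiableAt_const _)
    exact (h1.comp ζ₀ h2).mul_const (w₀.2.1 ^ j * w₀.2.2 ^ k)⁻¹
  refine hd.congr_of_eventuallyEq ?_
  filter_upwards [hev, (isOpen_strip _).mem_nhds hζ₀] with ζ h1 h2
  have := isotypic_fiber_eq hF (w := ⟨_, sect_mem hμ h2⟩) (w' := ⟨_, h1⟩) rfl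
  rwa [hFg, hFg] at this

end UnwoundWorm

/-! ### Integration along the fibres of D'_μ -/

namespace UnwoundWorm
open MeasureTheory Filter Topology Set
open scoped Interval ENNReal

theorem lintegral_Ioi_eq_lintegral_exp_half (φ : ℝ → ℝ≥0∞) :
    ∫⁻ r in Ioi (0 : ℝ), φ r =
      ∫⁻ s : ℝ, ENNReal.ofReal (Real.exp (s / 2) / 2) * φ (Real.exp (s / 2)) := by
  have himg : (fun s : ℝ => Real.exp (s / 2)) '' univ = Ioi 0 := by
    ext r
    simp only [image_univ, mem_range, mem_Ioi]
    constructor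
    · rintro ⟨s, rfl⟩; exact Real.exp_pos _
    · intro hr
      exact ⟨2 * Real.log r, by rw [mul_div_cancel_left₀ _ two_ne_zero, Real.exp_log hr]⟩
  rw [← himg, lintegral_image_eq_lintegral_abs_deriv_mul (f' := fun s => Real.exp (s / 2) / 2)
    MeasurableSet.univ (fun s _ => ?_) (fun s _ t _ hst => ?_), setLIntegral_univ]
  · refine lintegral_congr fun s => ?_
    rw [abs_of_pos (by positivity)]
  · refine HasDerivAt.hasDerivWithinAt ?_
    exact (((hasDerivAt_id s).div_const 2).exp).congr_deriv (by simp; ring)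
  · have := Real.exp_injective hst
    linarith

/-- Integration of `|z|^{2j} ψ(log |z|²)` in the coordinate `s = log |z|²`. -/
theorem lintegral_zpow_mul_log (j : ℤ) {ψ : ℝ → ℝ≥0∞} (hψ : Measurable ψ) {Θ : ℂ → ℝ≥0∞}
    (hΘ : ∀ z, z ≠ 0 → Θ z = ENNReal.ofReal (‖z ^ j‖ ^ 2) * ψ (Real.log (‖z‖ ^ 2))) :
    ∫⁻ z, Θ z = ENNReal.ofReal Real.pi *
      ∫⁻ s : ℝ, ENNReal.ofReal (Real.exp (((j : ℝ) + 1) * s)) * ψ s := by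
  set κ : ℝ → ℝ≥0∞ := fun r =>
    ENNReal.ofReal r * (ENNReal.ofReal ((r ^ j) ^ 2) * ψ (Real.log (r ^ 2))) with hκ
  have hκm : Measurable κ := by
    refine Measurable.mul (by fun_prop) (Measurable.mul (by fun_prop) (hψ.comp ?_))
    exact Real.measurable_log.comp (by fun_prop)
  have hpi := Real.pi_pos
  have e1 : ∀ p ∈ polarCoord.target,
      ENNReal.ofReal p.1 • Θ (Complex.polarCoord.symm p) = κ p.1 := by
    rintro ⟨r, θ⟩ hp
    have hr : 0 < r := hp.1
    have hn : ‖Complex.polarCoord.symm (r, θ)‖ = r := by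
      rw [Complex.norm_polarCoord_symm, abs_of_pos hr]
    have hne : Complex.polarCoord.symm (r, θ) ≠ 0 := by
      rw [← norm_pos_iff, hn]; exact hr
    rw [hΘ _ hne, norm_zpow, hn, smul_eq_mul]
  rw [← Complex.lintegral_comp_polarCoord_symm,
    setLIntegral_congr_fun polarCoord.open_target.measurableSet e1, polarCoord_target,
    Measure.volume_eq_prod, ← Measure.prod_restrict,
    lintegral_prod (fun p : ℝ × ℝ => κ p.1) (hκm.comp measurable_fst).aemeasurable]
  simp only [lintegral_const, Measure.restrict_apply MeasurableSet.univ, univ_inter,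
    Real.volume_Ioo]
  rw [lintegral_mul_const _ hκm, lintegral_Ioi_eq_lintegral_exp_half, mul_comm,
    ← lintegral_const_mul _ (by fun_prop), ← lintegral_const_mul _ (by fun_prop)]
  refine lintegral_congr fun s => ?_
  have e2 : Real.log (Real.exp (s / 2) ^ 2) = s := by
    rw [Real.log_pow, Real.log_exp]; push_cast; ring
  simp only [hκ, e2]
  simp only [← mul_assoc]
  congr 1
  rw [sub_neg_eq_add, ← ENNReal.ofReal_mul (by positivity), ← ENNReal.ofReal_mul (by positivity),
    ← ENNReal.ofReal_mul (by positivity), ← ENNReal.ofReal_mul hpi.le]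
  congr 1
  have e3 : (Real.exp (s / 2) ^ j) ^ 2 = Real.exp (j * s) := by
    rw [← Real.rpow_intCast, ← Real.exp_mul, ← Real.exp_nat_mul]; push_cast; ring_nf
  -- The polar element r dr dθ becomes 2π · e^{s/2} · (e^{s/2}/2) ds = π e^s ds, and |z^j|² =
  -- e^{js}. This explains the exponent j + 1 and one factor π for each of w₂ and w₃.
  have e4 : Real.exp (((j : ℝ) + 1) * s) = Real.exp (s / 2) * Real.exp (s / 2) * Real.exp (j * s) := by
    rw [← Real.exp_add, ← Real.exp_add]; ring_nf
  rw [e3, e4]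
  ring

theorem ofReal_expCutoff_eq (a r s : ℝ) : ENNReal.ofReal (expCutoff a r s) =
    ENNReal.ofReal (Real.exp (a * s)) * ENNReal.ofReal (expCutoff 0 r s) := by
  by_cases hs : s ∈ Ioo (-r) r <;> simp [expCutoff, hs]

/-- Integration over the fibre of `D'_μ` over `ζ`. -/
theorem lintegral_fiber {μ : ℝ} (hμ : 0 < μ) (j k : ℤ) (ζ : ℂ) :
    ∫⁻ p : ℂ × ℂ, (unwoundDomain μ).indicator
      (fun w => ENNReal.ofReal (‖monomial j k w‖ ^ 2)) (ζ, p) =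
      ENNReal.ofReal (profile μ j k ζ.im) := by
  set χ : ℝ → ℝ := expCutoff 0 (Real.pi / 2) with hχ
  set c : ℝ → ℝ := expCutoff 0 μ with hc
  have bχ : IsBump (Real.pi / 2) χ := isBump_expCutoff 0 (half_pos Real.pi_pos)
  have bc : IsBump μ c := isBump_expCutoff 0 hμ
  have bj := isBump_expCutoff ((j : ℝ) + 1) hμ
  have bk := isBump_expCutoff ((k : ℝ) + 1) hμ
  -- The indicator of the domain splits into cut-offs in s = log |a|², t = log |b|² and Im ζ - s -
  -- t. The dependence on Im ζ - s - t makes the iterated integral a double convolution. The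
  -- coordinate axes are null sets.
  have hind : ∀ a b : ℂ, a ≠ 0 → b ≠ 0 → (unwoundDomain μ).indicator
      (fun w => ENNReal.ofReal (‖monomial j k w‖ ^ 2)) (ζ, a, b) =
      ENNReal.ofReal (‖b ^ k‖ ^ 2) * (ENNReal.ofReal (‖a ^ j‖ ^ 2) *
        (ENNReal.ofReal (c (Real.log (‖a‖ ^ 2))) * (ENNReal.ofReal (c (Real.log (‖b‖ ^ 2))) *
          ENNReal.ofReal (χ (ζ.im - Real.log (‖a‖ ^ 2) - Real.log (‖b‖ ^ 2)))))) := by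
    intro a b ha hb
    by_cases hw : (ζ, a, b) ∈ unwoundDomain μ
    · rw [indicator_of_mem hw]
      obtain ⟨-, -, h1, h2, h3⟩ := mem_unwoundDomain_iff.1 hw
      simp only at h1 h2 h3
      simp only [hχ, hc, expCutoff, indicator_of_mem h1, indicator_of_mem h2, indicator_of_mem h3,
        zero_mul, Real.exp_zero, ENNReal.ofReal_one, mul_one, monomial, norm_mul, mul_pow]
      rw [ENNReal.ofReal_mul (by positivity), mul_comm]
    · rw [indicator_of_notMem hw]
      rw [mem_unwoundDomain_iff] at hw
      simp only [ne_eq, ha, hb, not_false_eq_true, true_and, not_and_or] at hw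
      rcases hw with h | h | h
      · rw [bχ.zero _ h]; simp
      · rw [bc.zero _ h]; simp
      · rw [bc.zero _ h]; simp
  have hmeas : Measurable ((unwoundDomain μ).indicator
      (fun w => ENNReal.ofReal (‖monomial j k w‖ ^ 2))) :=
    Measurable.indicator (((measurable_monomial j k).norm.pow_const 2).ennreal_ofReal)
      (isOpen_unwoundDomain μ).measurableSet
  have hχm := bχ.measurable
  have hcm := bc.measurable
  rw [Measure.volume_eq_prod, lintegral_prod (fun p : ℂ × ℂ => (unwoundDomain μ).indicator
    (fun w => ENNReal.ofReal (‖monomial j k w‖ ^ 2)) (ζ, p))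
    (hmeas.comp measurable_prodMk_left).aemeasurable]
  have hconv := (bk.conv bχ).measurable
  have inner : ∀ a : ℂ, a ≠ 0 → ∫⁻ b : ℂ, (unwoundDomain μ).indicator
      (fun w => ENNReal.ofReal (‖monomial j k w‖ ^ 2)) (ζ, a, b) =
      ENNReal.ofReal (‖a ^ j‖ ^ 2) * (fun s => ENNReal.ofReal (c s) * (ENNReal.ofReal Real.pi *
        ENNReal.ofReal (conv (expCutoff ((k : ℝ) + 1) μ) χ (ζ.im - s)))) (Real.log (‖a‖ ^ 2)) := by
    intro a ha
    rw [lintegral_zpow_mul_log k (ψ := fun t => ENNReal.ofReal (‖a ^ j‖ ^ 2) *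
        (ENNReal.ofReal (c (Real.log (‖a‖ ^ 2))) * (ENNReal.ofReal (c t) *
          ENNReal.ofReal (χ (ζ.im - Real.log (‖a‖ ^ 2) - t))))) (by fun_prop)
        (fun b hb => hind a b ha hb)]
    beta_reduce
    rw [bk.ofReal_conv bχ, ← lintegral_const_mul _ (by fun_prop), ← lintegral_const_mul _ (by
        have := bk.measurable; fun_prop), ← lintegral_const_mul _ (by
        have := bk.measurable; fun_prop), ← lintegral_const_mul _ (by
        have := bk.measurable; fun_prop)]
    refine lintegral_congr fun t => ?_
    rw [ofReal_expCutoff_eq ((k : ℝ) + 1)]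
    ring
  rw [lintegral_zpow_mul_log j (ψ := fun s => ENNReal.ofReal (c s) * (ENNReal.ofReal Real.pi *
        ENNReal.ofReal (conv (expCutoff ((k : ℝ) + 1) μ) χ (ζ.im - s)))) (by fun_prop) inner, profile, indicator_one_eq_expCutoff,
    ENNReal.ofReal_mul (by positivity), bj.ofReal_conv (bk.conv bχ), ENNReal.ofReal_pow
    Real.pi_pos.le, sq, mul_assoc]
  congr 1
  rw [← lintegral_const_mul _ (by have := bj.measurable; fun_prop)]
  refine lintegral_congr fun s => ?_
  rw [ofReal_expCutoff_eq ((j : ℝ) + 1)]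
  ring

/-- The measure `|w₂^j w₃^k|² dV` on `D'_μ`. -/
noncomputable def monomialMeasure (μ : ℝ) (j k : ℤ) : Measure (ℂ × ℂ × ℂ) :=
  (volume.restrict (unwoundDomain μ)).withDensity
    fun w => ENNReal.ofReal (‖monomial j k w‖ ^ 2)

theorem measurable_monomial_density (j k : ℤ) :
    Measurable fun w => ENNReal.ofReal (‖monomial j k w‖ ^ 2) :=
  ((measurable_monomial j k).norm.pow_const 2).ennreal_ofReal

/-- Square-integrability and inner products of functions f(w₁) w₂^j w₃^k are thereby changes of
variables along the first projection. -/
theorem map_monomialMeasure {μ : ℝ} (hμ : 0 < μ) (j k : ℤ) :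
    (monomialMeasure μ j k).map Prod.fst = stripMeasure (profile μ j k) := by
  ext A hA
  have hpre : MeasurableSet (Prod.fst ⁻¹' A : Set (ℂ × ℂ × ℂ)) := measurable_fst hA
  have hD := (isOpen_unwoundDomain μ).measurableSet
  rw [Measure.map_apply measurable_fst hA, monomialMeasure, withDensity_apply _ hpre,
    Measure.restrict_restrict hpre, stripMeasure, withDensity_apply _ hA, inter_comm,
    ← Measure.restrict_restrict hD, ← lintegral_indicator hD, ← lintegral_indicator hpre,
    ← lintegral_indicator hA]
  have hm := ((measurable_monomial_density j k).indicator hD).indicator hpre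
  rw [Measure.volume_eq_prod, lintegral_prod _ hm.aemeasurable]
  refine lintegral_congr fun ζ => ?_
  by_cases hζ : ζ ∈ A
  · rw [indicator_of_mem hζ, ← lintegral_fiber hμ]
    refine lintegral_congr fun p => ?_
    rw [indicator_of_mem (by exact hζ)]
  · rw [indicator_of_notMem hζ, lintegral_eq_zero_iff' (by
      exact (hm.comp measurable_prodMk_left).aemeasurable)]
    refine Eventually.of_forall fun p => ?_
    exact indicator_of_notMem (by exact hζ) _

theorem memLp_monomial_iff {μ : ℝ} (hμ : 0 < μ) (j k : ℤ) {f : ℂ → ℂ}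
    (hf : ContinuousOn f (strip (halfWidth μ))) {g : ℂ × ℂ × ℂ → ℂ}
    (hg : ContinuousOn g (unwoundDomain μ))
    (hfg : ∀ w ∈ unwoundDomain μ, g w = f w.1 * monomial j k w) :
    MemLp g 2 (volume.restrict (unwoundDomain μ)) ↔ MemLp f 2 (stripMeasure (profile μ j k)) := by
  have hD := (isOpen_unwoundDomain μ).measurableSet
  have hw := isStripWeight_profile hμ j k
  have hfm : AEStronglyMeasurable f (stripMeasure (profile μ j k)) := by
    rw [← hw.restrict_stripMeasure]
    exact hf.aestronglyMeasurable (isOpen_strip _).measurableSet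
  rw [memLp_two_iff_integrable_sq_norm (hg.aestronglyMeasurable hD),
    memLp_two_iff_integrable_sq_norm hfm, ← map_monomialMeasure hμ,
    integrable_map_measure (by rw [map_monomialMeasure hμ]; exact (hfm.norm.pow 2))
      measurable_fst.aemeasurable, monomialMeasure,
    integrable_withDensity_iff_integrable_smul' (measurable_monomial_density j k)
      (Eventually.of_forall fun _ => ENNReal.ofReal_lt_top)]
  refine integrable_congr ?_
  filter_upwards [ae_restrict_mem hD] with w hwD
  rw [ENNReal.toReal_ofReal (by positivity), hfg w hwD, norm_mul, mul_pow, smul_eq_mul, mul_comm]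
  rfl

theorem integral_monomial {μ : ℝ} (hμ : 0 < μ) (j k : ℤ) {f₁ f₂ : ℂ → ℂ}
    (hf₁ : ContinuousOn f₁ (strip (halfWidth μ))) (hf₂ : ContinuousOn f₂ (strip (halfWidth μ)))
    {g₁ g₂ : ℂ × ℂ × ℂ → ℂ} (h₁ : ∀ w ∈ unwoundDomain μ, g₁ w = f₁ w.1 * monomial j k w)
    (h₂ : ∀ w ∈ unwoundDomain μ, g₂ w = f₂ w.1 * monomial j k w) :
    ∫ w in unwoundDomain μ, g₁ w * conj (g₂ w) =
      ∫ z, f₁ z * conj (f₂ z) ∂(stripMeasure (profile μ j k)) := by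
  have hD := (isOpen_unwoundDomain μ).measurableSet
  have hw := isStripWeight_profile hμ j k
  have hfm : AEStronglyMeasurable (fun z => f₁ z * conj (f₂ z))
      (stripMeasure (profile μ j k)) := by
    rw [← hw.restrict_stripMeasure]
    exact (hf₁.mul (Complex.continuous_conj.comp_continuousOn hf₂)).aestronglyMeasurable
      (isOpen_strip _).measurableSet
  rw [← map_monomialMeasure hμ, integral_map measurable_fst.aemeasurable
    (by rw [map_monomialMeasure hμ]; exact hfm), monomialMeasure,
    integral_withDensity_eq_integral_toReal_smul (measurable_monomial_density j k)
    (Eventually.of_forall fun _ => ENNReal.ofReal_lt_top)]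
  refine setIntegral_congr_fun hD fun w hwD => ?_
  rw [ENNReal.toReal_ofReal (by positivity), h₁ w hwD, h₂ w hwD, map_mul, Complex.real_smul,
    ← Complex.normSq_eq_norm_sq, ← Complex.mul_conj]
  ring

end UnwoundWorm

/-! ### The isomorphism with the strip and the transfer of kernels -/

namespace UnwoundWorm
open MeasureTheory Filter Topology Set
open scoped Interval ENNReal

/-- The function `f(w₁) w₂^j w₃^k` on `D'_μ`. -/
noncomputable def ofStrip (μ : ℝ) (j k : ℤ) (f : strip (halfWidth μ) → ℂ) (w : unwoundDomain μ) :
    ℂ := f (proj μ w) * monomial j k w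

/-- The function `f` on the strip with `G(w) = f(w₁) w₂^j w₃^k`. -/
noncomputable def toStrip {μ : ℝ} (hμ : 0 < μ) (j k : ℤ) (G : unwoundDomain μ → ℂ)
    (ζ : strip (halfWidth μ)) : ℂ :=
  G ⟨sect μ ζ, sect_mem hμ ζ.2⟩ * (monomial j k (sect μ ζ))⁻¹

theorem toStrip_proj {μ : ℝ} (hμ : 0 < μ) {j k : ℤ} {G : unwoundDomain μ → ℂ}
    (hG : G ∈ isotypic (unwoundDomain μ) j k) (w : unwoundDomain μ) :
    toStrip hμ j k G (proj μ w) = G w * (monomial j k w)⁻¹ :=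
  isotypic_fiber_eq hG (w := ⟨sect μ (proj μ w), sect_mem hμ (proj μ w).2⟩) rfl

theorem ofStrip_toStrip {μ : ℝ} (hμ : 0 < μ) {j k : ℤ} {G : unwoundDomain μ → ℂ}
    (hG : G ∈ isotypic (unwoundDomain μ) j k) : ofStrip μ j k (toStrip hμ j k G) = G := by
  ext w
  rw [ofStrip, toStrip_proj hμ hG, inv_mul_cancel_right₀ (monomial_ne_zero j k w.2)]

theorem toStrip_ofStrip {μ : ℝ} (hμ : 0 < μ) (j k : ℤ) (f : strip (halfWidth μ) → ℂ) :
    toStrip hμ j k (ofStrip μ j k f) = f := by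
  ext ζ
  rw [toStrip, ofStrip, mul_inv_cancel_right₀ (monomial_ne_zero j k (sect_mem hμ ζ.2))]
  rfl

theorem toStrip_mem {μ : ℝ} (hμ : 0 < μ) {j k : ℤ} {G : unwoundDomain μ → ℂ}
    (hG : G ∈ isotypic (unwoundDomain μ) j k) : toStrip hμ j k G ∈ weightedBergman μ j k := by
  obtain ⟨g, hg, hGg, hL⟩ := (mem_bergman_iff (isOpen_unwoundDomain μ).measurableSet).1 hG.1
  have hd := differentiableOn_sect hμ hG hg hGg
  rw [weightedBergman, weightedVolume_eq, mem_bergman_iff (isOpen_strip _).measurableSet,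
    (isStripWeight_profile hμ j k).restrict_stripMeasure]
  refine ⟨_, hd, fun ζ => by rw [toStrip, hGg], (memLp_monomial_iff hμ j k hd.continuousOn
    hg.continuousOn fun w hw => ?_).1 hL⟩
  have h1 := toStrip_proj hμ hG ⟨w, hw⟩
  rw [toStrip, hGg, hGg] at h1
  change _ * _ = _ at h1
  simp only [proj] at h1
  rw [h1, inv_mul_cancel_right₀ (monomial_ne_zero j k hw)]

theorem differentiableOn_comp_fst {μ : ℝ} {g : ℂ → ℂ}
    (hg : DifferentiableOn ℂ g (strip (halfWidth μ))) (j k : ℤ) :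
    DifferentiableOn ℂ (fun w : ℂ × ℂ × ℂ => g w.1 * monomial j k w) (unwoundDomain μ) :=
  (hg.comp differentiableOn_fst fun _ hw => fst_mem_strip hw).mul (differentiableOn_monomial μ j k)

theorem ofStrip_mem {μ : ℝ} (hμ : 0 < μ) {j k : ℤ} {f : strip (halfWidth μ) → ℂ}
    (hf : f ∈ weightedBergman μ j k) : ofStrip μ j k f ∈ isotypic (unwoundDomain μ) j k := by
  rw [weightedBergman, weightedVolume_eq, mem_bergman_iff (isOpen_strip _).measurableSet,
    (isStripWeight_profile hμ j k).restrict_stripMeasure] at hf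
  obtain ⟨g, hg, hfg, hL⟩ := hf
  have hd := differentiableOn_comp_fst hg j k
  refine ⟨(mem_bergman_iff (isOpen_unwoundDomain μ).measurableSet).2
    ⟨_, hd, fun w => by rw [ofStrip, hfg]; rfl, (memLp_monomial_iff hμ j k hg.continuousOn
    hd.continuousOn fun _ _ => rfl).2 hL⟩, fun θ w w' h => ?_, fun θ w w' h => ?_⟩
  · have h1 : proj μ w' = proj μ w := Subtype.ext (by simp [proj, h])
    rw [ofStrip, ofStrip, h1, monomial, monomial, h, mul_zpow, ← Complex.exp_int_mul]
    ring_nf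
  · have h1 : proj μ w' = proj μ w := Subtype.ext (by simp [proj, h])
    rw [ofStrip, ofStrip, h1, monomial, monomial, h, mul_zpow, ← Complex.exp_int_mul]
    ring_nf

theorem bergmanInner_ofStrip {μ : ℝ} (hμ : 0 < μ) {j k : ℤ} {f₁ f₂ : strip (halfWidth μ) → ℂ}
    (hf₁ : f₁ ∈ weightedBergman μ j k) (hf₂ : f₂ ∈ weightedBergman μ j k) :
    bergmanInner (unwoundDomain μ) volume (ofStrip μ j k f₁) (ofStrip μ j k f₂) =
      bergmanInner (strip (halfWidth μ)) (weightedVolume μ j k) f₁ f₂ := by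
  have hms := (isOpen_strip (halfWidth μ)).measurableSet
  obtain ⟨⟨g₁, hg₁, hfg₁⟩, -⟩ := hf₁
  obtain ⟨⟨g₂, hg₂, hfg₂⟩, -⟩ := hf₂
  rw [bergmanInner_eq hms _ hfg₁ hfg₂, weightedVolume_eq,
    (isStripWeight_profile hμ j k).restrict_stripMeasure,
    bergmanInner_eq (isOpen_unwoundDomain μ).measurableSet _
      (f := fun w => g₁ w.1 * monomial j k w) (g := fun w => g₂ w.1 * monomial j k w)
      (fun w => by rw [ofStrip, hfg₁]; rfl) (fun w => by rw [ofStrip, hfg₂]; rfl),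
    integral_monomial hμ j k hg₁.continuousOn hg₂.continuousOn (fun _ _ => rfl) (fun _ _ => rfl)]

/-- The isomorphism `L_{j,k}`. -/
noncomputable def stripEquiv {μ : ℝ} (hμ : 0 < μ) (j k : ℤ) :
    isotypic (unwoundDomain μ) j k ≃ₗ[ℂ] weightedBergman μ j k where
  toFun G := ⟨toStrip hμ j k G.1, toStrip_mem hμ G.2⟩
  invFun f := ⟨ofStrip μ j k f.1, ofStrip_mem hμ f.2⟩
  map_add' F G := by
    ext ζ
    simp [toStrip, add_mul]
  map_smul' c F := by
    ext ζ
    simp [toStrip, mul_assoc]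
  left_inv G := Subtype.ext (ofStrip_toStrip hμ G.2)
  right_inv f := Subtype.ext (toStrip_ofStrip hμ j k f.1)

theorem inv_monomial (j k : ℤ) (w : ℂ × ℂ × ℂ) :
    (monomial j k w)⁻¹ = w.2.1 ^ (-j) * w.2.2 ^ (-k) := by
  rw [monomial, mul_inv, zpow_neg, zpow_neg]

/-- With m the monomial, the section of the proposed kernel at w' is conj(m(w')) times the image of
K(·, w₁') under the inverse isometry. Pairing F with it gives m(w') times the value at w₁' of the
strip function of F, which is F(w'). -/
theorem isReproducingKernel_isotypic {μ : ℝ} (hμ : 0 < μ) {j k : ℤ}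
    {K : strip (halfWidth μ) → strip (halfWidth μ) → ℂ}
    (hK : IsReproducingKernel (strip (halfWidth μ)) (weightedVolume μ j k)
      (weightedBergman μ j k) K) :
    IsReproducingKernel (unwoundDomain μ) volume (isotypic (unwoundDomain μ) j k)
      (fun w w' => K (proj μ w) (proj μ w') * (w.1.2.1 * conj w'.1.2.1) ^ j *
        (w.1.2.2 * conj w'.1.2.2) ^ k) := by
  intro w'
  obtain ⟨hK1, hK2⟩ := hK (proj μ w')
  have e : (fun w : unwoundDomain μ => K (proj μ w) (proj μ w') *
      (w.1.2.1 * conj w'.1.2.1) ^ j * (w.1.2.2 * conj w'.1.2.2) ^ k) =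
      conj (monomial j k w') • ofStrip μ j k (fun ζ => K ζ (proj μ w')) := by
    ext w
    simp only [Pi.smul_apply, smul_eq_mul, ofStrip, monomial, mul_zpow, map_mul, map_zpow₀]
    ring
  rw [e]
  refine ⟨Submodule.smul_mem _ _ (ofStrip_mem hμ hK1), fun F hF => ?_⟩
  have h1 : bergmanInner (unwoundDomain μ) volume F
      (conj (monomial j k w') • ofStrip μ j k (fun ζ => K ζ (proj μ w'))) =
      monomial j k w' * bergmanInner (unwoundDomain μ) volume F
        (ofStrip μ j k (fun ζ => K ζ (proj μ w'))) := by
    rw [bergmanInner, bergmanInner, ← integral_const_mul]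
    refine integral_congr_ae (Eventually.of_forall fun w => ?_)
    simp only [Pi.smul_apply, smul_eq_mul, map_mul, Complex.conj_conj]
    ring
  rw [h1]
  nth_rw 2 [← ofStrip_toStrip hμ hF]
  rw [bergmanInner_ofStrip hμ (toStrip_mem hμ hF) hK1, ← hK2 _ (toStrip_mem hμ hF),
    toStrip_proj hμ hF, mul_comm, inv_mul_cancel_right₀ (monomial_ne_zero j k w'.2)]

theorem isotypic_isometry {μ : ℝ} (hμ : 0 < μ) (j k : ℤ) :
    (∃ L : isotypic (unwoundDomain μ) j k ≃ₗ[ℂ] weightedBergman μ j k,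
      (∀ (G : isotypic (unwoundDomain μ) j k) (w : unwoundDomain μ),
        (L G).1 (proj μ w) = G.1 w * w.1.2.1 ^ (-j) * w.1.2.2 ^ (-k)) ∧
      (∀ F G : isotypic (unwoundDomain μ) j k,
        bergmanInner (strip (halfWidth μ)) (weightedVolume μ j k) (L F).1 (L G).1 =
          bergmanInner (unwoundDomain μ) volume F.1 G.1)) := by
  refine ⟨stripEquiv hμ j k, fun G w => ?_, fun F G => ?_⟩
  · rw [mul_assoc, ← inv_monomial]
    exact toStrip_proj hμ G.2 w
  · rw [← bergmanInner_ofStrip hμ (stripEquiv hμ j k F).2 (stripEquiv hμ j k G).2]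
    exact congrArg₂ _ (ofStrip_toStrip hμ F.2) (ofStrip_toStrip hμ G.2)

theorem isReproducingKernel_weightedBergman {μ : ℝ} (hμ : 0 < μ) (j k : ℤ) :
    IsReproducingKernel (strip (halfWidth μ)) (weightedVolume μ j k) (weightedBergman μ j k)
      (fun ζ ζ' => stripKernel (profile μ j k) (ζ.1 - conj ζ'.1)) :=
  (isStripWeight_profile hμ j k).isReproducingKernel

theorem abs_im_sub_conj_lt {β : ℝ} (ζ ζ' : strip β) : |(ζ.1 - conj ζ'.1).im| < 2 * β := by
  have h1 := abs_lt.2 ζ.2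
  have h2 := abs_lt.2 ζ'.2
  rw [Complex.sub_im, Complex.conj_im, sub_neg_eq_add]
  linarith [abs_add_le ζ.1.im ζ'.1.im]

theorem integrable_kernelIntegrand {μ : ℝ} (hμ : 0 < μ) {τ : ℂ} (hτ : |τ.im| < 2 * halfWidth μ) :
    Integrable (kernelIntegrand μ τ) :=
  ((isStripWeight_profile hμ (-1) (-1)).integrable_kernel hτ).congr (kernelIntegrand_ae_eq hμ τ)

theorem stripKernel_eq_integral {μ : ℝ} (hμ : 0 < μ) (τ : ℂ) :
    stripKernel (profile μ (-1) (-1)) τ = ∫ ξ : ℝ, kernelIntegrand μ τ ξ :=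
  integral_congr_ae (kernelIntegrand_ae_eq hμ τ)

end UnwoundWorm

/-! ### The meromorphic symbol and its size at infinity -/

namespace UnwoundWorm
open MeasureTheory Filter Topology Set

/-- The entire function `sinh z / z`. -/
noncomputable def shc : ℂ → ℂ := dslope Complex.sinh 0

theorem mul_shc (z : ℂ) : z * shc z = Complex.sinh z := by
  simpa [shc] using sub_smul_dslope Complex.sinh 0 z

theorem shc_of_ne {z : ℂ} (hz : z ≠ 0) : shc z = Complex.sinh z / z := by
  rw [← mul_shc, mul_div_cancel_left₀ _ hz]

theorem differentiable_shc : Differentiable ℂ shc := by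
  rw [← differentiableOn_univ]
  exact (Complex.differentiableOn_dslope univ_mem).2 Complex.differentiable_sinh.differentiableOn

theorem shc_zero : shc 0 = 1 := by
  rw [shc, dslope_same, (Complex.hasDerivAt_sinh 0).deriv, Complex.cosh_zero]

theorem shc_neg (z : ℂ) : shc (-z) = shc z := by
  by_cases hz : z = 0
  · simp [hz]
  · rw [shc_of_ne hz, shc_of_ne (neg_ne_zero.2 hz), Complex.sinh_neg, neg_div_neg_eq]

/-- `shc` is even. For this reason the factor coming from sinh(2μz) contributes nothing to the
derivative in the residue at iν. -/
theorem hasDerivAt_shc_zero : HasDerivAt shc 0 0 := by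
  have h := (differentiable_shc 0).hasDerivAt
  have h1 : HasDerivAt (fun z => shc (-z)) (-deriv shc 0) 0 := by
    have h2 : HasDerivAt shc (deriv shc 0) (-0) := by simpa using h
    have := h2.comp (0 : ℂ) (hasDerivAt_neg (0 : ℂ))
    simpa [Function.comp_def] using this
  simp only [shc_neg] at h1
  have h3 := h.unique h1
  have h4 : deriv shc 0 = 0 := by
    linear_combination (1 / 2 : ℂ) * h3
  rwa [h4] at h

theorem sinh_eq_zero {z : ℂ} (h : Complex.sinh z = 0) : z.re = 0 ∧ Real.sin z.im = 0 := by
  have h1 : Complex.sinh z = (Real.sinh z.re * Real.cos z.im : ℝ) +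
      (Real.cosh z.re * Real.sin z.im : ℝ) * Complex.I := by
    conv_lhs => rw [← Complex.re_add_im z]
    rw [Complex.sinh_add, Complex.sinh_mul_I, Complex.cosh_mul_I]
    push_cast
    ring
  rw [h1] at h
  have hre := congrArg Complex.re h
  have him := congrArg Complex.im h
  simp only [Complex.add_re, Complex.ofReal_re, Complex.mul_re, Complex.I_re, mul_zero,
    Complex.ofReal_im, Complex.I_im, mul_one, sub_self, add_zero, Complex.zero_re] at hre
  simp only [Complex.add_im, Complex.ofReal_im, Complex.mul_im, Complex.ofReal_re, Complex.I_im,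
    mul_one, Complex.I_re, mul_zero, add_zero, zero_add, Complex.zero_im] at him
  have hs : Real.sin z.im = 0 := (mul_eq_zero.1 him).resolve_left (Real.cosh_pos _).ne'
  have hc : Real.cos z.im ≠ 0 := fun hc => by
    have := Real.sin_sq_add_cos_sq z.im
    rw [hs, hc] at this; norm_num at this
  exact ⟨Real.sinh_eq_zero.1 ((mul_eq_zero.1 hre).resolve_right hc), hs⟩

theorem shc_ne_zero_of_sin_ne {z : ℂ} (h : z.re ≠ 0 ∨ Real.sin z.im ≠ 0) : shc z ≠ 0 := by
  intro h0
  have h1 := sinh_eq_zero (by rw [← mul_shc, h0, mul_zero])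
  tauto

theorem shc_ne_zero_of_abs_im_lt {z : ℂ} (h : |z.im| < Real.pi) : shc z ≠ 0 := by
  intro h0
  have h1 := sinh_eq_zero (by rw [← mul_shc, h0, mul_zero])
  rw [abs_lt] at h
  have h2 := (Real.sin_eq_zero_iff_of_lt_of_lt h.1 h.2).1 h1.2
  have h3 : z = 0 := Complex.ext h1.1 h2
  rw [h3, shc_zero] at h0
  exact one_ne_zero h0

/-- Antiperiodicity of sinh under πi moves the zero of sinh(cz) from 0 to p, so the factor z - p is
split off with a quotient that is regular at p. -/
theorem mul_shc_eq_neg {c p : ℂ} (hp : c * p = Real.pi * Complex.I) (z : ℂ) :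
    c * z * shc (c * z) = -(c * (z - p) * shc (c * (z - p))) := by
  have e : c * z = c * (z - p) + Real.pi * Complex.I := by rw [← hp]; ring
  rw [mul_shc, mul_shc, e, Complex.sinh_add, Complex.sinh_mul_I, Complex.cosh_mul_I]
  simp

theorem mul_shc_eq {c p : ℂ} (hp : c * p = 2 * (Real.pi * Complex.I)) (z : ℂ) :
    c * z * shc (c * z) = c * (z - p) * shc (c * (z - p)) := by
  have h1 := mul_shc_eq_neg (c := c) (p := p / 2) (by linear_combination hp / 2) z
  have h2 := mul_shc_eq_neg (c := c) (p := p / 2) (by linear_combination hp / 2) (z - p / 2)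
  have e : z - p / 2 - p / 2 = z - p := by ring
  rw [e] at h2
  rw [h1, h2, neg_neg]

/-- The meromorphic function `z³ / (2π³ sinh²(2μz) sinh(πz))`. -/
noncomputable def symbol (μ : ℝ) (z : ℂ) : ℂ :=
  (8 * Real.pi ^ 4 * μ ^ 2 * shc (2 * μ * z) ^ 2 * shc (Real.pi * z))⁻¹

theorem symbol_neg (μ : ℝ) (z : ℂ) : symbol μ (-z) = symbol μ z := by
  simp only [symbol, mul_neg, shc_neg]

/-- The triple zero of the denominator at 0 cancels z³, with 2π³ · (2μ)² · π = 8π⁴μ²; `symbol` is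
the holomorphic extension through 0. -/
theorem symbol_of_ne {μ : ℝ} (hμ : μ ≠ 0) {z : ℂ} (hz : z ≠ 0) : symbol μ z =
    z ^ 3 / (2 * Real.pi ^ 3 * Complex.sinh (2 * μ * z) ^ 2 * Complex.sinh (Real.pi * z)) := by
  have h1 : (μ : ℂ) ≠ 0 := by exact_mod_cast hμ
  have h2 : (Real.pi : ℂ) ≠ 0 := by exact_mod_cast Real.pi_ne_zero
  rw [symbol, ← mul_shc, ← mul_shc]
  have e : (2 * (Real.pi : ℂ) ^ 3 * (2 * μ * z * shc (2 * μ * z)) ^ 2 *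
      (Real.pi * z * shc (Real.pi * z))) =
      z ^ 3 * (8 * Real.pi ^ 4 * μ ^ 2 * shc (2 * μ * z) ^ 2 * shc (Real.pi * z)) := by ring
  rw [e, inv_eq_one_div]
  conv_lhs => rw [← mul_div_mul_left _ _ (pow_ne_zero 3 hz), mul_one]

theorem differentiableAt_symbol {μ : ℝ} (hμ : μ ≠ 0) {z : ℂ} (h1 : shc (2 * μ * z) ≠ 0)
    (h2 : shc (Real.pi * z) ≠ 0) : DifferentiableAt ℂ (symbol μ) z := by
  have h3 : (μ : ℂ) ≠ 0 := by exact_mod_cast hμ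
  have h4 : (Real.pi : ℂ) ≠ 0 := by exact_mod_cast Real.pi_ne_zero
  unfold symbol
  have d1 : DifferentiableAt ℂ (fun z : ℂ => shc (2 * μ * z)) z :=
    differentiable_shc.differentiableAt.comp z (by fun_prop)
  have d2 : DifferentiableAt ℂ (fun z : ℂ => shc (Real.pi * z)) z :=
    differentiable_shc.differentiableAt.comp z (by fun_prop)
  refine DifferentiableAt.inv (((d1.pow 2).const_mul _).mul d2) ?_
  exact mul_ne_zero (mul_ne_zero (by simp [h3, h4]) (pow_ne_zero _ h1)) h2

theorem kernelIntegrand_eq_symbol {μ : ℝ} (hμ : μ ≠ 0) (τ : ℂ) {ξ : ℝ} (hξ : ξ ≠ 0) :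
    kernelIntegrand μ τ ξ = symbol μ ξ * Complex.exp (Complex.I * τ * ξ) := by
  rw [symbol_of_ne hμ (by exact_mod_cast hξ), kernelIntegrand]
  push_cast
  ring

/-- Since 4μ + π = 2β, the leading term of each sinh gives (4/π³) z³ e^{-2βz}. The relative
corrections are powers of u = e^{-4μz} and v = e^{-2πz}, both at most e^{-Re z} ≤ 1/2, and so gain
one more factor e^{-Re z}. -/
theorem norm_symbol_sub_le {μ : ℝ} (hμ : Real.pi / 2 < μ) {z : ℂ} (hz : 1 ≤ z.re) :
    ‖symbol μ z - 4 / Real.pi ^ 3 * z ^ 3 * Complex.exp (-(2 * halfWidth μ * z))‖ ≤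
      224 * ‖z‖ ^ 3 * Real.exp (-(2 * halfWidth μ + 1) * z.re) := by
  have hpi := Real.pi_gt_three
  have hμ0 : μ ≠ 0 := by linarith
  have hz0 : z ≠ 0 := by rintro rfl; norm_num at hz
  set u := Complex.exp (-(4 * μ * z)) with hu
  set v := Complex.exp (-(2 * Real.pi * z)) with hv
  have hq : Real.exp (-z.re) ≤ 1 / 2 := by
    rw [Real.exp_neg, inv_eq_one_div]
    refine one_div_le_one_div_of_le two_pos ?_
    linarith [Real.add_one_le_exp z.re]
  have hun : ‖u‖ ≤ Real.exp (-z.re) := by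
    rw [hu, Complex.norm_exp]
    refine Real.exp_le_exp.2 ?_
    have : (-(4 * (μ : ℂ) * z)).re = -(4 * μ * z.re) := by simp
    rw [this]; nlinarith
  have hvn : ‖v‖ ≤ Real.exp (-z.re) := by
    rw [hv, Complex.norm_exp]
    refine Real.exp_le_exp.2 ?_
    have : (-(2 * (Real.pi : ℂ) * z)).re = -(2 * Real.pi * z.re) := by simp
    rw [this]; nlinarith
  have h1u : 1 / 2 ≤ ‖1 - u‖ := by
    have := norm_sub_norm_le (1 : ℂ) u
    rw [norm_one] at this; linarith
  have h1v : 1 / 2 ≤ ‖1 - v‖ := by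
    have := norm_sub_norm_le (1 : ℂ) v
    rw [norm_one] at this; linarith
  have hu0 : 1 - u ≠ 0 := norm_pos_iff.1 (by linarith)
  have hv0 : 1 - v ≠ 0 := norm_pos_iff.1 (by linarith)
  have hpc : (Real.pi : ℂ) ≠ 0 := by exact_mod_cast Real.pi_ne_zero
  have e1 : Complex.sinh (2 * μ * z) = Complex.exp (2 * μ * z) * (1 - u) / 2 := by
    rw [Complex.sinh, hu, mul_sub, mul_one, ← Complex.exp_add]; ring_nf
  have e2 : Complex.sinh (Real.pi * z) = Complex.exp (Real.pi * z) * (1 - v) / 2 := by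
    rw [Complex.sinh, hv, mul_sub, mul_one, ← Complex.exp_add]; ring_nf
  have e3 : Complex.exp (2 * μ * z) ^ 2 * Complex.exp (Real.pi * z) *
      Complex.exp (-(2 * halfWidth μ * z)) = 1 := by
    rw [← Complex.exp_nat_mul, ← Complex.exp_add, ← Complex.exp_add, halfWidth]
    push_cast
    rw [← Complex.exp_zero]
    ring_nf
  have e4 : symbol μ z - 4 / Real.pi ^ 3 * z ^ 3 * Complex.exp (-(2 * halfWidth μ * z)) =
      4 / Real.pi ^ 3 * z ^ 3 * Complex.exp (-(2 * halfWidth μ * z)) *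
        ((v + 2 * u - u ^ 2 - 2 * u * v + u ^ 2 * v) / ((1 - u) ^ 2 * (1 - v))) := by
    rw [symbol_of_ne hμ0 hz0, e1, e2]
    have hA := Complex.exp_ne_zero (2 * μ * z)
    have hB := Complex.exp_ne_zero (Real.pi * z)
    have e5 : Complex.exp (-(2 * halfWidth μ * z)) =
        1 / (Complex.exp (2 * μ * z) ^ 2 * Complex.exp (Real.pi * z)) := by
      rw [eq_div_iff (by simp [hA, hB]), mul_comm]; exact e3
    rw [e5]
    field_simp
    ring
  rw [e4, norm_mul, norm_mul, norm_mul, norm_div, norm_div, norm_pow, norm_pow, norm_mul, norm_pow,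
    Complex.norm_real, Real.norm_of_nonneg Real.pi_pos.le, Complex.norm_exp]
  -- The constant 224 is 4 · 7 · 8: prefactor at most 4, numerator at most 7e^{-Re z}, denominator
  -- at least 1/8.
  have hnum : ‖v + 2 * u - u ^ 2 - 2 * u * v + u ^ 2 * v‖ ≤ 7 * Real.exp (-z.re) := by
    have hu1 : ‖u‖ ≤ 1 := by linarith
    have hv1 : ‖v‖ ≤ 1 := by linarith
    have a1 := norm_nonneg u
    have a2 := norm_nonneg v
    calc ‖v + 2 * u - u ^ 2 - 2 * u * v + u ^ 2 * v‖
        ≤ ‖v‖ + ‖2 * u‖ + ‖u ^ 2‖ + ‖2 * u * v‖ + ‖u ^ 2 * v‖ := by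
          refine (norm_add_le _ _).trans (add_le_add_left ?_ _)
          refine (norm_sub_le _ _).trans (add_le_add_left ?_ _)
          refine (norm_sub_le _ _).trans (add_le_add_left ?_ _)
          exact norm_add_le _ _
      _ = ‖v‖ + 2 * ‖u‖ + ‖u‖ ^ 2 + 2 * ‖u‖ * ‖v‖ + ‖u‖ ^ 2 * ‖v‖ := by simp
      _ ≤ 7 * Real.exp (-z.re) := by nlinarith [mul_nonneg a1 a2, mul_nonneg (mul_nonneg a1 a1) a2]
  have hden : 1 / 8 ≤ ‖1 - u‖ ^ 2 * ‖1 - v‖ := by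
    calc (1 / 8 : ℝ) = (1 / 2) ^ 2 * (1 / 2) := by norm_num
      _ ≤ _ := by gcongr
  have hfrac : ‖v + 2 * u - u ^ 2 - 2 * u * v + u ^ 2 * v‖ / (‖1 - u‖ ^ 2 * ‖1 - v‖) ≤
      56 * Real.exp (-z.re) := by
    rw [div_le_iff₀ (by linarith)]
    nlinarith [Real.exp_pos (-z.re)]
  have h4 : ‖(4 : ℂ)‖ / Real.pi ^ 3 ≤ 4 := by
    rw [Complex.norm_ofNat]
    refine div_le_self (by norm_num) (one_le_pow₀ (by linarith))
  have hre : (-(2 * (halfWidth μ : ℂ) * z)).re = -(2 * halfWidth μ) * z.re := by simp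
  rw [hre]
  calc ‖(4 : ℂ)‖ / Real.pi ^ 3 * ‖z‖ ^ 3 * Real.exp (-(2 * halfWidth μ) * z.re) *
        (‖v + 2 * u - u ^ 2 - 2 * u * v + u ^ 2 * v‖ / (‖1 - u‖ ^ 2 * ‖1 - v‖))
      ≤ 4 * ‖z‖ ^ 3 * Real.exp (-(2 * halfWidth μ) * z.re) * (56 * Real.exp (-z.re)) := by gcongr
    _ = 224 * ‖z‖ ^ 3 * Real.exp (-(2 * halfWidth μ + 1) * z.re) := by
      have : Real.exp (-(2 * halfWidth μ + 1) * z.re) =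
          Real.exp (-(2 * halfWidth μ) * z.re) * Real.exp (-z.re) := by
        rw [← Real.exp_add]; ring_nf
      rw [this]; ring

theorem norm_le_two_mul {z : ℂ} (h2 : |z.im| ≤ 2) : ‖z‖ ≤ 2 * (1 + |z.re|) := by
  have := Complex.norm_le_abs_re_add_abs_im z
  linarith [abs_nonneg z.re]

/-- On the right, error and leading term add up to 224 + 4 = 228 times ‖z‖³, and ‖z‖ ≤ 2(1 + |Re z|)
gives 228 · 8 = 1824. Evenness of the symbol covers Re z < 0. -/
theorem norm_symbol_le {μ : ℝ} (hμ : Real.pi / 2 < μ) {z : ℂ} (hz : 1 ≤ |z.re|)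
    (h2 : |z.im| ≤ 2) :
    ‖symbol μ z‖ ≤ 1824 * (1 + |z.re|) ^ 3 * Real.exp (-(2 * halfWidth μ) * |z.re|) := by
  have key : ∀ z : ℂ, 1 ≤ z.re → |z.im| ≤ 2 →
      ‖symbol μ z‖ ≤ 1824 * (1 + |z.re|) ^ 3 * Real.exp (-(2 * halfWidth μ) * |z.re|) := by
    intro z hz h2
    have h1 := norm_symbol_sub_le hμ hz
    have hpi := Real.pi_gt_three
    have hn := norm_le_two_mul h2
    have hn3 : ‖z‖ ^ 3 ≤ 8 * (1 + |z.re|) ^ 3 := by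
      calc ‖z‖ ^ 3 ≤ (2 * (1 + |z.re|)) ^ 3 := by gcongr
        _ = _ := by ring
    have h3 : ‖4 / (Real.pi : ℂ) ^ 3 * z ^ 3 * Complex.exp (-(2 * halfWidth μ * z))‖ ≤
        4 * ‖z‖ ^ 3 * Real.exp (-(2 * halfWidth μ) * z.re) := by
      have hre : (-(2 * (halfWidth μ : ℂ) * z)).re = -(2 * halfWidth μ) * z.re := by simp
      rw [norm_mul, norm_mul, norm_div, norm_pow, norm_pow, Complex.norm_real,
        Real.norm_of_nonneg Real.pi_pos.le, Complex.norm_exp, hre, Complex.norm_ofNat]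
      gcongr
      exact div_le_self (by norm_num) (one_le_pow₀ (by linarith))
    have h4 : Real.exp (-(2 * halfWidth μ + 1) * z.re) ≤ Real.exp (-(2 * halfWidth μ) * z.re) :=
      Real.exp_le_exp.2 (by nlinarith)
    have h5 := norm_sub_norm_le (symbol μ z)
      (4 / (Real.pi : ℂ) ^ 3 * z ^ 3 * Complex.exp (-(2 * halfWidth μ * z)))
    have habs : |z.re| = z.re := abs_of_pos (by linarith)
    calc ‖symbol μ z‖ ≤ 224 * ‖z‖ ^ 3 * Real.exp (-(2 * halfWidth μ + 1) * z.re) +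
          4 * ‖z‖ ^ 3 * Real.exp (-(2 * halfWidth μ) * z.re) := by linarith
      _ ≤ 224 * ‖z‖ ^ 3 * Real.exp (-(2 * halfWidth μ) * z.re) +
          4 * ‖z‖ ^ 3 * Real.exp (-(2 * halfWidth μ) * z.re) := by gcongr
      _ = 228 * ‖z‖ ^ 3 * Real.exp (-(2 * halfWidth μ) * z.re) := by ring
      _ ≤ 228 * (8 * (1 + |z.re|) ^ 3) * Real.exp (-(2 * halfWidth μ) * z.re) := by gcongr
      _ = _ := by rw [habs]; ring
  rcases le_total 0 z.re with h | h
  · exact key z (by rwa [abs_of_nonneg h] at hz) h2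
  · have := key (-z) (by rw [abs_of_nonpos h] at hz; simpa using hz) (by simpa using h2)
    simpa [symbol_neg] using this

/-- Boundedness, relative to `(1 + |x|)³ e^{-a|x|}`, from boundedness off a compact set. -/
theorem exists_norm_le_of_continuousOn {E : ℝ → ℂ} {s : Set ℝ} (hs : IsClosed s)
    (hE : ContinuousOn E s) {a C : ℝ} (ha : 0 ≤ a)
    (hC : ∀ x ∈ s, 1 ≤ |x| → ‖E x‖ ≤ C * (1 + |x|) ^ 3 * Real.exp (-a * |x|)) :
    ∃ C', 0 ≤ C' ∧ ∀ x ∈ s, ‖E x‖ ≤ C' * (1 + |x|) ^ 3 * Real.exp (-a * |x|) := by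
  obtain ⟨M, hM⟩ := (isCompact_Icc.inter_right hs : IsCompact (Icc (-1 : ℝ) 1 ∩ s)).exists_bound_of_continuousOn
    (hE.mono inter_subset_right)
  refine ⟨max C (max 0 M * Real.exp a), le_max_of_le_right (by positivity), fun x hx => ?_⟩
  rcases le_total 1 |x| with h | h
  · refine (hC x hx h).trans ?_
    gcongr
    exact le_max_left _ _
  · have h1 := (hM x ⟨abs_le.1 h, hx⟩).trans (le_max_right 0 M)
    calc ‖E x‖ ≤ max 0 M := h1
      _ = max 0 M * Real.exp a * 1 * Real.exp (-a) := by
        rw [mul_one, mul_assoc, ← Real.exp_add]; simp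
      _ ≤ max C (max 0 M * Real.exp a) * (1 + |x|) ^ 3 * Real.exp (-a * |x|) := by
        have h3 : (1 : ℝ) ≤ (1 + |x|) ^ 3 := one_le_pow₀ (by linarith [abs_nonneg x])
        have h4 : Real.exp (-a) ≤ Real.exp (-a * |x|) := Real.exp_le_exp.2 (by nlinarith)
        have h5 := le_max_right C (max 0 M * Real.exp a)
        gcongr

theorem one_add_pow_three_le {ε : ℝ} (hε : 0 < ε) : ∃ K, 0 ≤ K ∧ ∀ x : ℝ, 0 ≤ x →
    (1 + x) ^ 3 ≤ K * Real.exp (ε * x) := by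
  set K := max 1 (3 / ε) with hK
  refine ⟨K ^ 3, by positivity, fun x hx => ?_⟩
  have h1 : 1 + x ≤ K * Real.exp (ε / 3 * x) := by
    have h2 := Real.add_one_le_exp (ε / 3 * x)
    have h3 : x ≤ K * (ε / 3 * x) := by
      have h4 : 1 ≤ K * (ε / 3) := by
        calc 1 = 3 / ε * (ε / 3) := by field_simp
          _ ≤ _ := by gcongr; exact le_max_right _ _
      nlinarith
    calc 1 + x ≤ K * 1 + K * (ε / 3 * x) := add_le_add (by simp [hK]) h3
      _ = K * (ε / 3 * x + 1) := by ring
      _ ≤ _ := by gcongr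
  calc (1 + x) ^ 3 ≤ (K * Real.exp (ε / 3 * x)) ^ 3 := by gcongr
    _ = K ^ 3 * Real.exp (ε * x) := by
      rw [mul_pow, ← Real.exp_nat_mul]; push_cast; ring_nf

theorem integrable_one_add_pow_mul_exp {ε : ℝ} (hε : 0 < ε) :
    Integrable fun x : ℝ => (1 + |x|) ^ 3 * Real.exp (-ε * |x|) := by
  obtain ⟨K, hK, hb⟩ := one_add_pow_three_le (half_pos hε)
  refine ((integrable_exp_neg_mul_abs (half_pos hε)).const_mul K).mono'
    (Continuous.aestronglyMeasurable (by fun_prop)) (Eventually.of_forall fun x => ?_)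
  rw [Real.norm_of_nonneg (by positivity)]
  calc (1 + |x|) ^ 3 * Real.exp (-ε * |x|)
      ≤ K * Real.exp (ε / 2 * |x|) * Real.exp (-ε * |x|) := by
        gcongr; exact hb _ (abs_nonneg x)
    _ = K * Real.exp (-(ε / 2) * |x|) := by rw [mul_assoc, ← Real.exp_add]; ring_nf

theorem tendsto_one_add_pow_mul_exp {ε : ℝ} (hε : 0 < ε) :
    Tendsto (fun x : ℝ => (1 + x) ^ 3 * Real.exp (-ε * x)) atTop (𝓝 0) := by
  obtain ⟨K, hK, hb⟩ := one_add_pow_three_le (half_pos hε)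
  have h1 : Tendsto (fun x : ℝ => K * Real.exp (-(ε / 2) * x)) atTop (𝓝 0) := by
    have : Tendsto (fun x : ℝ => Real.exp (-(ε / 2) * x)) atTop (𝓝 0) :=
      Real.tendsto_exp_atBot.comp (tendsto_id.const_mul_atTop_of_neg (by linarith))
    simpa using this.const_mul K
  refine squeeze_zero' ?_ ?_ h1
  · filter_upwards [eventually_ge_atTop 0] with x hx
    positivity
  · filter_upwards [eventually_ge_atTop 0] with x hx
    calc (1 + x) ^ 3 * Real.exp (-ε * x)
        ≤ K * Real.exp (ε / 2 * x) * Real.exp (-ε * x) := by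
          gcongr; exact hb _ hx
      _ = K * Real.exp (-(ε / 2) * x) := by rw [mul_assoc, ← Real.exp_add]; ring_nf

end UnwoundWorm

/-! ### Half-line integrals up to the edge of the strip, and regular factors at double poles -/

namespace UnwoundWorm
open MeasureTheory Filter Topology Set

theorem norm_add_const_le {c : ℂ} {x : ℝ} (hx : 0 ≤ x) : ‖(x : ℂ) + c‖ ≤ (1 + ‖c‖) * (1 + x) := by
  have h1 := norm_add_le (x : ℂ) c
  rw [Complex.norm_real, Real.norm_of_nonneg hx] at h1
  nlinarith [norm_nonneg c]

/-- The exact value matters: it is bounded in terms of 1/|s| and so stays controlled as Re s → 0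
with |Im s| bounded below, where an absolute estimate of the integral would blow up. -/
theorem integral_Ioi_cube_mul_exp (c : ℂ) {s : ℂ} (hs : 0 < s.re) :
    IntegrableOn (fun x : ℝ => ((x : ℂ) + c) ^ 3 * Complex.exp (-(s * x))) (Ioi 0) ∧
    ∫ x : ℝ in Ioi 0, ((x : ℂ) + c) ^ 3 * Complex.exp (-(s * x)) =
      c ^ 3 / s + 3 * c ^ 2 / s ^ 2 + 6 * c / s ^ 3 + 6 / s ^ 4 := by
  have hs0 : s ≠ 0 := by rintro rfl; simp at hs
  have hn : ∀ x : ℝ, ‖Complex.exp (-(s * x))‖ = Real.exp (-s.re * x) := fun x => by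
    rw [Complex.norm_exp]; simp
  set a := 1 + ‖c‖ with ha
  have ha1 : 1 ≤ a := by rw [ha]; linarith [norm_nonneg c]
  have hint : IntegrableOn (fun x : ℝ => ((x : ℂ) + c) ^ 3 * Complex.exp (-(s * x))) (Ioi 0) := by
    refine Integrable.mono' ((integrable_one_add_pow_mul_exp hs).const_mul (a ^ 3)).integrableOn
      (Continuous.aestronglyMeasurable (by fun_prop)) ?_
    filter_upwards [ae_restrict_mem measurableSet_Ioi] with x hx
    have hx0 : 0 ≤ x := (mem_Ioi.1 hx).le
    rw [norm_mul, hn, norm_pow, abs_of_nonneg hx0]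
    calc ‖(x : ℂ) + c‖ ^ 3 * Real.exp (-s.re * x)
        ≤ (a * (1 + x)) ^ 3 * Real.exp (-s.re * x) := by gcongr; exact norm_add_const_le hx0
      _ = _ := by ring
  refine ⟨hint, ?_⟩
  set P : ℝ → ℂ := fun x => -((((x : ℂ) + c) ^ 3 / s + 3 * ((x : ℂ) + c) ^ 2 / s ^ 2 +
    6 * ((x : ℂ) + c) / s ^ 3 + 6 / s ^ 4) * Complex.exp (-(s * x))) with hP
  have hd : ∀ x ∈ Ioi (0 : ℝ), HasDerivAt P (((x : ℂ) + c) ^ 3 * Complex.exp (-(s * x))) x := by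
    intro x _
    have h1 : HasDerivAt (fun x : ℝ => (x : ℂ) + c) 1 x :=
      (Complex.ofRealCLM.hasDerivAt (x := x)).add_const c
    have h2 : HasDerivAt (fun x : ℝ => Complex.exp (-(s * x)))
        (Complex.exp (-(s * x)) * -(s * 1)) x :=
      (((Complex.ofRealCLM.hasDerivAt (x := x)).const_mul s).neg).cexp
    have h3 := ((((h1.fun_pow 3).div_const s).add (((h1.fun_pow 2).const_mul 3).div_const (s ^ 2))).add
      ((h1.const_mul 6).div_const (s ^ 3))).add_const (6 / s ^ 4)
    refine ((h3.mul h2).neg).congr_deriv ?_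
    simp only [Pi.add_apply]
    field_simp
    push_cast
    ring
  have hlim : Tendsto P atTop (𝓝 0) := by
    have h0 := (tendsto_one_add_pow_mul_exp hs).const_mul
      (a ^ 3 * (1 / ‖s‖ + 3 / ‖s‖ ^ 2 + 6 / ‖s‖ ^ 3 + 6 / ‖s‖ ^ 4))
    rw [mul_zero] at h0
    refine squeeze_zero_norm' ?_ h0
    filter_upwards [eventually_ge_atTop 0] with x hx
    rw [hP, norm_neg, norm_mul, hn, ← mul_assoc]
    refine mul_le_mul_of_nonneg_right ?_ (Real.exp_pos _).le
    have hb := norm_add_const_le (c := c) hx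
    rw [← ha] at hb
    have hy : 1 ≤ a * (1 + x) := one_le_mul_of_one_le_of_one_le ha1 (by linarith)
    set y := a * (1 + x) with hydef
    have e1 : ‖((x : ℂ) + c) ^ 3 / s‖ ≤ y ^ 3 * (1 / ‖s‖) := by
      rw [norm_div, norm_pow, div_eq_mul_one_div]
      gcongr
    have e2 : ‖3 * ((x : ℂ) + c) ^ 2 / s ^ 2‖ ≤ y ^ 3 * (3 / ‖s‖ ^ 2) := by
      rw [norm_div, norm_mul, norm_pow, norm_pow, Complex.norm_ofNat, mul_comm, mul_div_assoc]
      gcongr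
      calc ‖(x : ℂ) + c‖ ^ 2 ≤ y ^ 2 := by gcongr
        _ ≤ y ^ 3 := pow_le_pow_right₀ hy (by norm_num)
    have e3 : ‖6 * ((x : ℂ) + c) / s ^ 3‖ ≤ y ^ 3 * (6 / ‖s‖ ^ 3) := by
      rw [norm_div, norm_mul, norm_pow, Complex.norm_ofNat, mul_comm, mul_div_assoc]
      gcongr
      calc ‖(x : ℂ) + c‖ ≤ y ^ 1 := by simpa using hb
        _ ≤ y ^ 3 := pow_le_pow_right₀ hy (by norm_num)
    have e4 : ‖6 / s ^ 4‖ ≤ y ^ 3 * (6 / ‖s‖ ^ 4) := by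
      rw [norm_div, norm_pow, Complex.norm_ofNat]
      exact le_mul_of_one_le_left (by positivity) (one_le_pow₀ hy)
    calc _ ≤ ‖((x : ℂ) + c) ^ 3 / s‖ + ‖3 * ((x : ℂ) + c) ^ 2 / s ^ 2‖ +
          ‖6 * ((x : ℂ) + c) / s ^ 3‖ + ‖6 / s ^ 4‖ := norm_add₄_le
      _ ≤ y ^ 3 * (1 / ‖s‖) + y ^ 3 * (3 / ‖s‖ ^ 2) + y ^ 3 * (6 / ‖s‖ ^ 3) +
          y ^ 3 * (6 / ‖s‖ ^ 4) := by gcongr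
      _ = _ := by rw [hydef]; ring
  have hcont : ContinuousWithinAt P (Ici 0) 0 := by
    refine Continuous.continuousWithinAt ?_
    fun_prop
  rw [integral_Ioi_of_hasDerivAt_of_tendsto hcont hd hint hlim]
  simp [hP]

/-- Uniformity holds up to |Re σ| = 2β. The leading part L of the symbol is integrated exactly and
gives a polynomial in 1/s with s = 2β - σ, where |s| ≥ |Im σ| ≥ δ. The rest E has an extra decay
e^{-x}, which survives multiplication by e^{σx}. -/
theorem exists_norm_halfLine_le {μ : ℝ} (hμ : Real.pi / 2 < μ) {h : ℝ} (hh : |h| ≤ 2)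
    (hc : Continuous fun x : ℝ => symbol μ (x + h * Complex.I)) {δ : ℝ} (hδ : 0 < δ) :
    ∃ C, ∀ σ : ℂ, |σ.re| < 2 * halfWidth μ → δ ≤ |σ.im| →
      ‖∫ x : ℝ in Ioi 0, symbol μ (x + h * Complex.I) * Complex.exp (σ * x)‖ ≤ C := by
  set β := halfWidth μ with hβ
  have hβ0 : 0 < β := by rw [hβ, halfWidth]; linarith [Real.pi_pos]
  set c : ℂ := h * Complex.I with hcdef
  set L : ℝ → ℂ := fun x => 4 / Real.pi ^ 3 * ((x : ℂ) + c) ^ 3 *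
    Complex.exp (-(2 * β * ((x : ℂ) + c))) with hL
  set E : ℝ → ℂ := fun x => symbol μ (x + c) - L x with hE
  have hEc : Continuous E := hc.sub (by fun_prop)
  -- The constant 1792 is 224 · 2³, from ‖x + c‖ ≤ 2(1 + x).
  obtain ⟨C, hC0, hC⟩ := exists_norm_le_of_continuousOn (E := E) (s := Ici 0) isClosed_Ici
    hEc.continuousOn (a := 2 * β + 1) (C := 1792) (by linarith) (by
      intro x hx hx1
      rw [abs_of_nonneg (mem_Ici.1 hx)] at hx1 ⊢
      have hre : ((x : ℂ) + c).re = x := by simp [hcdef]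
      have him : ((x : ℂ) + c).im = h := by simp [hcdef]
      have h1 := norm_symbol_sub_le hμ (z := (x : ℂ) + c) (by rwa [hre])
      have h2 := norm_le_two_mul (z := (x : ℂ) + c) (by rwa [him])
      rw [hre, abs_of_nonneg (mem_Ici.1 hx)] at h2
      rw [hre] at h1
      refine h1.trans ?_
      calc 224 * ‖(x : ℂ) + c‖ ^ 3 * Real.exp (-(2 * halfWidth μ + 1) * x)
          ≤ 224 * (2 * (1 + x)) ^ 3 * Real.exp (-(2 * halfWidth μ + 1) * x) := by gcongr
        _ = _ := by rw [hβ]; ring)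
  set D := 4 * (‖c‖ ^ 3 / δ + 3 * ‖c‖ ^ 2 / δ ^ 2 + 6 * ‖c‖ / δ ^ 3 + 6 / δ ^ 4) with hD
  refine ⟨(∫ x : ℝ, C * ((1 + |x|) ^ 3 * Real.exp (-1 * |x|))) + D, fun σ hσ hσδ => ?_⟩
  have hsre : 0 < ((2 * β : ℝ) - σ : ℂ).re := by
    rw [Complex.sub_re, Complex.ofReal_re]
    linarith [le_abs_self σ.re]
  obtain ⟨hLi, hLv⟩ := integral_Ioi_cube_mul_exp c hsre
  have hLe : ∀ x : ℝ, L x * Complex.exp (σ * x) = 4 / Real.pi ^ 3 * Complex.exp (-(2 * β * c)) *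
      (((x : ℂ) + c) ^ 3 * Complex.exp (-(((2 * β : ℝ) - σ : ℂ) * x))) := by
    intro x
    have : Complex.exp (-(2 * β * ((x : ℂ) + c))) * Complex.exp (σ * x) =
        Complex.exp (-(2 * β * c)) * Complex.exp (-(((2 * β : ℝ) - σ : ℂ) * x)) := by
      rw [← Complex.exp_add, ← Complex.exp_add]; push_cast; ring_nf
    simp only [hL]
    linear_combination (4 / Real.pi ^ 3 * ((x : ℂ) + c) ^ 3) * this
  have hEb : ∀ x ∈ Ioi (0 : ℝ), ‖E x * Complex.exp (σ * x)‖ ≤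
      C * ((1 + |x|) ^ 3 * Real.exp (-1 * |x|)) := by
    intro x hx
    have hx0 : 0 < x := hx
    have h1 := hC x hx0.le
    have h2 : ‖Complex.exp (σ * x)‖ ≤ Real.exp (2 * β * |x|) := by
      rw [Complex.norm_exp]
      refine Real.exp_le_exp.2 ?_
      simp only [Complex.mul_re, Complex.ofReal_re, Complex.ofReal_im, mul_zero, sub_zero]
      rw [abs_of_pos hx0]
      gcongr
      exact (le_abs_self _).trans hσ.le
    rw [norm_mul]
    calc ‖E x‖ * ‖Complex.exp (σ * x)‖
        ≤ C * (1 + |x|) ^ 3 * Real.exp (-(2 * β + 1) * |x|) * Real.exp (2 * β * |x|) := by gcongr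
      _ = C * ((1 + |x|) ^ 3 * Real.exp (-1 * |x|)) := by
        rw [mul_assoc, ← Real.exp_add]; ring_nf
  have hBi := (integrable_one_add_pow_mul_exp one_pos).const_mul C
  have hEi : IntegrableOn (fun x : ℝ => E x * Complex.exp (σ * x)) (Ioi 0) := by
    refine Integrable.mono' hBi.integrableOn
      (Continuous.aestronglyMeasurable (by fun_prop)) ?_
    filter_upwards [ae_restrict_mem measurableSet_Ioi] with x hx using hEb x hx
  have hLi' : IntegrableOn (fun x : ℝ => L x * Complex.exp (σ * x)) (Ioi 0) := by
    simp only [hLe]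
    exact hLi.const_mul _
  have hsplit : ∫ x : ℝ in Ioi 0, symbol μ (x + c) * Complex.exp (σ * x) =
      (∫ x : ℝ in Ioi 0, E x * Complex.exp (σ * x)) +
        ∫ x : ℝ in Ioi 0, L x * Complex.exp (σ * x) := by
    rw [← integral_add hEi hLi']
    refine integral_congr_ae (Eventually.of_forall fun x => ?_)
    simp only [hE]; ring
  rw [hsplit]
  refine (norm_add_le _ _).trans (add_le_add ?_ ?_)
  · calc ‖∫ x : ℝ in Ioi 0, E x * Complex.exp (σ * x)‖
        ≤ ∫ x : ℝ in Ioi 0, C * ((1 + |x|) ^ 3 * Real.exp (-1 * |x|)) := by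
          refine norm_integral_le_of_norm_le hBi.integrableOn ?_
          filter_upwards [ae_restrict_mem measurableSet_Ioi] with x hx using hEb x hx
      _ ≤ _ := setIntegral_le_integral hBi (Eventually.of_forall fun x => by positivity)
  · simp only [hLe]
    rw [integral_const_mul, hLv]
    set s : ℂ := (2 * β : ℝ) - σ with hs
    have hsδ : δ ≤ ‖s‖ := by
      refine hσδ.trans ?_
      have := Complex.abs_im_le_norm s
      rwa [hs, Complex.sub_im, Complex.ofReal_im, zero_sub, abs_neg] at this
    have hexp : ‖Complex.exp (-(2 * β * c))‖ = 1 := by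
      rw [Complex.norm_exp, hcdef]; simp
    have hpi3 : ‖(4 : ℂ) / (Real.pi : ℂ) ^ 3‖ ≤ 4 := by
      rw [norm_div, norm_pow, Complex.norm_real, Real.norm_of_nonneg Real.pi_pos.le,
        Complex.norm_ofNat]
      exact div_le_self (by norm_num) (one_le_pow₀ (by linarith [Real.pi_gt_three]))
    rw [norm_mul, norm_mul, hexp, mul_one, hD]
    refine mul_le_mul hpi3 ?_ (norm_nonneg _) (by norm_num)
    refine norm_add₄_le.trans ?_
    simp only [norm_div, norm_mul, norm_pow, Complex.norm_ofNat]
    gcongr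

section Poles
variable {μ : ℝ}

theorem nu_mul (hμ : μ ≠ 0) : 2 * (μ : ℂ) * (nu μ * Complex.I) = Real.pi * Complex.I := by
  have h : (μ : ℂ) ≠ 0 := by exact_mod_cast hμ
  rw [nu]; push_cast; field_simp

theorem two_mu_mul_nu (hμ : μ ≠ 0) : 2 * μ * nu μ = Real.pi := by
  rw [nu]; field_simp

/-- The regular factor `h` in `z³ / (2π³ sinh²(2μz) sinh(πz)) = h(z) / (z - p)²`, for the zeros `p`
of `sinh(2μz)`. -/
noncomputable def doubleFactor (μ : ℝ) (p z : ℂ) : ℂ :=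
  z ^ 2 * (8 * Real.pi ^ 4 * μ ^ 2 * shc (2 * μ * (z - p)) ^ 2 * shc (Real.pi * z))⁻¹

theorem differentiableAt_doubleFactor (hμ : μ ≠ 0) {p z : ℂ} (h1 : shc (2 * μ * (z - p)) ≠ 0)
    (h2 : shc (Real.pi * z) ≠ 0) : DifferentiableAt ℂ (doubleFactor μ p) z := by
  have h3 : (μ : ℂ) ≠ 0 := by exact_mod_cast hμ
  have h4 : (Real.pi : ℂ) ≠ 0 := by exact_mod_cast Real.pi_ne_zero
  unfold doubleFactor
  have d1 : DifferentiableAt ℂ (fun z : ℂ => shc (2 * μ * (z - p))) z :=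
    differentiable_shc.differentiableAt.comp z (by fun_prop)
  have d2 : DifferentiableAt ℂ (fun z : ℂ => shc (Real.pi * z)) z :=
    differentiable_shc.differentiableAt.comp z (by fun_prop)
  refine DifferentiableAt.mul (by fun_prop)
    (DifferentiableAt.inv (((d1.pow 2).const_mul _).mul d2) ?_)
  exact mul_ne_zero (mul_ne_zero (by simp [h3, h4]) (pow_ne_zero _ h1)) h2

/-- Only squares enter the hypothesis, so both zeros with sinh changing sign (iν) and zeros at a
full period (2iν) are covered. At z = p the convention 0⁻¹ = 0 makes both sides 0, and no condition
z ≠ p is needed. -/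
theorem symbol_eq_doubleFactor (hμ : μ ≠ 0) {p z : ℂ} (hz : z ≠ 0)
    (hsq : (2 * μ * z * shc (2 * μ * z)) ^ 2 = (2 * μ * (z - p) * shc (2 * μ * (z - p))) ^ 2) :
    symbol μ z = doubleFactor μ p z * ((z - p) ^ 2)⁻¹ := by
  have h3 : (μ : ℂ) ≠ 0 := by exact_mod_cast hμ
  have e : shc (2 * μ * z) ^ 2 = (z - p) ^ 2 * shc (2 * μ * (z - p)) ^ 2 / z ^ 2 := by
    rw [eq_div_iff (pow_ne_zero 2 hz)]
    have h5 : (4 * μ ^ 2 : ℂ) ≠ 0 := by simp [h3]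
    refine mul_left_cancel₀ h5 ?_
    linear_combination hsq
  rw [symbol, doubleFactor, e]
  simp only [mul_inv, div_eq_mul_inv, inv_inv]
  ring

end Poles

end UnwoundWorm

/-! ### The poles iν and iν' of the symbol -/

namespace UnwoundWorm
open MeasureTheory Filter Topology Set

section
variable {μ : ℝ}

theorem nu_pos (hμ : 0 < μ) : 0 < nu μ := by
  have := Real.pi_pos
  rw [nu]; positivity

theorem nu_lt_one (hμ : Real.pi / 2 < μ) : nu μ < 1 := by
  rw [nu, div_lt_one] <;> linarith [Real.pi_pos]

theorem nu_lt_nu' (hμ : Real.pi / 2 < μ) : nu μ < nu' μ :=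
  lt_min (by linarith [nu_pos (μ := μ) (by linarith [Real.pi_pos])]) (nu_lt_one hμ)

theorem nu'_le_one (μ : ℝ) : nu' μ ≤ 1 := min_le_right _ _

theorem shc_two_mul_ne_zero {z : ℂ} (h : |2 * μ * z.im| < Real.pi) : shc (2 * μ * z) ≠ 0 := by
  refine shc_ne_zero_of_abs_im_lt ?_
  simpa using h

theorem shc_pi_mul_ne_zero {z : ℂ} (h : |z.im| < 1) : shc (Real.pi * z) ≠ 0 := by
  refine shc_ne_zero_of_abs_im_lt ?_
  rw [Complex.im_ofReal_mul, abs_mul, abs_of_pos Real.pi_pos]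
  exact mul_lt_of_lt_one_right Real.pi_pos h

theorem abs_two_mul_lt (hμ : 0 < μ) {y : ℝ} (h1 : -nu μ < y) (h2 : y < nu μ) :
    |2 * μ * y| < Real.pi := by
  rw [← two_mu_mul_nu hμ.ne', abs_lt]
  constructor <;> nlinarith

theorem shc_two_mul_sub_ne_zero (hμ : 0 < μ) {q : ℝ} {z : ℂ} (h1 : q - nu μ < z.im)
    (h2 : z.im < q + nu μ) : shc (2 * μ * (z - q * Complex.I)) ≠ 0 := by
  refine shc_two_mul_ne_zero (abs_two_mul_lt hμ ?_ ?_) <;>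
  · simp; linarith

theorem differentiableAt_symbol_of_abs_im_lt (hμ : Real.pi / 2 < μ) {z : ℂ} (h : |z.im| < nu μ) :
    DifferentiableAt ℂ (symbol μ) z := by
  have hμ0 : 0 < μ := by linarith [Real.pi_pos]
  rw [abs_lt] at h
  exact differentiableAt_symbol hμ0.ne' (shc_two_mul_ne_zero (abs_two_mul_lt hμ0 h.1 h.2))
    (shc_pi_mul_ne_zero (abs_lt.2 ⟨by linarith [nu_lt_one hμ], by linarith [nu_lt_one hμ]⟩))

theorem ne_zero_of_im_pos {z : ℂ} (h : 0 < z.im) : z ≠ 0 := by rintro rfl; simp at h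

theorem symbol_eq_first_pole (hμ : 0 < μ) {z : ℂ} (hz : 0 < z.im) :
    symbol μ z = doubleFactor μ (nu μ * Complex.I) z * ((z - nu μ * Complex.I) ^ 2)⁻¹ := by
  refine symbol_eq_doubleFactor hμ.ne' (ne_zero_of_im_pos hz) ?_
  rw [mul_shc_eq_neg (nu_mul hμ.ne'), neg_sq]

/-- Above iν the next zeros are 2iν for sinh(2μz) and i for sinh(πz); the lower of the two heights
is ν'. -/
theorem differentiableAt_doubleFactor_first (hμ : 0 < μ) {z : ℂ}
    (h0 : 0 < z.im) (h1 : z.im < nu' μ) :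
    DifferentiableAt ℂ (doubleFactor μ (nu μ * Complex.I)) z := by
  refine differentiableAt_doubleFactor hμ.ne' (shc_two_mul_sub_ne_zero hμ ?_ ?_)
    (shc_pi_mul_ne_zero ?_)
  · linarith
  · linarith [min_le_left (2 * nu μ) 1, show nu' μ = min (2 * nu μ) 1 from rfl]
  · rw [abs_of_pos h0]; linarith [nu'_le_one μ]

/-- The next pole is the lower of i and 2iν. It is simple (from sinh(πz)) if 2ν > 1, that is μ < π;
double (from sinh²(2μz)) if μ > π; and triple if they coincide, μ = π. In each case the order is m +
1. -/
theorem exists_second_pole (hμ : Real.pi / 2 < μ) : ∃ hi : ℝ, nu' μ < hi ∧ ∃ H : ℂ → ℂ,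
    (∀ z : ℂ, nu μ < z.im → z.im < hi → DifferentiableAt ℂ H z) ∧
    ∀ z : ℂ, nu μ < z.im → symbol μ z =
      H z * ((z - nu' μ * Complex.I) ^ (remainderDegree μ + 1))⁻¹ := by
  have hpi := Real.pi_pos
  have hμ0 : 0 < μ := by linarith
  have hμc : (μ : ℂ) ≠ 0 := by exact_mod_cast hμ0.ne'
  have hpc : (Real.pi : ℂ) ≠ 0 := by exact_mod_cast hpi.ne'
  have hν0 := nu_pos hμ0
  have hν1 := nu_lt_one hμ
  have h2ν := two_mu_mul_nu hμ0.ne'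
  have hpole : ∀ z : ℂ, z ≠ 0 →
      shc (Real.pi * z) = -((z - Complex.I) * shc (Real.pi * (z - Complex.I))) / z := by
    intro z hz
    have := mul_shc_eq_neg (c := (Real.pi : ℂ)) (p := Complex.I) rfl z
    rw [eq_div_iff hz]
    refine mul_left_cancel₀ hpc ?_
    linear_combination this
  have hshc : ∀ z : ℂ, 0 < z.im → z.im < 2 → shc (Real.pi * (z - Complex.I)) ≠ 0 := by
    intro z h1 h2
    refine shc_pi_mul_ne_zero (abs_lt.2 ?_)
    simp only [Complex.sub_im, Complex.I_im]
    constructor <;> linarith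
  have dshc : ∀ (c q z : ℂ), DifferentiableAt ℂ (fun z : ℂ => shc (c * (z - q))) z :=
    fun c q z => differentiable_shc.differentiableAt.comp z (by fun_prop)
  rcases lt_trichotomy μ Real.pi with hlt | heq | hgt
  · have hν : 1 < 2 * nu μ := by nlinarith
    have hν' : nu' μ = 1 := min_eq_right hν.le
    have hm : remainderDegree μ = 0 := if_pos hlt
    -- For ν < Im z < 2ν the number 2μ Im z lies between π and 2π, so sinh(2μz) has no zero there
    -- and only the pole i needs to be split off.
    refine ⟨2 * nu μ, by rw [hν']; exact hν,
      fun z => -z * (8 * Real.pi ^ 4 * μ ^ 2 * shc (2 * μ * (z - 0)) ^ 2 *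
        shc (Real.pi * (z - Complex.I)))⁻¹, fun z h1 h2 => ?_, fun z h1 => ?_⟩
    · refine DifferentiableAt.mul (by fun_prop) (DifferentiableAt.inv
        ((((dshc _ _ z).pow 2).const_mul _).mul (dshc _ _ z)) ?_)
      refine mul_ne_zero (mul_ne_zero (by simp [hμc, hpc]) (pow_ne_zero _ ?_))
        (hshc z (by linarith) (by linarith))
      rw [sub_zero]
      refine shc_ne_zero_of_sin_ne (Or.inr ?_)
      have him : (2 * (μ : ℂ) * z).im = 2 * μ * z.im := by simp
      rw [him, ← neg_ne_zero, ← Real.sin_sub_pi]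
      exact (Real.sin_pos_of_pos_of_lt_pi (by nlinarith) (by nlinarith)).ne'
    · have hz := ne_zero_of_im_pos (hν0.trans h1)
      rw [symbol, hpole z hz, hν', hm]
      simp only [mul_inv, div_eq_mul_inv, inv_inv, neg_mul, mul_neg, inv_neg, sub_zero, zero_add,
        pow_one, Complex.ofReal_one, one_mul]
      ring
  · have hν : 2 * nu μ = 1 := by nlinarith
    have hν' : nu' μ = 1 := min_eq_right hν.ge
    have hm : remainderDegree μ = 2 := by
      rw [remainderDegree, if_neg heq.not_lt, if_pos heq]
    -- Here ν = 1/2, and 3/2 = 3ν is the height of the zero of sinh(2μz) after i.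
    refine ⟨3 / 2, by rw [hν']; norm_num,
      fun z => -z ^ 3 * (8 * Real.pi ^ 4 * μ ^ 2 * shc (2 * μ * (z - (1 : ℝ) * Complex.I)) ^ 2 *
        shc (Real.pi * (z - Complex.I)))⁻¹, fun z h1 h2 => ?_, fun z h1 => ?_⟩
    · refine DifferentiableAt.mul (by fun_prop) (DifferentiableAt.inv
        ((((dshc _ _ z).pow 2).const_mul _).mul (dshc _ _ z)) ?_)
      exact mul_ne_zero (mul_ne_zero (by simp [hμc, hpc]) (pow_ne_zero _
        (shc_two_mul_sub_ne_zero hμ0 (by linarith) (by linarith))))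
        (hshc z (by linarith) (by linarith))
    · have hz := ne_zero_of_im_pos (hν0.trans h1)
      rw [symbol_eq_doubleFactor hμ0.ne' (p := Complex.I) hz
        (by rw [mul_shc_eq (p := Complex.I) (by rw [heq]; ring)]), doubleFactor, hpole z hz, hν', hm]
      simp only [mul_inv, div_eq_mul_inv, inv_inv, neg_mul, mul_neg, inv_neg,
        Complex.ofReal_one, one_mul, ← inv_pow]
      ring
  · have hν : 2 * nu μ < 1 := by nlinarith
    have hν' : nu' μ = 2 * nu μ := min_eq_left hν.le
    have hm : remainderDegree μ = 1 := by
      rw [remainderDegree, if_neg hgt.le.not_gt, if_neg hgt.ne']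
    -- The next obstructions above 2iν are 3iν for sinh(2μz) and i for sinh(πz).
    refine ⟨min (3 * nu μ) 1, by rw [hν']; exact lt_min (by linarith) hν,
      doubleFactor μ ((2 * nu μ : ℝ) * Complex.I), fun z h1 h2 => ?_, fun z h1 => ?_⟩
    · refine differentiableAt_doubleFactor hμ0.ne' (shc_two_mul_sub_ne_zero hμ0 (by linarith) ?_)
        (shc_pi_mul_ne_zero ?_)
      · linarith [min_le_left (3 * nu μ) 1]
      · rw [abs_of_pos (by linarith)]; linarith [min_le_right (3 * nu μ) 1]
    · have hz := ne_zero_of_im_pos (hν0.trans h1)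
      rw [hν', hm]
      refine symbol_eq_doubleFactor hμ0.ne' hz ?_
      rw [mul_shc_eq]
      rw [← nu_mul hμ0.ne']; push_cast; ring

/-- Near p = iν the function is a constant times z³ e^{iτz} / (shc(2μ(z - p))² sinh(πz)). Its
logarithmic derivative at p is 3/p + iτ - π coth(πp), where coth(iνπ) = -i cot(νπ); the first and
last terms yield C'_ν and the middle one C_ν τ. -/
theorem deriv_doubleFactor_mul_exp (hμ : Real.pi / 2 < μ) (τ : ℂ) :
    deriv (fun z => doubleFactor μ (nu μ * Complex.I) z * Complex.exp (Complex.I * τ * z))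
      (nu μ * Complex.I) =
      Complex.exp (-(τ * nu μ)) * (coeffC (nu μ) * τ + coeffC' (nu μ)) := by
  have hpi := Real.pi_pos
  have hμ0 : 0 < μ := by linarith
  have hν0 := nu_pos hμ0
  set ν := nu μ with hν
  have hνc : (ν : ℂ) ≠ 0 := by exact_mod_cast hν0.ne'
  have hpc : (Real.pi : ℂ) ≠ 0 := by exact_mod_cast hpi.ne'
  have hμν : (μ : ℂ) = Real.pi / (2 * ν) := by
    rw [eq_div_iff (by simp [hνc])]
    have := two_mu_mul_nu hμ0.ne'
    rw [← hν] at this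
    have h2 : (2 * μ * ν : ℂ) = Real.pi := by exact_mod_cast this
    linear_combination h2
  have hs : Complex.sin (ν * Real.pi) ≠ 0 := by
    have : Real.sin (ν * Real.pi) ≠ 0 := by
      refine (Real.sin_pos_of_pos_of_lt_pi (by positivity) ?_).ne'
      have := nu_lt_one hμ
      rw [← hν] at this
      exact mul_lt_of_lt_one_left hpi this
    exact_mod_cast this
  set p : ℂ := ν * Complex.I with hp
  have hp0 : p ≠ 0 := by simp [hp, hνc]
  have hsp : Complex.sinh (Real.pi * p) = Complex.sin (ν * Real.pi) * Complex.I := by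
    rw [← Complex.sinh_mul_I]; congr 1; rw [hp]; ring
  have hcp : Complex.cosh (Real.pi * p) = Complex.cos (ν * Real.pi) := by
    rw [← Complex.cosh_mul_I]; congr 1; rw [hp]; ring
  have hsp0 : Complex.sinh (Real.pi * p) ≠ 0 := by simp [hsp, hs]
  have heq : (fun z => doubleFactor μ p z * Complex.exp (Complex.I * τ * z)) =ᶠ[𝓝 p]
      fun z => z ^ 3 * Complex.exp (Complex.I * τ * z) /
        (8 * Real.pi ^ 3 * μ ^ 2 * (shc (2 * μ * (z - p)) ^ 2 * Complex.sinh (Real.pi * z))) := by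
    filter_upwards [isOpen_ne.mem_nhds hp0] with z hz
    have hz' : (z : ℂ) ≠ 0 := hz
    rw [doubleFactor, ← mul_shc, div_eq_mul_inv]
    simp only [mul_inv]
    field_simp
  rw [heq.deriv_eq]
  have d0 : HasDerivAt (fun z : ℂ => 2 * (μ : ℂ) * (z - p)) (2 * μ * 1) p :=
    ((hasDerivAt_id p).sub_const p).const_mul _
  have d1 : HasDerivAt (fun z : ℂ => shc (2 * μ * (z - p))) (0 * (2 * μ * 1)) p := by
    refine HasDerivAt.comp (h₂ := shc) p ?_ d0
    rw [sub_self, mul_zero]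
    exact hasDerivAt_shc_zero
  have d2 : HasDerivAt (fun z : ℂ => Complex.sinh (Real.pi * z))
      (Complex.cosh (Real.pi * p) * (Real.pi * 1)) p :=
    ((hasDerivAt_id p).const_mul (Real.pi : ℂ)).csinh
  have d3 : HasDerivAt (fun z : ℂ => Complex.exp (Complex.I * τ * z))
      (Complex.exp (Complex.I * τ * p) * (Complex.I * τ * 1)) p :=
    ((hasDerivAt_id p).const_mul (Complex.I * τ)).cexp
  have dn := ((hasDerivAt_id p).fun_pow 3).mul d3
  have dd := ((d1.fun_pow 2).mul d2).const_mul (8 * (Real.pi : ℂ) ^ 3 * μ ^ 2)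
  have hμc : (μ : ℂ) ≠ 0 := by exact_mod_cast hμ0.ne'
  have hall := dn.div dd (by simp [shc_zero, hsp0, hpc, hμc])
  have hall' := hall.deriv
  simp only [id, Pi.mul_apply, sub_self, mul_zero, shc_zero, hsp, hcp] at hall'
  have hexp : Complex.exp (Complex.I * τ * p) = Complex.exp (-(τ * ν)) := by
    congr 1; rw [hp]; linear_combination (τ * ν) * Complex.I_mul_I
  refine Eq.trans ?_ (hall'.trans ?_)
  · rfl
  · rw [hexp, coeffC, coeffC', Complex.ofReal_cot, Complex.cot]
    push_cast
    rw [hμν, hp]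
    have hI2 : Complex.I ^ 2 = -1 := Complex.I_sq
    field_simp
    rw [hI2]
    ring
end

end UnwoundWorm

/-! ### Shifting the kernel integral past both poles -/

namespace UnwoundWorm
open MeasureTheory Filter Topology Set

theorem norm_exp_I_mul_mul (τ z : ℂ) :
    ‖Complex.exp (Complex.I * τ * z)‖ = Real.exp (-(τ.re * z.im) - τ.im * z.re) := by
  rw [Complex.norm_exp]
  congr 1
  simp
  ring

section
variable {μ : ℝ}

theorem norm_exp_I_mul_mul_le (τ z : ℂ) : ‖Complex.exp (Complex.I * τ * z)‖ ≤
    Real.exp (-(τ.re * z.im)) * Real.exp (|τ.im| * |z.re|) := by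
  rw [norm_exp_I_mul_mul, ← Real.exp_add, ← abs_mul]
  refine Real.exp_le_exp.2 ?_
  linarith [neg_abs_le (τ.im * z.re)]

theorem norm_symbol_mul_exp_le (hμ : Real.pi / 2 < μ) (τ : ℂ) {z : ℂ} (hz : 1 ≤ |z.re|)
    (h2 : |z.im| ≤ 2) : ‖symbol μ z * Complex.exp (Complex.I * τ * z)‖ ≤
      1824 * Real.exp (2 * |τ.re|) *
        ((1 + |z.re|) ^ 3 * Real.exp (-(2 * halfWidth μ - |τ.im|) * |z.re|)) := by
  have h3 : Real.exp (-(τ.re * z.im)) ≤ Real.exp (2 * |τ.re|) := by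
    refine Real.exp_le_exp.2 ((neg_le_abs _).trans ?_)
    rw [abs_mul, mul_comm]
    gcongr
  rw [norm_mul]
  calc ‖symbol μ z‖ * ‖Complex.exp (Complex.I * τ * z)‖
      ≤ (1824 * (1 + |z.re|) ^ 3 * Real.exp (-(2 * halfWidth μ) * |z.re|)) *
          (Real.exp (2 * |τ.re|) * Real.exp (|τ.im| * |z.re|)) := by
        refine mul_le_mul (norm_symbol_le hμ hz h2) ((norm_exp_I_mul_mul_le τ z).trans ?_)
          (norm_nonneg _) (by positivity)
        exact mul_le_mul_of_nonneg_right h3 (Real.exp_pos _).le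
    _ = 1824 * Real.exp (2 * |τ.re|) * ((1 + |z.re|) ^ 3 *
          (Real.exp (-(2 * halfWidth μ) * |z.re|) * Real.exp (|τ.im| * |z.re|))) := by ring
    _ = _ := by rw [← Real.exp_add]; ring_nf

theorem exists_norm_line_le (hμ : Real.pi / 2 < μ) {h : ℝ} (hh : |h| ≤ 2)
    (hc : Continuous fun x : ℝ => symbol μ (x + h * Complex.I)) :
    ∃ C, 0 ≤ C ∧ ∀ (τ : ℂ) (x : ℝ), ‖symbol μ (x + h * Complex.I) *
      Complex.exp (Complex.I * τ * (x + h * Complex.I))‖ ≤ C * Real.exp (-(τ.re * h)) *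
        ((1 + |x|) ^ 3 * Real.exp (-(2 * halfWidth μ - |τ.im|) * |x|)) := by
  have hβ : 0 < halfWidth μ := by rw [halfWidth]; linarith [Real.pi_pos]
  have hre : ∀ x : ℝ, ((x : ℂ) + h * Complex.I).re = x := fun x => by simp
  have him : ∀ x : ℝ, ((x : ℂ) + h * Complex.I).im = h := fun x => by simp
  obtain ⟨C, hC0, hC⟩ := exists_norm_le_of_continuousOn isClosed_univ hc.continuousOn
    (a := 2 * halfWidth μ) (C := 1824) (by linarith) (by
      intro x _ hx
      have := norm_symbol_le hμ (z := (x : ℂ) + h * Complex.I) (by rwa [hre]) (by rwa [him])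
      rwa [hre] at this)
  refine ⟨C, hC0, fun τ x => ?_⟩
  have h1 := norm_exp_I_mul_mul_le τ ((x : ℂ) + h * Complex.I)
  rw [hre, him] at h1
  rw [norm_mul]
  calc _ ≤ (C * (1 + |x|) ^ 3 * Real.exp (-(2 * halfWidth μ) * |x|)) *
        (Real.exp (-(τ.re * h)) * Real.exp (|τ.im| * |x|)) :=
        mul_le_mul (hC x (mem_univ x)) h1 (norm_nonneg _) (by positivity)
    _ = C * Real.exp (-(τ.re * h)) * ((1 + |x|) ^ 3 *
          (Real.exp (-(2 * halfWidth μ) * |x|) * Real.exp (|τ.im| * |x|))) := by ring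
    _ = _ := by rw [← Real.exp_add]; ring_nf

theorem integrable_symbol_line (hμ : Real.pi / 2 < μ) {h : ℝ} (hh : |h| ≤ 2)
    (hc : Continuous fun x : ℝ => symbol μ (x + h * Complex.I)) {τ : ℂ}
    (hτ : |τ.im| < 2 * halfWidth μ) : Integrable fun x : ℝ => symbol μ (x + h * Complex.I) *
      Complex.exp (Complex.I * τ * (x + h * Complex.I)) := by
  obtain ⟨C, -, hC⟩ := exists_norm_line_le hμ hh hc
  refine ((integrable_one_add_pow_mul_exp (sub_pos.2 hτ)).const_mul _).mono'
    (Continuous.aestronglyMeasurable (hc.mul (by fun_prop))) (Eventually.of_forall (hC τ))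

/-- If |Im τ| ≤ 2β - δ, the integrand decays like e^{-δ|x|} up to a polynomial and an absolute
estimate suffices. If |Re τ| ≥ δ, the factor e^{-τh} is taken out and each half-line is estimated by
`exists_norm_halfLine_le` with σ = ±iτ, for which |Im σ| = |Re τ|. Evenness of the symbol turns the
negative half-line into a positive one at height -h. -/
theorem exists_norm_integral_line_le (hμ : Real.pi / 2 < μ) {h : ℝ} (hh : |h| ≤ 2)
    (hc : Continuous fun x : ℝ => symbol μ (x + h * Complex.I)) {δ : ℝ} (hδ : 0 < δ) :
    ∃ C, ∀ τ : ℂ, |τ.im| < 2 * halfWidth μ → (δ ≤ |τ.re| ∨ |τ.im| ≤ 2 * halfWidth μ - δ) →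
      ‖∫ x : ℝ, symbol μ (x + h * Complex.I) *
        Complex.exp (Complex.I * τ * (x + h * Complex.I))‖ ≤ C * Real.exp (-(τ.re * h)) := by
  obtain ⟨C, hC0, hC⟩ := exists_norm_line_le hμ hh hc
  have hneg : ∀ x : ℝ, symbol μ (((-x : ℝ) : ℂ) + h * Complex.I) =
      symbol μ ((x : ℂ) + ((-h : ℝ) : ℂ) * Complex.I) := fun x => by
    rw [← symbol_neg]; push_cast; ring_nf
  have hc' : Continuous fun x : ℝ => symbol μ (x + ((-h : ℝ) : ℂ) * Complex.I) := by
    simp only [← hneg]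
    exact hc.comp continuous_neg
  obtain ⟨A, hA⟩ := exists_norm_halfLine_le hμ hh hc hδ
  obtain ⟨A', hA'⟩ := exists_norm_halfLine_le hμ (h := -h) (by rwa [abs_neg]) hc' hδ
  set J := ∫ x : ℝ, (1 + |x|) ^ 3 * Real.exp (-δ * |x|) with hJ
  refine ⟨max (C * J) (A' + A), fun τ hτ hcase => ?_⟩
  rcases hcase with hR | hI
  · refine le_trans ?_ (mul_le_mul_of_nonneg_right (le_max_right _ _) (Real.exp_pos _).le)
    have e : ∀ x : ℝ, symbol μ (x + h * Complex.I) *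
        Complex.exp (Complex.I * τ * (x + h * Complex.I)) = Complex.exp (-(τ * h)) *
          (symbol μ (x + h * Complex.I) * Complex.exp (Complex.I * τ * x)) := fun x => by
      have : Complex.exp (Complex.I * τ * (x + h * Complex.I)) =
          Complex.exp (-(τ * h)) * Complex.exp (Complex.I * τ * x) := by
        rw [← Complex.exp_add]
        congr 1
        linear_combination (τ * h) * Complex.I_mul_I
      rw [this]; ring
    have hi := integrable_symbol_line hμ hh hc hτ
    simp only [e] at hi ⊢
    have hi2 : Integrable fun x : ℝ =>
        symbol μ (x + h * Complex.I) * Complex.exp (Complex.I * τ * x) :=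
      (integrable_const_mul_iff (IsUnit.mk0 _ (Complex.exp_ne_zero _)) _).1 hi
    have hn : ‖Complex.exp (-(τ * h))‖ = Real.exp (-(τ.re * h)) := by
      rw [Complex.norm_exp]; simp
    rw [integral_const_mul, norm_mul, hn, mul_comm]
    refine mul_le_mul_of_nonneg_right ?_ (Real.exp_pos _).le
    rw [← intervalIntegral.integral_Iic_add_Ioi hi2.integrableOn hi2.integrableOn (b := 0)]
    refine (norm_add_le _ _).trans (add_le_add ?_ ?_)
    · have h1 := integral_comp_neg_Ioi (0 : ℝ) fun x : ℝ =>
        symbol μ (x + h * Complex.I) * Complex.exp (Complex.I * τ * x)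
      rw [neg_zero] at h1
      rw [← h1]
      simp only [hneg]
      have h2 := hA' (-(Complex.I * τ)) (by simpa using hτ) (by simpa using hR)
      refine le_of_eq_of_le ?_ h2
      congr 2
      funext x
      push_cast
      ring_nf
    · exact hA (Complex.I * τ) (by simpa using hτ) (by simpa using hR)
  · refine le_trans ?_ (mul_le_mul_of_nonneg_right (le_max_left _ _) (Real.exp_pos _).le)
    have hi := (integrable_one_add_pow_mul_exp hδ).const_mul (C * Real.exp (-(τ.re * h)))
    refine (norm_integral_le_of_norm_le hi (Eventually.of_forall fun x => (hC τ x).trans ?_)).trans ?_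
    · refine mul_le_mul_of_nonneg_left ?_ (by positivity)
      refine mul_le_mul_of_nonneg_left (Real.exp_le_exp.2 ?_) (by positivity)
      nlinarith [abs_nonneg x]
    · rw [integral_const_mul]
      exact le_of_eq (by ring)

theorem continuous_symbol_line {H : ℂ → ℂ} {p : ℂ} {n : ℕ} {h : ℝ}
    (hH : ∀ z : ℂ, z.im = h → DifferentiableAt ℂ H z) (hp : p.im ≠ h)
    (hF : ∀ z : ℂ, z.im = h → symbol μ z = H z * ((z - p) ^ n)⁻¹) :
    Continuous fun x : ℝ => symbol μ (x + h * Complex.I) := by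
  have him : ∀ x : ℝ, ((x : ℂ) + h * Complex.I).im = h := fun x => by simp
  have e : (fun x : ℝ => symbol μ (x + h * Complex.I)) = fun x : ℝ =>
      H (x + h * Complex.I) * ((x + h * Complex.I - p) ^ n)⁻¹ := funext fun x => hF _ (him x)
  rw [e]
  refine Continuous.mul ?_ (Continuous.inv₀ (by fun_prop) fun x => pow_ne_zero _ fun h0 => hp ?_)
  · exact continuous_iff_continuousAt.2 fun x =>
      (hH _ (him x)).continuousAt.comp (f := fun x : ℝ => (x : ℂ) + h * Complex.I)
        (Continuous.continuousAt (by fun_prop))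
  · rw [← sub_eq_zero.1 h0, him]

theorem integral_line_sub_integral_line_symbol (hμ : Real.pi / 2 < μ) {H : ℂ → ℂ} {p : ℂ}
    {n : ℕ} {lo hi a b : ℝ} (hH : ∀ z : ℂ, lo < z.im → z.im < hi → DifferentiableAt ℂ H z)
    (hF : ∀ z : ℂ, lo < z.im → symbol μ z = H z * ((z - p) ^ (n + 1))⁻¹)
    (ha0 : -2 ≤ a) (hb2 : b ≤ 2) (hla : lo < a) (hap : a < p.im) (hpb : p.im < b) (hbh : b < hi)
    {τ : ℂ} (hτ : |τ.im| < 2 * halfWidth μ) :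
    (∫ x : ℝ, symbol μ (x + a * Complex.I) * Complex.exp (Complex.I * τ * (x + a * Complex.I))) -
      (∫ x : ℝ, symbol μ (x + b * Complex.I) * Complex.exp (Complex.I * τ * (x + b * Complex.I))) =
      2 * Real.pi * Complex.I * taylorCoeff p n (fun z => H z * Complex.exp (Complex.I * τ * z)) := by
  have hca : Continuous fun x : ℝ => symbol μ (x + a * Complex.I) :=
    continuous_symbol_line (fun z hz => hH z (by linarith) (by linarith)) hap.ne'
      fun z hz => hF z (by linarith)
  have hcb : Continuous fun x : ℝ => symbol μ (x + b * Complex.I) :=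
    continuous_symbol_line (fun z hz => hH z (by linarith) (by linarith)) hpb.ne
      fun z hz => hF z (by linarith)
  have hB := (tendsto_one_add_pow_mul_exp (sub_pos.2 hτ)).const_mul
    (1824 * Real.exp (2 * |τ.re|))
  rw [mul_zero] at hB
  refine integral_line_sub_integral_line (T₀ := 1)
    (F := fun z => symbol μ z * Complex.exp (Complex.I * τ * z)) hB (fun z hz h1 => ?_)
    (integrable_symbol_line hμ (abs_le.2 ⟨by linarith, by linarith⟩) hca hτ)
    (integrable_symbol_line hμ (abs_le.2 ⟨by linarith, by linarith⟩) hcb hτ) n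
    (U := {z : ℂ | z.im ∈ Ioo lo hi}) (isOpen_Ioo.preimage Complex.continuous_im)
    (fun z hz => ?_) (fun z hz => ⟨by linarith [hz.1], by linarith [hz.2]⟩) hap hpb
    (fun z hz _ => ?_)
  · exact norm_symbol_mul_exp_le hμ τ h1 (abs_le.2 ⟨by linarith [hz.1], by linarith [hz.2]⟩)
  · exact ((hH z hz.1 hz.2).mul (by fun_prop)).differentiableWithinAt
  · rw [hF z (by linarith [hz.1])]
    ring

/-- The poles are crossed one at a time, with an intermediate line between ν and ν', so that each
crossing needs only the factorisation at a single pole. -/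
theorem exists_contour (hμ : Real.pi / 2 < μ) : ∃ (h hi : ℝ) (H : ℂ → ℂ), nu' μ < h ∧ h ≤ 2 ∧
    nu' μ < hi ∧ (Continuous fun x : ℝ => symbol μ (x + h * Complex.I)) ∧
    (∀ z : ℂ, nu μ < z.im → z.im < hi → DifferentiableAt ℂ H z) ∧
    ∀ τ : ℂ, |τ.im| < 2 * halfWidth μ →
      (∫ ξ : ℝ, kernelIntegrand μ τ ξ) - 2 * Real.pi * Complex.I *
        (Complex.exp (-(τ * nu μ)) * (coeffC (nu μ) * τ + coeffC' (nu μ))) =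
      2 * Real.pi * Complex.I * taylorCoeff (nu' μ * Complex.I) (remainderDegree μ)
        (fun z => H z * Complex.exp (Complex.I * τ * z)) +
      ∫ x : ℝ, symbol μ (x + h * Complex.I) *
        Complex.exp (Complex.I * τ * (x + h * Complex.I)) := by
  have hμ0 : 0 < μ := by linarith [Real.pi_pos]
  have hν0 := nu_pos hμ0
  have hν1 := nu_lt_one hμ
  have hνν := nu_lt_nu' hμ
  have hν'1 := nu'_le_one μ
  obtain ⟨hi, hhi, H, hH, hHF⟩ := exists_second_pole hμ
  obtain ⟨h₁, h1l, h1u⟩ := exists_between hνν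
  -- The new line must lie below `hi`, where H is regular, and below 2, the height up to which the
  -- symbol bounds are stated.
  obtain ⟨h₂, h2l, h2u⟩ := exists_between (lt_min hhi (show nu' μ < 2 by linarith))
  have h2hi := h2u.trans_le (min_le_left _ _)
  have h22 := h2u.trans_le (min_le_right _ _)
  have hp1 : ((nu μ : ℂ) * Complex.I).im = nu μ := by simp
  have hp2 : ((nu' μ : ℂ) * Complex.I).im = nu' μ := by simp
  refine ⟨h₂, hi, H, h2l, h22.le, hhi, continuous_symbol_line
    (fun z hz => hH z (by linarith) (by linarith)) (by rw [hp2]; exact h2l.ne)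
    fun z hz => hHF z (by linarith), hH, fun τ hτ => ?_⟩
  -- With exponent n = 0 the pole is fictitious; any point off the line can serve as p.
  have hc0 : ∀ y : ℝ, |y| < nu μ → Continuous fun x : ℝ => symbol μ (x + y * Complex.I) :=
    fun y hy => continuous_symbol_line (p := (y + 1) * Complex.I) (n := 0)
      (fun z hz => differentiableAt_symbol_of_abs_im_lt hμ (by rwa [hz])) (by simp)
      fun z _ => by simp
  have hn2 : |nu μ / 2| < nu μ := by rw [abs_of_pos (by linarith)]; linarith
  have hB := (tendsto_one_add_pow_mul_exp (sub_pos.2 hτ)).const_mul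
    (1824 * Real.exp (2 * |τ.re|))
  rw [mul_zero] at hB
  -- The real line is first lifted to height ν/2, without crossing a pole, because the factorisation
  -- at iν is available only for Im z > 0.
  have s0 := integral_line_eq (T₀ := 1) (a := 0) (b := nu μ / 2)
    (F := fun z => symbol μ z * Complex.exp (Complex.I * τ * z)) (by linarith) hB
    (fun z hz h1 => norm_symbol_mul_exp_le hμ τ h1
      (abs_le.2 ⟨by linarith [hz.1], by linarith [hz.2]⟩))
    (integrable_symbol_line hμ (by simp) (hc0 0 (by simpa)) hτ)
    (integrable_symbol_line hμ (by linarith) (hc0 _ hn2) hτ)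
    (fun z hz => ((differentiableAt_symbol_of_abs_im_lt hμ (abs_lt.2
      ⟨by linarith [hz.1], by linarith [hz.2]⟩)).mul (by fun_prop)).differentiableWithinAt)
  have s1 := integral_line_sub_integral_line_symbol hμ (n := 1)
    (fun z => differentiableAt_doubleFactor_first (μ := μ) hμ0 (z := z))
    (fun z => symbol_eq_first_pole (μ := μ) hμ0 (z := z))
    (a := nu μ / 2) (b := h₁) (by linarith) (by linarith) (by linarith)
    (by rw [hp1]; linarith) (by rw [hp1]; linarith) h1u hτ
  rw [taylorCoeff_one, deriv_doubleFactor_mul_exp hμ] at s1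
  have s2 := integral_line_sub_integral_line_symbol hμ hH hHF (a := h₁) (b := h₂)
    (by linarith) (by linarith) h1l (by rw [hp2]; linarith) (by rw [hp2]; linarith) h2hi hτ
  have sk : ∫ ξ : ℝ, kernelIntegrand μ τ ξ = ∫ x : ℝ, symbol μ (x + (0 : ℝ) * Complex.I) *
      Complex.exp (Complex.I * τ * (x + (0 : ℝ) * Complex.I)) := by
    refine integral_congr_ae ?_
    filter_upwards [(measure_eq_zero_iff_ae_notMem.1 (measure_singleton (0 : ℝ)) :
      ∀ᵐ x : ℝ, x ∉ ({0} : Set ℝ))] with x hx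
    rw [kernelIntegrand_eq_symbol hμ0.ne' τ (by simpa using hx)]
    simp
  rw [sk, s0]
  linear_combination s1 + s2

end

end UnwoundWorm

/-! ### The remainder estimate and the symmetry of the kernel -/

namespace UnwoundWorm
open MeasureTheory Filter Topology Set

section
variable {μ : ℝ}

/-- Cauchy's estimate on a disc of radius r = s/(1 + Re τ): there Re τ · r ≤ 1, so e^{iτz} exceeds
e^{-q Re τ} by at most a bounded factor, while (2/r)^n produces (1 + Re τ)^n. A pole of order n + 1
thus costs a polynomial of degree n. -/
theorem exists_norm_taylorCoeff_mul_exp_le {H : ℂ → ℂ} {lo hi q : ℝ} (n : ℕ) (hlo : lo < q)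
    (hhi : q < hi) (hH : ∀ z : ℂ, lo < z.im → z.im < hi → DifferentiableAt ℂ H z) (b : ℝ) :
    ∃ C, 0 ≤ C ∧ ∀ τ : ℂ, 0 < τ.re → |τ.im| ≤ b →
      ‖taylorCoeff (q * Complex.I) n fun z => H z * Complex.exp (Complex.I * τ * z)‖ ≤
        C * (1 + τ.re) ^ n * Real.exp (-(τ.re * q)) := by
  set p : ℂ := q * Complex.I with hp
  set s : ℝ := min 1 (min ((q - lo) / 2) ((hi - q) / 2)) with hs
  have hs0 : 0 < s := lt_min one_pos (lt_min (by linarith) (by linarith))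
  have hs1 : s ≤ 1 := min_le_left _ _
  have hslo : s ≤ (q - lo) / 2 := (min_le_right _ _).trans (min_le_left _ _)
  have hshi : s ≤ (hi - q) / 2 := (min_le_right _ _).trans (min_le_right _ _)
  have him : ∀ z : ℂ, |z.im - q| ≤ ‖z - p‖ := fun z => by
    simpa [hp] using Complex.abs_im_le_norm (z - p)
  have hre : ∀ z : ℂ, |z.re| ≤ ‖z - p‖ := fun z => by
    simpa [hp] using Complex.abs_re_le_norm (z - p)
  have hsub : Metric.closedBall p s ⊆ {z : ℂ | z.im ∈ Ioo lo hi} := fun z hz => by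
    rw [mem_closedBall_iff_norm] at hz
    have := abs_le.1 ((him z).trans hz)
    exact ⟨by linarith, by linarith⟩
  obtain ⟨M, hM⟩ := (isCompact_closedBall p s).exists_bound_of_continuousOn
    (fun z hz => (hH z (hsub hz).1 (hsub hz).2).continuousAt.continuousWithinAt)
  have hM0 : 0 ≤ M := (norm_nonneg _).trans (hM p (Metric.mem_closedBall_self hs0.le))
  refine ⟨M * Real.exp (1 + |b|) * (2 / s) ^ n, by positivity, fun τ hτ hτb => ?_⟩
  set r := s / (1 + τ.re) with hr
  have hr0 : 0 < r := by positivity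
  have hrs : r ≤ s := div_le_self hs0.le (by linarith)
  have hr1 : τ.re * r ≤ 1 := by
    rw [hr, ← mul_div_assoc, div_le_one (by linarith)]
    nlinarith
  have hbound : ∀ z ∈ Metric.closedBall p r, ‖H z * Complex.exp (Complex.I * τ * z)‖ ≤
      M * (Real.exp (-(τ.re * q)) * Real.exp (1 + |b|)) := by
    intro z hz
    rw [norm_mul, ← Real.exp_add]
    refine mul_le_mul (hM z (Metric.closedBall_subset_closedBall hrs hz)) ?_ (norm_nonneg _) hM0
    rw [mem_closedBall_iff_norm] at hz
    rw [norm_exp_I_mul_mul]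
    refine Real.exp_le_exp.2 ?_
    have h1 := (abs_le.1 ((him z).trans hz)).1
    have h2 : -(τ.im * z.re) ≤ |b| := by
      refine (neg_le_abs _).trans ?_
      rw [abs_mul]
      calc |τ.im| * |z.re| ≤ |b| * 1 := mul_le_mul (hτb.trans (le_abs_self b))
            ((hre z).trans (hz.trans (hrs.trans hs1))) (abs_nonneg _) (abs_nonneg _)
        _ = |b| := mul_one _
    nlinarith
  refine (norm_taylorCoeff_le hr0 n (isOpen_Ioo.preimage Complex.continuous_im)
    (fun z hz => ((hH z hz.1 hz.2).mul (by fun_prop)).differentiableWithinAt)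
    ((Metric.closedBall_subset_closedBall hrs).trans hsub) hbound).trans (le_of_eq ?_)
  rw [hr, div_div_eq_mul_div, mul_div_right_comm, mul_pow]
  ring

/-- The expansion of the kernel to the right of the imaginary axis. -/
theorem exists_norm_integral_sub_le (hμ : Real.pi / 2 < μ) {δ : ℝ} (hδ : 0 < δ) :
    ∃ A, ∀ τ : ℂ, |τ.im| < 2 * halfWidth μ → (δ ≤ |τ.re| ∨ |τ.im| ≤ 2 * halfWidth μ - δ) →
      0 < τ.re → ‖(∫ ξ : ℝ, kernelIntegrand μ τ ξ) - 2 * Real.pi * Complex.I *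
        (Complex.exp (-(τ * nu μ)) * (coeffC (nu μ) * τ + coeffC' (nu μ)))‖ ≤
      A * (1 + |τ.re|) ^ remainderDegree μ * Real.exp (-(τ.re * nu' μ)) := by
  obtain ⟨h, hi, H, hh, hh2, hhi, hc, hH, heq⟩ := exists_contour hμ
  have hν'0 : 0 < nu' μ :=
    (nu_pos (μ := μ) (by linarith [Real.pi_pos])).trans (nu_lt_nu' hμ)
  obtain ⟨C, hC0, hC⟩ := exists_norm_taylorCoeff_mul_exp_le (remainderDegree μ)
    (nu_lt_nu' hμ) hhi hH (2 * halfWidth μ)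
  obtain ⟨D, hD⟩ := exists_norm_integral_line_le hμ
    (abs_le.2 ⟨by linarith, hh2⟩) hc hδ
  refine ⟨2 * Real.pi * C + |D|, fun τ hτ hcase hre => ?_⟩
  rw [heq τ hτ, abs_of_pos hre]
  have h1 : ‖2 * (Real.pi : ℂ) * Complex.I‖ = 2 * Real.pi := by
    simp [abs_of_pos Real.pi_pos]
  have h2 : (1 : ℝ) ≤ (1 + τ.re) ^ remainderDegree μ := one_le_pow₀ (by linarith)
  -- As h > ν', the integral on the shifted line is absorbed by the error term of the pole iν'.
  have h3 : Real.exp (-(τ.re * h)) ≤ Real.exp (-(τ.re * nu' μ)) :=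
    Real.exp_le_exp.2 (by nlinarith)
  refine (norm_add_le _ _).trans ?_
  rw [norm_mul, h1, add_mul, add_mul]
  refine add_le_add ?_ ?_
  · refine (mul_le_mul_of_nonneg_left (hC τ hre hτ.le) (by positivity)).trans_eq ?_
    ring
  · calc _ ≤ D * Real.exp (-(τ.re * h)) := hD τ hτ hcase
      _ ≤ |D| * Real.exp (-(τ.re * h)) := by gcongr; exact le_abs_self D
      _ ≤ |D| * 1 * Real.exp (-(τ.re * nu' μ)) := by rw [mul_one]; gcongr
      _ ≤ _ := by gcongr

/-- The substitution ξ ↦ -ξ, with ξ³ and sinh(πξ) both odd. It reduces Re τ < 0 to Re τ > 0. -/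
theorem integral_kernelIntegrand_neg (μ : ℝ) (τ : ℂ) :
    ∫ ξ : ℝ, kernelIntegrand μ (-τ) ξ = ∫ ξ : ℝ, kernelIntegrand μ τ ξ := by
  rw [← integral_neg_eq_self]
  refine integral_congr_ae (Eventually.of_forall fun ξ => ?_)
  simp only [kernelIntegrand, mul_neg, Real.sinh_neg]
  push_cast
  rw [neg_mul_neg, neg_sq, mul_neg, div_neg, Odd.neg_pow (by decide), neg_mul, neg_div, neg_neg]

end

end UnwoundWorm

/-! ### Assembly of the four statements -/

theorem mainTheorem5 (μ : ℝ) (hμ : 0 < μ) :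
    -- for all `j, k`: the isometric isomorphism and the transfer of the reproducing kernels
    (∀ j k : ℤ,
      (∃ L : isotypic (unwoundDomain μ) j k ≃ₗ[ℂ] weightedBergman μ j k,
        (∀ (G : isotypic (unwoundDomain μ) j k) (w : unwoundDomain μ),
          (L G).1 (proj μ w) = G.1 w * w.1.2.1 ^ (-j) * w.1.2.2 ^ (-k)) ∧
        (∀ F G : isotypic (unwoundDomain μ) j k,
          bergmanInner (strip (halfWidth μ)) (weightedVolume μ j k) (L F).1 (L G).1 =
            bergmanInner (unwoundDomain μ) MeasureTheory.volume F.1 G.1)) ∧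
      (∃! K : strip (halfWidth μ) → strip (halfWidth μ) → ℂ,
        IsReproducingKernel (strip (halfWidth μ)) (weightedVolume μ j k)
          (weightedBergman μ j k) K) ∧
      (∀ K : strip (halfWidth μ) → strip (halfWidth μ) → ℂ,
        IsReproducingKernel (strip (halfWidth μ)) (weightedVolume μ j k)
          (weightedBergman μ j k) K →
        IsReproducingKernel (unwoundDomain μ) MeasureTheory.volume
          (isotypic (unwoundDomain μ) j k)
          (fun w w' => K (proj μ w) (proj μ w') * (w.1.2.1 * conj w'.1.2.1) ^ j *
            (w.1.2.2 * conj w'.1.2.2) ^ k))) ∧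
    -- the reproducing kernel for `j = k = -1`
    (∀ K : strip (halfWidth μ) → strip (halfWidth μ) → ℂ,
      IsReproducingKernel (strip (halfWidth μ)) (weightedVolume μ (-1) (-1))
        (weightedBergman μ (-1) (-1)) K →
      (∀ ζ ζ' : strip (halfWidth μ),
        MeasureTheory.Integrable (kernelIntegrand μ (ζ.1 - conj ζ'.1)) ∧
        K ζ ζ' = ∫ ξ : ℝ, kernelIntegrand μ (ζ.1 - conj ζ'.1) ξ) ∧
      -- its expansion for `μ > π / 2`
      (Real.pi / 2 < μ →
        nu μ < 1 ∧ nu μ < nu' μ ∧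
        ∀ δ : ℝ, 0 < δ → ∃ A : ℝ, ∀ (ζ ζ' : strip (halfWidth μ)) (τ : ℂ),
          τ = ζ.1 - conj ζ'.1 →
          (δ ≤ |τ.re| ∨ |τ.im| ≤ 2 * halfWidth μ - δ) →
          (0 < τ.re →
            ‖K ζ ζ' - 2 * (Real.pi : ℂ) * Complex.I * (Complex.exp (-(τ * nu μ)) *
                (coeffC (nu μ) * τ + coeffC' (nu μ)))‖ ≤
              A * (1 + |τ.re|) ^ remainderDegree μ * Real.exp (-(τ.re * nu' μ))) ∧
          (τ.re < 0 →
            ‖K ζ ζ' + 2 * (Real.pi : ℂ) * Complex.I * (Complex.exp (τ * nu μ) *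
                (coeffC (nu μ) * τ - coeffC' (nu μ)))‖ ≤
              A * (1 + |τ.re|) ^ remainderDegree μ * Real.exp (τ.re * nu' μ)))) := by
  refine ⟨fun j k => ⟨isotypic_isometry hμ j k,
    ⟨_, isReproducingKernel_weightedBergman hμ j k, fun K hK =>
      hK.unique (isReproducingKernel_weightedBergman hμ j k)⟩,
    fun K hK => isReproducingKernel_isotypic hμ hK⟩, fun K hK => ?_⟩
  have hKτ : ∀ ζ ζ' : strip (halfWidth μ), K ζ ζ' =
      ∫ ξ : ℝ, kernelIntegrand μ (ζ.1 - conj ζ'.1) ξ := fun ζ ζ' => by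
    rw [hK.unique (isReproducingKernel_weightedBergman hμ (-1) (-1))]
    exact stripKernel_eq_integral hμ _
  refine ⟨fun ζ ζ' => ⟨integrable_kernelIntegrand hμ (abs_im_sub_conj_lt ζ ζ'), hKτ ζ ζ'⟩,
    fun h2μ => ⟨nu_lt_one h2μ, nu_lt_nu' h2μ, fun δ hδ => ?_⟩⟩
  obtain ⟨A, hA⟩ := exists_norm_integral_sub_le h2μ hδ
  refine ⟨A, fun ζ ζ' τ hτ hcase => ?_⟩
  have him : |τ.im| < 2 * halfWidth μ := hτ ▸ abs_im_sub_conj_lt ζ ζ'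
  rw [hKτ, ← hτ]
  refine ⟨fun hre => hA τ him hcase hre, fun hre => ?_⟩
  -- Both alternatives of the uniformity condition are symmetric under τ ↦ -τ, so the same constant
  -- A serves on the left.
  have h := hA (-τ) (by simpa using him) (by simpa using hcase) (by simpa using hre)
  rw [integral_kernelIntegrand_neg] at h
  refine le_of_eq_of_le (congrArg norm ?_) (h.trans_eq ?_)
  · rw [neg_mul, neg_neg]
    ring
  · simp
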